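/- Let $G=(V,E)$ be a finite simple graph, $b\ge 0$ an integer and $\beta:E\to\{0,1,2,3\}$. A polyline drawing of $G$ draws the vertices as distinct points of the plane and every edge as a simple polygonal curve joining its two end-points and passing through no other vertex; the points where consecutive segments of an edge meet (at an angle different from $180^\circ$) are its bends, and a crossing of two edges is a common point of their curves other than the end-points of these curves. A $b$-bend $\beta$-restricted RAC drawing of $G$ is a polyline drawing in which every crossing of two edges lies in the relative interiors of two orthogonal segments of these edges, the total number of bends is at most $b$, and every edge $e$ has at most $\beta(e)$ bends. The problem Bend-Restricted RAC Drawing asks, given $(G,b,\beta)$, whether $G$ admits a $b$-bend $\beta$-restricted RAC drawing. Theorem. Bend-Restricted RAC Drawing, where the input $(G,b,\beta)$ comes with a vertex cover $C$ of $G$ of size $k$ and is parameterized by $b+k$, admits a kernel of size $O((b+1)\cdot 2^{k})$. That is, there is an algorithm that runs in time polynomial in the encoding length of $(G,b,\beta,C)$ and outputs $(G',b',\beta',C')$, where $C'$ is a vertex cover of $G'$, such that 1. $G'$ admits a $b'$-bend $\beta'$-restricted RAC drawing if and only if $G$ admits a $b$-bend $\beta$-restricted RAC drawing; 2. the parameter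 $b'+|C'|$ and the encoding length of $(G',b',\beta',C')$ are bounded by $g(b+k)$ for some computable function $g$; 3. $|V(G')|+|E(G')|\le c\cdot (b+1)\cdot 2^{k}$ for an absolute constant $c$. -/

import Mathlib

noncomputable section

namespace RACDrawing

/-- The Euclidean plane. -/
abbrev Plane : Type := EuclideanSpace ℝ (Fin 2)

/-- A polyline drawing of a simple graph `G`. The vertex `v` is drawn at `pos v`; the edge `e` is
drawn as the union of the `bends e + 1` closed segments from `pt e i` to `pt e (i + 1)`,
`0 ≤ i ≤ bends e`, so that its bends are the points `pt e 1, …, pt e (bends e)`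
(the values `pt e i` for `i > bends e + 1` carry no information). -/
structure PolylineDrawing {V : Type*} (G : SimpleGraph V) where
  /-- the position of a vertex -/
  pos : V → Plane
  /-- the number of bends of an edge -/
  bends : G.edgeSet → ℕ
  /-- the successive corners of the polyline of an edge -/
  pt : G.edgeSet → ℕ → Plane
  /-- distinct vertices are drawn at distinct points -/
  pos_injective : Function.Injective pos
  /-- the polyline of an edge `uv` joins the points representing `u` and `v` -/
  ends : ∀ e, s(pt e 0, pt e (bends e + 1)) = Sym2.map pos e.1
  /-- all segments are nondegenerate -/
  nondegenerate : ∀ e, ∀ i ≤ bends e, pt e i ≠ pt e (i + 1)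
  /-- consecutive segments meet precisely in their shared end-point -/
  consecutive : ∀ e, ∀ i < bends e,
    segment ℝ (pt e i) (pt e (i + 1)) ∩ segment ℝ (pt e (i + 1)) (pt e (i + 2)) = {pt e (i + 1)}
  /-- consecutive segments close an angle different from `180°` -/
  bend_angle : ∀ e, ∀ i < bends e,
    EuclideanGeometry.angle (pt e i) (pt e (i + 1)) (pt e (i + 2)) ≠ Real.pi
  /-- every other pair of segments is disjoint -/
  nonconsecutive : ∀ e i j, i + 1 < j → j ≤ bends e →
    Disjoint (segment ℝ (pt e i) (pt e (i + 1))) (segment ℝ (pt e j) (pt e (j + 1)))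
  /-- an edge does not pass through a vertex that is not one of its end-points -/
  avoids : ∀ (v : V) (e : G.edgeSet), v ∉ e.1 →
    ∀ i ≤ bends e, pos v ∉ segment ℝ (pt e i) (pt e (i + 1))

namespace PolylineDrawing

variable {V : Type*} {G : SimpleGraph V}

/-- The point set `δ(e)` representing the edge `e`. -/
def curve (D : PolylineDrawing G) (e : G.edgeSet) : Set Plane :=
  {x | ∃ i ≤ D.bends e, x ∈ segment ℝ (D.pt e i) (D.pt e (i + 1))}

/-- The curve of the edge `e` without its two end-points, `int(δ(e))`. -/
def curveInt (D : PolylineDrawing G) (e : G.edgeSet) : Set Plane :=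
  D.curve e \ {D.pt e 0, D.pt e (D.bends e + 1)}

/-- The edges `e` and `f` have a right-angle crossing at `x`: the point `x` lies in the relative
interiors of a segment of `e` and a segment of `f` that are orthogonal to each other. -/
def RightAngleAt (D : PolylineDrawing G) (e f : G.edgeSet) (x : Plane) : Prop :=
  ∃ i ≤ D.bends e, ∃ j ≤ D.bends f,
    x ∈ openSegment ℝ (D.pt e i) (D.pt e (i + 1)) ∧
    x ∈ openSegment ℝ (D.pt f j) (D.pt f (j + 1)) ∧
    inner ℝ (D.pt e (i + 1) - D.pt e i) (D.pt f (j + 1) - D.pt f j) = 0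

/-- Every crossing is a right-angle crossing. Two orthogonal segments have at most one common
point, so the number of crossings of two edges is then automatically finite. -/
def IsRAC (D : PolylineDrawing G) : Prop :=
  ∀ e f : G.edgeSet, e ≠ f → ∀ x ∈ D.curveInt e ∩ D.curveInt f, D.RightAngleAt e f x

open Classical in
/-- The total number of bends, counted over all edges. -/
def totalBends [Fintype V] (D : PolylineDrawing G) : ℕ := ∑ e : G.edgeSet, D.bends e

end PolylineDrawing

/-- `G` admits a `b`-bend `β`-restricted RAC drawing. -/
def HasBendRestrictedRACDrawing {V : Type*} [Fintype V] (G : SimpleGraph V) (b : ℕ)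
    (β : G.edgeSet → Fin 4) : Prop :=
  ∃ D : PolylineDrawing G, D.IsRAC ∧ D.totalBends ≤ b ∧ ∀ e, D.bends e ≤ (β e : ℕ)

/-- An instance of Bend-Restricted RAC Drawing, provided with a vertex cover of its graph. -/
structure Instance where
  /-- the number of vertices -/
  n : ℕ
  /-- the graph -/
  G : SimpleGraph (Fin n)
  /-- the bound on the total number of bends -/
  b : ℕ
  /-- the bound on the number of bends of each single edge -/
  β : G.edgeSet → Fin 4
  /-- the provided vertex cover -/
  C : Finset (Fin n)
  /-- `C` is a vertex cover -/
  cover : G.IsVertexCover (C : Set (Fin n))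

namespace Instance

/-- The yes-instances. -/
def IsYes (I : Instance) : Prop := HasBendRestrictedRACDrawing I.G I.b I.β

/-- The size `k` of the provided vertex cover. -/
def k (I : Instance) : ℕ := I.C.card

/-- The parameter: the bend budget plus the size of the provided vertex cover. -/
def param (I : Instance) : ℕ := I.b + I.k

/-- The size of the graph: the number of its vertices plus the number of its edges. -/
def size (I : Instance) : ℕ := I.n + I.G.edgeSet.ncard

end Instance

/-- The input and output alphabet. -/
inductive Letter
  | bit (x : Bool)
  | entry (a : Option (Fin 4))
  | sep

namespace Instance

open Classical in
/-- The entry at `(i, j)` of the labelled adjacency matrix: `none` for a non-edge, and the label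
of the edge otherwise. -/
def label (I : Instance) (i j : Fin I.n) : Option (Fin 4) :=
  if h : I.G.Adj i j then some (I.β ⟨s(i, j), h⟩) else none

/-- The row of the vertex `i`: whether `i` belongs to the provided vertex cover, followed by the
row of `i` in the labelled adjacency matrix. -/
def encodeRow (I : Instance) (i : Fin I.n) : List Letter :=
  Letter.bit (decide (i ∈ I.C)) ::
    ((List.finRange I.n).map (fun j => Letter.entry (I.label i j)) ++ [Letter.sep])

/-- The encoding of an instance as a word: `b` in binary, and then the rows of all vertices. -/
def encode (I : Instance) : List Letter :=
  (Computability.encodeNat I.b).map Letter.bit ++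
    Letter.sep :: (List.finRange I.n).flatMap I.encodeRow

end Instance

/-- `f` is a kernelization of the parameterized problem with yes-instances `yes` and parameter
`param`, for instances encoded by `enc`: it is computable by a Turing machine in time polynomial in
the encoding length, it maintains the answer, and both the parameter and the encoding length of
the output are bounded by a computable function of the parameter of the input. -/
def IsKernelization {α Γ : Type} (enc : α → List Γ) (yes : α → Prop) (param : α → ℕ)
    (f : α → α) : Prop :=
  Nonempty (Turing.TM2ComputableInPolyTime enc enc f) ∧
  (∀ x, yes (f x) ↔ yes x) ∧
  ∃ g : ℕ → ℕ, Computable g ∧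
    ∀ x, param (f x) ≤ g (param x) ∧ (enc (f x)).length ≤ g (param x)

end RACDrawing

end

/-! Call an edge clean if it is drawn as a single segment without crossings. In a drawing with at
most `b` bends, only few edges at a vertex `x` are not clean (`DrawnOn.card_not_clean_le`). At most
`b` of them are bent. A straight edge `xu` with a crossing is crossed perpendicularly by a segment
with an end `p` that is a bend or a vertex of the cover `C`, so there are at most `k + b` choices
for `p`. The crossing is the foot of the perpendicular from `p`, so it lies on the Thales circle
over `xp`. If two edges `xu` and `xv` had distinct feet for the same `p` on the same side of `xp`, a
leg at `p` of one right triangle would cross a leg at `x` of the other (`legs_cross`); this crossing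
has to be perpendicular, and then two perpendiculars would drop from `p` to one line. A common foot
is impossible as well, because two segments from `x` cannot cross at a right angle. So every `p`
accounts for at most two edges, and at most `3 * (k + b)` edges at `x` are not clean.

Hence, among `9 * (k + b) + m` common neighbours of at most three vertices, some `m` have only clean
edges to these vertices. This is used twice.

Three vertices do not have 28 common neighbours with clean edges only (`DrawnOn.card_le_of_clean`):
by pigeonhole, two of the neighbours, `u` and `v`, lie on the same sides of the three lines spanned
in pairs. Planarity then forces the line `uv` to separate any two of the three vertices, but a line
has only two sides.

If a vertex has at most two neighbours, joined to it by clean edges, a further vertex with the same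
neighbours fits next to it, with straight edges that cross nothing
(`DrawnOn.exists_isTwinPosition`).

The kernel sorts the vertices by the list of their last three neighbours and keeps, besides `C`,
only the first ones with each list. Suppose that some vertex is dropped. If its list has length
three, neither graph has a drawing; otherwise the list is its whole neighbourhood, and it can be put
back as a twin. There are at most `(k + 1) ^ 3` lists of cover vertices, each kept `O(k + b + 1)`
times, and every vertex accounts for at most `k` edges to the cover. The total is `O((k + 1) ^ 5 *
(b + 1))`, which is `O((b + 1) * 2 ^ k)`.

Polynomial running time is shown by an explicit machine with several stacks. It holds the threshold
in unary, which is affordable because `min b n` may replace `b`. Pushing a row on a stack reverses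
it, so comparisons start at the right end; this is why the last neighbours are used. -/

noncomputable section

namespace RACDrawing

/-! ### Plane geometry of right-angle crossings -/

section Drawings

open Filter Topology

/-- The signed area of the parallelogram spanned by two vectors of the plane. -/
def cross (x y : Plane) : ℝ := x 0 * y 1 - x 1 * y 0

theorem inner_eq (x y : Plane) : inner ℝ x y = x 0 * y 0 + x 1 * y 1 := by
  simp [PiLp.inner_apply, Fin.sum_univ_two, mul_comm]

theorem plane_ext {x y : Plane} (h0 : x 0 = y 0) (h1 : x 1 = y 1) : x = y := by
  ext i; fin_cases i <;> assumption

theorem eq_of_sq_add_sq_eq_zero {x y : Plane} (h : (x 0 - y 0) ^ 2 + (x 1 - y 1) ^ 2 = 0) :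
    x = y := by
  have h' := (add_eq_zero_iff_of_nonneg (sq_nonneg _) (sq_nonneg _)).1 h
  exact plane_ext (sub_eq_zero.1 (pow_eq_zero_iff two_ne_zero |>.1 h'.1))
    (sub_eq_zero.1 (pow_eq_zero_iff two_ne_zero |>.1 h'.2))

theorem sq_add_sq_pos {x y : Plane} (h : x ≠ y) : 0 < (x 0 - y 0) ^ 2 + (x 1 - y 1) ^ 2 :=
  lt_of_le_of_ne (by positivity) fun h' => h (eq_of_sq_add_sq_eq_zero h'.symm)

theorem mem_segment_iff {x y z : Plane} :
    z ∈ segment ℝ x y ↔ ∃ t : ℝ, 0 ≤ t ∧ t ≤ 1 ∧ z 0 = x 0 + t * (y 0 - x 0) ∧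
      z 1 = x 1 + t * (y 1 - x 1) := by
  rw [segment_eq_image']
  constructor
  · rintro ⟨t, ⟨h0, h1⟩, rfl⟩
    exact ⟨t, h0, h1, by simp, by simp⟩
  · rintro ⟨t, h0, h1, h2, h3⟩
    exact ⟨t, ⟨h0, h1⟩, plane_ext (by simp [h2]) (by simp [h3])⟩

theorem mem_openSegment_iff {x y z : Plane} :
    z ∈ openSegment ℝ x y ↔ ∃ t : ℝ, 0 < t ∧ t < 1 ∧ z 0 = x 0 + t * (y 0 - x 0) ∧
      z 1 = x 1 + t * (y 1 - x 1) := by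
  rw [openSegment_eq_image']
  constructor
  · rintro ⟨t, ⟨h0, h1⟩, rfl⟩
    exact ⟨t, h0, h1, by simp, by simp⟩
  · rintro ⟨t, h0, h1, h2, h3⟩
    exact ⟨t, ⟨h0, h1⟩, plane_ext (by simp [h2]) (by simp [h3])⟩

theorem eq_zero_of_cross_eq_zero {x y z : Plane} (h : cross x y ≠ 0) (hx : cross z x = 0)
    (hy : cross z y = 0) : z = 0 := by
  simp only [cross] at *
  apply plane_ext
  · have : z 0 * (x 0 * y 1 - x 1 * y 0) = 0 := by linear_combination x 0 * hy - y 0 * hx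
    simpa [h] using this
  · have : z 1 * (x 0 * y 1 - x 1 * y 0) = 0 := by linear_combination x 1 * hy - y 1 * hx
    simpa [h] using this

/-- The interior of the right triangle argument in normalized coordinates. -/
theorem exists_params_of_thales {l₁ m₁ l₂ m₂ : ℝ} (h₁ : l₁ ^ 2 + m₁ ^ 2 = l₁)
    (h₂ : l₂ ^ 2 + m₂ ^ 2 = l₂) (hm₁ : 0 < m₁) (hm₂ : 0 < m₂) (hl : l₂ < l₁) :
    ∃ s t : ℝ, 0 < s ∧ s < 1 ∧ 0 < t ∧ t < 1 ∧ 1 + s * (l₂ - 1) = t * l₁ ∧ s * m₂ = t * m₁ := by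
  have l2p : 0 < l₂ := by nlinarith [sq_nonneg l₂]
  have l1p : 0 < l₁ := by nlinarith [sq_nonneg l₁]
  have l1lt : l₁ < 1 := by nlinarith [sq_nonneg l₁]
  have l2lt : l₂ < 1 := by nlinarith [sq_nonneg l₂]
  -- The linear system for `s` and `t` has determinant `(1 - l₂) * m₁ + m₂ * l₁` and solution `m₁`,
  -- `m₂` over it. Thus `k1` means `s < 1` and `k2` means `t < 1`. Squaring and inserting `m ^ 2 = l
  -- * (1 - l)` reduces both to `l₂ < l₁`.
  have k1 : l₂ * m₁ < m₂ * l₁ := by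
    refine lt_of_pow_lt_pow_left₀ 2 (by positivity) ?_
    have e1 : m₁ ^ 2 = l₁ * (1 - l₁) := by linear_combination h₁
    have e2 : m₂ ^ 2 = l₂ * (1 - l₂) := by linear_combination h₂
    rw [mul_pow, mul_pow, e1, e2]
    have : 0 < l₁ * l₂ * (l₁ - l₂) := by
      have : 0 < l₁ - l₂ := by linarith
      positivity
    nlinarith
  have k2 : m₂ * (1 - l₁) < (1 - l₂) * m₁ := by
    have p1 : 0 < 1 - l₁ := by linarith
    have p2 : 0 < 1 - l₂ := by linarith
    refine lt_of_pow_lt_pow_left₀ 2 (by positivity) ?_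
    have e1 : m₁ ^ 2 = l₁ * (1 - l₁) := by linear_combination h₁
    have e2 : m₂ ^ 2 = l₂ * (1 - l₂) := by linear_combination h₂
    rw [mul_pow, mul_pow, e1, e2]
    have : 0 < (1 - l₁) * (1 - l₂) * (l₁ - l₂) := by
      have : 0 < l₁ - l₂ := by linarith
      positivity
    nlinarith
  have hd : 0 < (1 - l₂) * m₁ + m₂ * l₁ := by
    have p2 : 0 < 1 - l₂ := by linarith
    positivity
  refine ⟨m₁ / ((1 - l₂) * m₁ + m₂ * l₁), m₂ / ((1 - l₂) * m₁ + m₂ * l₁), by positivity, ?_,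
    by positivity, ?_, ?_, ?_⟩
  · rw [div_lt_one hd]; linarith
  · rw [div_lt_one hd]; linarith
  · rw [div_mul_eq_mul_div, div_mul_eq_mul_div, eq_div_iff hd.ne', add_mul,
      div_mul_cancel₀ _ hd.ne']
    ring
  · field_simp

/-- Two right angles over the segment `xp`, on the same side of it: if their apexes differ then
a leg at `p` of one of them crosses a leg at `x` of the other one. -/
theorem legs_cross {x p z₁ z₂ : Plane} (h₁ : inner ℝ (z₁ - p) (z₁ - x) = 0)
    (h₂ : inner ℝ (z₂ - p) (z₂ - x) = 0)
    (hc : 0 < cross (p - x) (z₁ - x) * cross (p - x) (z₂ - x)) :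
    z₁ = z₂ ∨ (∃ y, y ∈ openSegment ℝ p z₂ ∧ y ∈ openSegment ℝ x z₁) ∨
      ∃ y, y ∈ openSegment ℝ p z₁ ∧ y ∈ openSegment ℝ x z₂ := by
  set d0 := p 0 - x 0 with hd0
  set d1 := p 1 - x 1 with hd1
  simp only [inner_eq, cross, PiLp.sub_apply] at h₁ h₂ hc
  rw [← hd0, ← hd1] at hc
  have hN : 0 < d0 ^ 2 + d1 ^ 2 := by
    by_contra hN
    have e0 : d0 = 0 := by nlinarith [sq_nonneg d0, sq_nonneg d1]
    have e1 : d1 = 0 := by nlinarith [sq_nonneg d0, sq_nonneg d1]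
    rw [e0, e1] at hc; simp at hc
  -- coordinates relative to the basis `p - x` and its rotation, up to the sign `ε`
  obtain ⟨ε, hε, c1, c2⟩ : ∃ ε : ℝ, ε ^ 2 = 1 ∧ 0 < ε * (d0 * (z₁ 1 - x 1) - d1 * (z₁ 0 - x 0)) ∧
      0 < ε * (d0 * (z₂ 1 - x 1) - d1 * (z₂ 0 - x 0)) := by
    rcases pos_and_pos_or_neg_and_neg_of_mul_pos hc with ⟨a, b⟩ | ⟨a, b⟩
    · exact ⟨1, by norm_num, by linarith, by linarith⟩
    · exact ⟨-1, by norm_num, by linarith, by linarith⟩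
  -- In the frame with `x` at the origin and `p` at `(1, 0)` both apexes lie on the circle with
  -- diameter `xp`. The leg from `p` to the apex of smaller abscissa crosses the leg from `x` to the
  -- other apex.
  have key : ∀ z w : Plane,
      (z 0 - p 0) * (z 0 - x 0) + (z 1 - p 1) * (z 1 - x 1) = 0 →
      (w 0 - p 0) * (w 0 - x 0) + (w 1 - p 1) * (w 1 - x 1) = 0 →
      0 < ε * (d0 * (z 1 - x 1) - d1 * (z 0 - x 0)) →
      0 < ε * (d0 * (w 1 - x 1) - d1 * (w 0 - x 0)) →
      (d0 * (w 0 - x 0) + d1 * (w 1 - x 1)) / (d0 ^ 2 + d1 ^ 2) <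
        (d0 * (z 0 - x 0) + d1 * (z 1 - x 1)) / (d0 ^ 2 + d1 ^ 2) →
      ∃ y, y ∈ openSegment ℝ p w ∧ y ∈ openSegment ℝ x z := by
    intro z w hz hw cz cw hlt
    have circ : ∀ z : Plane, (z 0 - p 0) * (z 0 - x 0) + (z 1 - p 1) * (z 1 - x 1) = 0 →
        ((d0 * (z 0 - x 0) + d1 * (z 1 - x 1)) / (d0 ^ 2 + d1 ^ 2)) ^ 2 +
        ((ε * (d0 * (z 1 - x 1) - d1 * (z 0 - x 0))) / (d0 ^ 2 + d1 ^ 2)) ^ 2 =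
        (d0 * (z 0 - x 0) + d1 * (z 1 - x 1)) / (d0 ^ 2 + d1 ^ 2) := by
      intro z hz
      rw [div_pow, div_pow, mul_pow, hε]
      field_simp
      rw [hd0, hd1]
      linear_combination ((p 0 - x 0) ^ 2 + (p 1 - x 1) ^ 2) * hz
    obtain ⟨s, t, s0, s1, t0, t1, e1, e2⟩ := exists_params_of_thales (circ z hz) (circ w hw)
      (by positivity) (by positivity) hlt
    field_simp at e1 e2
    have e2' : s * (d0 * (w 1 - x 1) - d1 * (w 0 - x 0)) =
        t * (d0 * (z 1 - x 1) - d1 * (z 0 - x 0)) := by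
      have : ε ≠ 0 := by rintro rfl; norm_num at hε
      apply mul_left_cancel₀ this
      linear_combination e2
    refine ⟨p + s • (w - p), mem_openSegment_iff.2 ⟨s, s0, s1, by simp, by simp⟩,
      mem_openSegment_iff.2 ⟨t, t0, t1, ?_, ?_⟩⟩
    · apply mul_left_cancel₀ hN.ne'
      simp only [PiLp.add_apply, PiLp.smul_apply, PiLp.sub_apply, smul_eq_mul]
      rw [hd0, hd1] at *
      linear_combination (p 0 - x 0) * e1 - (p 1 - x 1) * e2'
    · apply mul_left_cancel₀ hN.ne'
      simp only [PiLp.add_apply, PiLp.smul_apply, PiLp.sub_apply, smul_eq_mul]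
      rw [hd0, hd1] at *
      linear_combination (p 1 - x 1) * e1 + (p 0 - x 0) * e2'
  rcases lt_trichotomy ((d0 * (z₁ 0 - x 0) + d1 * (z₁ 1 - x 1)) / (d0 ^ 2 + d1 ^ 2))
    ((d0 * (z₂ 0 - x 0) + d1 * (z₂ 1 - x 1)) / (d0 ^ 2 + d1 ^ 2)) with h | h | h
  · exact Or.inr (Or.inr (key z₂ z₁ h₂ h₁ c2 c1 h))
  · left
    have h' : d0 * (z₁ 0 - x 0) + d1 * (z₁ 1 - x 1) = d0 * (z₂ 0 - x 0) + d1 * (z₂ 1 - x 1) := by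
      field_simp at h; exact h
    set A := d0 * (z₁ 1 - x 1) - d1 * (z₁ 0 - x 0) with hA
    set B := d0 * (z₂ 1 - x 1) - d1 * (z₂ 0 - x 0) with hB
    -- Points of the circle with equal abscissas have ordinates of equal square, and lying on the
    -- same side fixes the sign.
    have hsq : A ^ 2 = B ^ 2 := by
      rw [hA, hB, hd0, hd1]
      rw [hd0, hd1] at h'
      linear_combination ((p 0 - x 0) ^ 2 + (p 1 - x 1) ^ 2) * (h₁ - h₂ + h') -
        ((p 0 - x 0) * (z₁ 0 - x 0) + (p 1 - x 1) * (z₁ 1 - x 1) +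
         (p 0 - x 0) * (z₂ 0 - x 0) + (p 1 - x 1) * (z₂ 1 - x 1)) * h'
    have hAB : A = B := by
      rcases sq_eq_sq_iff_eq_or_eq_neg.1 hsq with h | h
      · exact h
      · rw [h] at hc; nlinarith [sq_nonneg B]
    apply plane_ext
    · apply mul_left_cancel₀ hN.ne'
      linear_combination d0 * h' - d1 * (hA.symm.trans (hAB.trans hB))
    · apply mul_left_cancel₀ hN.ne'
      linear_combination d1 * h' + d0 * (hA.symm.trans (hAB.trans hB))
  · exact Or.inr (Or.inl (key z₁ z₂ h₁ h₂ c1 c2 h))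

/-- Vertex-disjoint straight paths of length two between `x` and `y` on the same side of
the line `xy` are separated by the line through their middle vertices. -/
theorem cross_mul_cross_neg {x y u v : Plane}
    (h₁ : Disjoint (segment ℝ x u) (segment ℝ y v))
    (h₂ : Disjoint (segment ℝ x v) (segment ℝ y u))
    (hs : 0 < cross (y - x) (u - x) * cross (y - x) (v - x)) :
    cross (v - u) (x - u) * cross (v - u) (y - u) < 0 := by
  by_contra hcon
  push Not at hcon
  -- The four signed areas `α, β, γ, δ` satisfy `α x + β u = γ y + δ v` and `α + β = γ + δ`. When
  -- they are nonnegative, dividing by the sum gives a common point of `xu` and `yv`.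
  have key : ∀ x y u v : Plane, Disjoint (segment ℝ x u) (segment ℝ y v) →
      0 < cross (y - x) (u - x) → 0 < cross (y - x) (v - x) →
      0 ≤ cross (v - u) (x - u) → 0 ≤ cross (v - u) (y - u) → False := by
    intro x y u v hd a b c d
    have hid0 : cross (v - u) (y - u) * x 0 + cross (y - x) (v - x) * u 0 =
        cross (v - u) (x - u) * y 0 + cross (y - x) (u - x) * v 0 := by
      simp [cross]; ring
    have hid1 : cross (v - u) (y - u) * x 1 + cross (y - x) (v - x) * u 1 =
        cross (v - u) (x - u) * y 1 + cross (y - x) (u - x) * v 1 := by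
      simp [cross]; ring
    have hsum : cross (v - u) (y - u) + cross (y - x) (v - x) =
        cross (v - u) (x - u) + cross (y - x) (u - x) := by
      simp [cross]; ring
    set α := cross (v - u) (y - u)
    set β := cross (y - x) (v - x)
    set γ := cross (v - u) (x - u)
    set δ := cross (y - x) (u - x)
    have hp : 0 < α + β := by linarith
    have hp' : α + β ≠ 0 := hp.ne'
    have hm₁ : x + (β / (α + β)) • (u - x) ∈ segment ℝ x u :=
      mem_segment_iff.2 ⟨β / (α + β), by positivity, by rw [div_le_one hp]; linarith,
        by simp, by simp⟩
    have hm₂ : x + (β / (α + β)) • (u - x) ∈ segment ℝ y v := by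
      refine mem_segment_iff.2 ⟨δ / (α + β), by positivity, by rw [div_le_one hp]; linarith, ?_, ?_⟩
      · simp; field_simp; linear_combination hid0 - y 0 * hsum
      · simp; field_simp; linear_combination hid1 - y 1 * hsum
    exact Set.disjoint_left.1 hd hm₁ hm₂
  have swap : ∀ u v z : Plane, cross (u - v) (z - v) = - cross (v - u) (z - u) := by
    intro u v z; simp [cross]; ring
  have key2 : ∀ x y u v : Plane, Disjoint (segment ℝ x u) (segment ℝ y v) →
      Disjoint (segment ℝ x v) (segment ℝ y u) →
      0 < cross (y - x) (u - x) → 0 < cross (y - x) (v - x) →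
      0 ≤ cross (v - u) (x - u) * cross (v - u) (y - u) → False := by
    intro x y u v hd hd' a b h
    rcases mul_nonneg_iff.1 h with ⟨c, d⟩ | ⟨c, d⟩
    · exact key x y u v hd a b c d
    · exact key x y v u hd' b a (by rw [swap]; linarith) (by rw [swap]; linarith)
  rcases pos_and_pos_or_neg_and_neg_of_mul_pos hs with ⟨a, b⟩ | ⟨a, b⟩
  · exact key2 x y u v h₁ h₂ a b hcon
  · exact key2 y x u v h₂.symm h₁.symm (by rw [swap]; linarith) (by rw [swap]; linarith)
      (by linarith)

/-- Two vertices of a straight-line drawing cannot both lie on the line `xy` if their paths of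
length two between `x` and `y` do not overlap. -/
theorem collinear_middle_eq {x y u v : Plane} (hu : cross (y - x) (u - x) = 0)
    (hv : cross (y - x) (v - x) = 0) (hxy : x ≠ y)
    (h₁ : y ∉ segment ℝ x u) (h₂ : x ∉ segment ℝ y u) (h₃ : y ∉ segment ℝ x v)
    (h₄ : x ∉ segment ℝ y v) (h₅ : u ∉ segment ℝ x v) (h₆ : v ∉ segment ℝ x u) : False := by
  have hN : 0 < (y 0 - x 0) ^ 2 + (y 1 - x 1) ^ 2 :=
    sq_add_sq_pos hxy.symm
  have param : ∀ w : Plane, cross (y - x) (w - x) = 0 →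
      ∃ r : ℝ, w 0 = x 0 + r * (y 0 - x 0) ∧ w 1 = x 1 + r * (y 1 - x 1) := by
    intro w hw
    simp only [cross, PiLp.sub_apply] at hw
    refine ⟨((w 0 - x 0) * (y 0 - x 0) + (w 1 - x 1) * (y 1 - x 1)) /
      ((y 0 - x 0) ^ 2 + (y 1 - x 1) ^ 2), ?_, ?_⟩
    · rw [div_mul_eq_mul_div, ← sub_eq_iff_eq_add', eq_div_iff hN.ne']
      linear_combination (-(y 1 - x 1)) * hw
    · rw [div_mul_eq_mul_div, ← sub_eq_iff_eq_add', eq_div_iff hN.ne']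
      linear_combination (y 0 - x 0) * hw
  -- A nonpositive parameter would put `x` on the segment `yw`. So both middle points lie on the
  -- open ray from `x` through `y`, and the nearer one lies on the segment from `x` to the other.
  have pos : ∀ (w : Plane) (r : ℝ), w 0 = x 0 + r * (y 0 - x 0) → w 1 = x 1 + r * (y 1 - x 1) →
      y ∉ segment ℝ x w → x ∉ segment ℝ y w → 0 < r := by
    intro w r e0 e1 a b
    by_contra hr
    refine b (mem_segment_iff.2 ⟨1 / (1 - r), by apply div_nonneg <;> linarith, ?_, ?_, ?_⟩)
    · rw [div_le_one (by linarith)]; linarith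
    · have : 1 - r ≠ 0 := by linarith
      rw [e0]; field_simp; ring
    · have : 1 - r ≠ 0 := by linarith
      rw [e1]; field_simp; ring
  have comp : ∀ (w z : Plane) (r s : ℝ), w 0 = x 0 + r * (y 0 - x 0) →
      w 1 = x 1 + r * (y 1 - x 1) → z 0 = x 0 + s * (y 0 - x 0) →
      z 1 = x 1 + s * (y 1 - x 1) → 0 < r → 0 < s → r ≤ s → w ∈ segment ℝ x z := by
    intro w z r s e0 e1 f0 f1 hr hs hrs
    refine mem_segment_iff.2 ⟨r / s, by positivity, by rw [div_le_one hs]; exact hrs, ?_, ?_⟩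
    · rw [e0, f0]; field_simp; ring
    · rw [e1, f1]; field_simp; ring
  obtain ⟨r, e0, e1⟩ := param u hu
  obtain ⟨s, f0, f1⟩ := param v hv
  have hr := pos u r e0 e1 h₁ h₂
  have hs := pos v s f0 f1 h₃ h₄
  rcases le_total r s with h | h
  · exact h₅ (comp u v r s e0 e1 f0 f1 hr hs h)
  · exact h₆ (comp v u s r f0 f1 e0 e1 hs hr h)

/-- Two segments with a common end-point that cross at a right angle: one of them is degenerate
at the crossing. -/
theorem eq_of_orthogonal_of_mem {x z u p : Plane} (hz : z ∈ openSegment ℝ x u)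
    (hz' : z ∈ openSegment ℝ x p) (h : inner ℝ (p - x) (u - x) = (0 : ℝ)) : x = z := by
  obtain ⟨s, s0, s1, a0, a1⟩ := mem_openSegment_iff.1 hz
  obtain ⟨t, t0, t1, b0, b1⟩ := mem_openSegment_iff.1 hz'
  simp only [inner_eq, PiLp.sub_apply] at h
  have : (z 0 - x 0) ^ 2 + (z 1 - x 1) ^ 2 = 0 := by
    have c0 : z 0 - x 0 = s * (u 0 - x 0) := by linarith
    have c1 : z 1 - x 1 = s * (u 1 - x 1) := by linarith
    have d0 : z 0 - x 0 = t * (p 0 - x 0) := by linarith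
    have d1 : z 1 - x 1 = t * (p 1 - x 1) := by linarith
    rw [sq, sq]
    nth_rewrite 1 [c0, c1]
    rw [d0, d1]
    linear_combination s * t * h
  exact (eq_of_sq_add_sq_eq_zero this).symm

/-! ### Moving the common vertex of at most two segments -/

theorem isClosed_segment (p r : Plane) : IsClosed (segment ℝ p r) := by
  rw [← convexHull_pair]
  exact (Set.toFinite {p, r}).isClosed_convexHull ℝ

/-- A tube argument: the complement of the fixed segment is open and the parameter interval of the
moving one is compact, so disjointness at `t = 0` persists nearby. -/
theorem eventually_disjoint_segment {a u d p r : Plane}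
    (h : Disjoint (segment ℝ p r) (segment ℝ a u)) :
    ∀ᶠ t in 𝓝 (0 : ℝ), Disjoint (segment ℝ p r) (segment ℝ a (u + t • d)) := by
  have hc : IsClosed (segment ℝ p r) := isClosed_segment p r
  have hk : ∀ᶠ t in 𝓝 (0 : ℝ), ∀ s ∈ Set.Icc (0 : ℝ) 1,
      a + s • (u + t • d - a) ∉ segment ℝ p r := by
    refine isCompact_Icc.eventually_forall_of_forall_eventually fun s hs => ?_
    have hcont : Continuous fun q : ℝ × ℝ => a + q.2 • (u + q.1 • d - a) := by fun_prop
    refine hcont.continuousAt.eventually (hc.isOpen_compl.mem_nhds ?_)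
    simp only [zero_smul, add_zero, Set.mem_compl_iff]
    exact Set.disjoint_right.1 h (by rw [segment_eq_image']; exact ⟨s, hs, rfl⟩)
  filter_upwards [hk] with t ht
  rw [Set.disjoint_right]
  intro z hz
  rw [segment_eq_image'] at hz
  obtain ⟨s, hs, rfl⟩ := hz
  exact ht s hs

/-- The area is affine in `t`. If it vanishes at `0` its slope does not, and every `t > 0` works;
otherwise continuity suffices. -/
theorem eventually_cross_ne_zero {w u d : Plane} (h : cross w u ≠ 0 ∨ cross w d ≠ 0) :
    ∀ᶠ t in 𝓝[>] (0 : ℝ), cross w (u + t • d) ≠ 0 := by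
  have e : ∀ t : ℝ, cross w (u + t • d) = cross w u + t * cross w d := by
    intro t; simp [cross]; ring
  simp_rw [e]
  by_cases hu : cross w u = 0
  · have hd := h.resolve_left (by simpa using hu)
    filter_upwards [self_mem_nhdsWithin] with t ht
    rw [hu, zero_add]
    exact mul_ne_zero (ne_of_gt ht) hd
  · have hcont : Continuous fun t : ℝ => cross w u + t * cross w d := by fun_prop
    exact (hcont.continuousAt.eventually_ne (by simpa using hu)).filter_mono nhdsWithin_le_nhds

theorem inter_subset_of_cross_ne_zero {a q p r : Plane} (ha : a ∈ segment ℝ p r)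
    (h : cross (r - p) (q - a) ≠ 0) : segment ℝ p r ∩ segment ℝ a q ⊆ {a} := by
  rintro z ⟨h1, h2⟩
  obtain ⟨s, -, -, a0, a1⟩ := mem_segment_iff.1 ha
  obtain ⟨t, -, -, b0, b1⟩ := mem_segment_iff.1 h1
  obtain ⟨m, -, -, c0, c1⟩ := mem_segment_iff.1 h2
  have : m * cross (r - p) (q - a) = 0 := by
    simp only [cross, PiLp.sub_apply]
    linear_combination (r 0 - p 0) * (b1 - c1 - a1) - (r 1 - p 1) * (b0 - c0 - a0)
  have hm : m = 0 := by simpa [h] using this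
  exact plane_ext (by rw [c0, hm]; ring) (by rw [c1, hm]; ring)

/-- If `a` lies on a nondegenerate `pr`, the moved edge is not parallel to `pr` for small `t > 0`,
because `u - a` and `d` span the plane; then `a` is the only common point. If `a` is off `pr`, the
two segments are disjoint and stay so. -/
theorem eventually_inter_subset {a u d p r : Plane} (hd : cross (u - a) d ≠ 0)
    (h : segment ℝ p r ∩ segment ℝ a u ⊆ {a}) :
    ∀ᶠ t in 𝓝[>] (0 : ℝ), segment ℝ p r ∩ segment ℝ a (u + t • d) ⊆ {a} := by
  by_cases ha : a ∈ segment ℝ p r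
  · rcases eq_or_ne p r with rfl | hpr
    · rw [segment_same] at ha ⊢
      refine .of_forall fun t => ?_
      rw [Set.mem_singleton_iff.1 ha]
      exact Set.inter_subset_left
    · have : cross (r - p) (u - a) ≠ 0 ∨ cross (r - p) d ≠ 0 := by
        by_contra hcon
        push Not at hcon
        exact hpr (sub_eq_zero.1 (eq_zero_of_cross_eq_zero hd hcon.1 hcon.2)).symm
      filter_upwards [eventually_cross_ne_zero this] with t ht
      exact inter_subset_of_cross_ne_zero ha (by rwa [add_sub_right_comm])
  · have hdisj : Disjoint (segment ℝ p r) (segment ℝ a u) := by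
      rw [Set.disjoint_left]
      intro z h1 h2
      have := h ⟨h1, h2⟩
      rw [Set.mem_singleton_iff] at this
      exact ha (this ▸ h1)
    filter_upwards [(eventually_disjoint_segment hdisj).filter_mono nhdsWithin_le_nhds] with t ht
    rw [ht.inter_eq]
    exact Set.empty_subset _

/-- The direction `d` in which the common end-point `u` of segments to the points of `X` may
be moved. -/
structure IsEscape (u : Plane) (X : Set Plane) (d : Plane) : Prop where
  ne_zero : d ≠ 0
  cross_ne : ∀ a ∈ X, cross (u - a) d ≠ 0
  disjoint : ∀ a ∈ X, ∀ c ∈ X, a ≠ c → ∀ t : ℝ, 0 < t →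
    Disjoint (segment ℝ u c) (segment ℝ a (u + t • d))
  inter : ∀ a ∈ X, ∀ c ∈ X, a ≠ c → ∀ t : ℝ, 0 < t →
    segment ℝ a (u + t • d) ∩ segment ℝ c (u + t • d) ⊆ {u + t • d}

theorem exists_cross_ne_zero {w : Plane} (h : w ≠ 0) : ∃ d, cross w d ≠ 0 := by
  by_contra hcon
  push Not at hcon
  have h0 := hcon !₂[1, 0]
  have h1 := hcon !₂[0, 1]
  simp [cross] at h0 h1
  exact h (plane_ext h1 h0)

theorem isEscape_pair {u a c d : Plane} (hac : a ≠ c) (h0 : d ≠ 0)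
    (ha : cross (u - a) d ≠ 0) (hc : cross (u - c) d ≠ 0)
    (h : ∀ t : ℝ, 0 < t → Disjoint (segment ℝ u c) (segment ℝ a (u + t • d)))
    (h' : ∀ t : ℝ, 0 < t → Disjoint (segment ℝ u a) (segment ℝ c (u + t • d)))
    (hi : ∀ t : ℝ, 0 < t → segment ℝ a (u + t • d) ∩ segment ℝ c (u + t • d) ⊆ {u + t • d}) :
    IsEscape u {a, c} d where
  ne_zero := h0
  cross_ne := by rintro _ (rfl | rfl) <;> assumption
  disjoint := by
    rintro _ (rfl | rfl) _ (rfl | rfl) hne <;> first | exact absurd rfl hne | assumption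
  inter := by
    rintro _ (rfl | rfl) _ (rfl | rfl) hne
    · exact absurd rfl hne
    · exact hi
    · intro t ht; rw [Set.inter_comm]; exact hi t ht
    · exact absurd rfl hne

/-- If the three points are collinear, any direction across the line works, and the perpendicular
one is taken. Otherwise `u` is moved away from both points in the direction `(u - a) + (u - c)`: the
old position is then inside the triangle formed by `a`, `c` and the new one, and so the old edges
avoid the new edges except at `a` and `c`. -/
theorem exists_isEscape_pair {u a c : Plane} (hac : a ≠ c) (hua : u ≠ a) (huc : u ≠ c)
    (h₁ : a ∉ segment ℝ u c) (h₂ : c ∉ segment ℝ u a) : ∃ d, IsEscape u {a, c} d := by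
  by_cases hcr : cross (u - a) (u - c) = 0
  · -- `u` lies between `a` and `c`
    have hN : ∀ x : Plane, u ≠ x → 0 < (u 0 - x 0) ^ 2 + (u 1 - x 1) ^ 2 :=
      fun x hx => sq_add_sq_pos hx
    have hca : cross (u - a) !₂[-(u 1 - a 1), u 0 - a 0] ≠ 0 := by
      have := hN a hua
      simp only [cross, PiLp.sub_apply]
      simp
      nlinarith
    have hcc : cross (u - c) !₂[-(u 1 - a 1), u 0 - a 0] ≠ 0 := by
      have ha := hN a hua
      have hc := hN c huc
      simp only [cross, PiLp.sub_apply] at hcr ⊢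
      simp
      intro h
      have : ((u 0 - a 0) ^ 2 + (u 1 - a 1) ^ 2) * ((u 0 - c 0) ^ 2 + (u 1 - c 1) ^ 2) = 0 := by
        linear_combination ((u 0 - c 0) * (u 0 - a 0) + (u 1 - c 1) * (u 1 - a 1)) * h +
          ((u 0 - a 0) * (u 1 - c 1) - (u 1 - a 1) * (u 0 - c 0)) * hcr
      have : 0 < ((u 0 - a 0) ^ 2 + (u 1 - a 1) ^ 2) * ((u 0 - c 0) ^ 2 + (u 1 - c 1) ^ 2) := by
        positivity
      linarith
    generalize (!₂[-(u 1 - a 1), u 0 - a 0] : Plane) = d at hca hcc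
    have disj : ∀ a c : Plane, a ∉ segment ℝ u c → u ≠ a → cross (u - a) (u - c) = 0 →
        cross (u - a) d ≠ 0 → ∀ t : ℝ, 0 < t →
        Disjoint (segment ℝ u c) (segment ℝ a (u + t • d)) := by
      intro a c hac hua hcr hca t ht
      rw [Set.disjoint_left]
      intro z hz hz'
      obtain ⟨r, -, -, e0, e1⟩ := mem_segment_iff.1 hz
      obtain ⟨s, -, -, f0, f1⟩ := mem_segment_iff.1 hz'
      simp only [PiLp.add_apply, PiLp.smul_apply, smul_eq_mul] at f0 f1
      have : s * t * cross (u - a) d = 0 := by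
        simp only [cross, PiLp.sub_apply] at hcr ⊢
        linear_combination (-r) * hcr + (u 0 - a 0) * (e1 - f1) - (u 1 - a 1) * (e0 - f0)
      have hs : s = 0 := by simpa [hca, ht.ne'] using this
      refine hac ?_
      have : a = z := plane_ext (by rw [f0, hs]; ring) (by rw [f1, hs]; ring)
      rwa [this]
    have hcr' : cross (u - c) (u - a) = 0 := by
      simp only [cross, PiLp.sub_apply] at hcr ⊢
      linarith
    refine ⟨d, isEscape_pair hac (by rintro rfl; simp [cross] at hca) hca hcc
      (disj a c h₁ hua hcr hca) (disj c a h₂ huc hcr' hcc) ?_⟩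
    rintro t ht z ⟨hz, hz'⟩
    rw [segment_symm] at hz hz'
    obtain ⟨r, -, -, e0, e1⟩ := mem_segment_iff.1 hz
    obtain ⟨s, -, -, f0, f1⟩ := mem_segment_iff.1 hz'
    simp only [PiLp.add_apply, PiLp.smul_apply, smul_eq_mul] at e0 e1 f0 f1
    have : (r - s) * t * cross (u - a) d = 0 := by
      simp only [cross, PiLp.sub_apply] at hcr ⊢
      linear_combination s * hcr + (u 0 - a 0) * (e1 - f1) - (u 1 - a 1) * (e0 - f0)
    have hrs : r = s := by
      have : r - s = 0 := by simpa [hca, ht.ne'] using this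
      linarith
    subst hrs
    have hr : r = 0 := by
      by_contra hr
      refine hac (plane_ext ?_ ?_)
      · apply mul_left_cancel₀ hr; linarith
      · apply mul_left_cancel₀ hr; linarith
    exact plane_ext (by rw [e0, hr]; simp) (by rw [e1, hr]; simp)
  · have hcr' : cross (u - c) (u - a) ≠ 0 := by
      contrapose! hcr
      simp only [cross, PiLp.sub_apply] at hcr ⊢
      linarith
    have disj : ∀ a c : Plane, cross (u - a) (u - c) ≠ 0 → ∀ t : ℝ, 0 < t →
        Disjoint (segment ℝ u c) (segment ℝ a (u + t • ((u - a) + (u - c)))) := by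
      intro a c hcr t ht
      rw [Set.disjoint_left]
      intro z hz hz'
      obtain ⟨r, r0, -, e0, e1⟩ := mem_segment_iff.1 hz
      obtain ⟨s, s0, -, f0, f1⟩ := mem_segment_iff.1 hz'
      simp only [PiLp.add_apply, PiLp.smul_apply, smul_eq_mul, PiLp.sub_apply] at f0 f1
      have k1 : (-1 + s * (1 + t)) * cross (u - a) (u - c) = 0 := by
        simp only [cross, PiLp.sub_apply]
        linear_combination (e0 - f0) * (u 1 - c 1) - (e1 - f1) * (u 0 - c 0)
      have k2 : (s * t + r) * cross (u - a) (u - c) = 0 := by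
        simp only [cross, PiLp.sub_apply]
        linear_combination (u 0 - a 0) * (e1 - f1) - (u 1 - a 1) * (e0 - f0)
      have k1' : -1 + s * (1 + t) = 0 := (mul_eq_zero.1 k1).resolve_right hcr
      have k2' : s * t + r = 0 := (mul_eq_zero.1 k2).resolve_right hcr
      have : s * t = 0 := by nlinarith [mul_nonneg s0 ht.le]
      have hs : s = 0 := by simpa [ht.ne'] using this
      rw [hs] at k1'; norm_num at k1'
    have e1 : ∀ a c : Plane, cross (u - a) ((u - a) + (u - c)) = cross (u - a) (u - c) := by
      intro a c; simp [cross]; ring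
    refine ⟨(u - a) + (u - c), isEscape_pair hac ?_ (by rwa [e1]) (by rwa [add_comm, e1])
      (disj a c hcr) (by rw [add_comm]; exact disj c a hcr') ?_⟩
    · intro h
      apply hcr
      rw [← e1, h]; simp [cross]
    rintro t ht z ⟨hz, hz'⟩
    rw [segment_symm] at hz hz'
    obtain ⟨r, r0, -, e0, e1⟩ := mem_segment_iff.1 hz
    obtain ⟨s, s0, -, f0, f1⟩ := mem_segment_iff.1 hz'
    simp only [PiLp.add_apply, PiLp.smul_apply, smul_eq_mul, PiLp.sub_apply] at e0 e1 f0 f1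
    have k1 : (r * (1 + t) - s * t) * cross (u - a) (u - c) = 0 := by
      simp only [cross, PiLp.sub_apply]
      linear_combination (e0 - f0) * (u 1 - c 1) - (e1 - f1) * (u 0 - c 0)
    have k2 : (r * t - s * (1 + t)) * cross (u - a) (u - c) = 0 := by
      simp only [cross, PiLp.sub_apply]
      linear_combination (u 0 - a 0) * (e1 - f1) - (u 1 - a 1) * (e0 - f0)
    have k1' := (mul_eq_zero.1 k1).resolve_right hcr
    have k2' := (mul_eq_zero.1 k2).resolve_right hcr
    have hr : r = 0 := by
      have : r * (1 + 2 * t) = 0 := by linear_combination (1 + t) * k1' - t * k2'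
      exact (mul_eq_zero.1 this).resolve_right (by positivity)
    exact plane_ext (by rw [e0, hr]; simp; ring) (by rw [e1, hr]; simp; ring)

theorem exists_isEscape {u : Plane} {X : Finset Plane} (hX : X.card ≤ 2) (hu : u ∉ X)
    (h : ∀ a ∈ X, ∀ c ∈ X, a ≠ c → a ∉ segment ℝ u c) : ∃ d, IsEscape u X d := by
  obtain h0 | h1 | h2 : X.card = 0 ∨ X.card = 1 ∨ X.card = 2 := by omega
  · rw [Finset.card_eq_zero] at h0
    subst h0
    exact ⟨EuclideanSpace.single 0 1, by simp, by simp, by simp, by simp⟩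
  · obtain ⟨a, rfl⟩ := Finset.card_eq_one.1 h1
    have hua : u ≠ a := by simpa using hu
    obtain ⟨d, hd⟩ := exists_cross_ne_zero (sub_ne_zero.2 hua)
    refine ⟨d, by rintro rfl; simp [cross] at hd, by simpa using hd, ?_, ?_⟩ <;>
    · intro a ha c hc hac
      simp only [Finset.coe_singleton, Set.mem_singleton_iff] at ha hc
      exact absurd (ha.trans hc.symm) hac
  · obtain ⟨a, c, hac, rfl⟩ := Finset.card_eq_two.1 h2
    simp only [Finset.mem_insert, Finset.mem_singleton, not_or] at hu
    rw [Finset.coe_pair]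
    exact exists_isEscape_pair hac hu.1 hu.2 (h a (by simp) c (by simp) hac)
      (h c (by simp) a (by simp) hac.symm)

theorem notMem_segment_of_cross_ne_zero {u c d : Plane} (h : cross (u - c) d ≠ 0) {t : ℝ}
    (ht : 0 < t) : u + t • d ∉ segment ℝ u c := by
  intro hm
  obtain ⟨r, -, -, e0, e1⟩ := mem_segment_iff.1 hm
  simp only [PiLp.add_apply, PiLp.smul_apply, smul_eq_mul] at e0 e1
  have : t * cross (u - c) d = 0 := by
    simp only [cross, PiLp.sub_apply]
    linear_combination (u 0 - c 0) * e1 - (u 1 - c 1) * e0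
  exact h ((mul_eq_zero.1 this).resolve_left ht.ne')

theorem notMem_segment_add_of_cross_ne_zero {u a d : Plane} (h : cross (u - a) d ≠ 0) {t : ℝ}
    (ht : 0 < t) : u ∉ segment ℝ a (u + t • d) := by
  intro hm
  obtain ⟨r, -, -, e0, e1⟩ := mem_segment_iff.1 hm
  simp only [PiLp.add_apply, PiLp.smul_apply, smul_eq_mul] at e0 e1
  have : r * (t * cross (u - a) d) = 0 := by
    simp only [cross, PiLp.sub_apply]
    linear_combination (-(u 0 - a 0)) * e1 + (u 1 - a 1) * e0
  have hr : r = 0 := (mul_eq_zero.1 this).resolve_right (mul_ne_zero ht.ne' h)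
  rw [hr] at e0 e1
  have : u = a := plane_ext (by linarith) (by linarith)
  simp [this, cross] at h

theorem segment_inter_subset_of_cross_ne_zero {u a d : Plane} (h : cross (u - a) d ≠ 0) {t : ℝ}
    (ht : 0 < t) : segment ℝ u a ∩ segment ℝ a (u + t • d) ⊆ {a} := by
  refine inter_subset_of_cross_ne_zero (right_mem_segment ℝ u a) ?_
  have : cross (a - u) (u + t • d - a) = -(t * cross (u - a) d) := by simp [cross]; ring
  rw [this, neg_ne_zero]
  exact mul_ne_zero ht.ne' h

/-- The foot of a perpendicular from `p` is unique. -/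
theorem eq_of_mem_openSegment_of_orthogonal {x z y p : Plane} (hy : y ∈ openSegment ℝ x z)
    (h : inner ℝ (z - p) (z - x) = (0 : ℝ)) (h' : inner ℝ (y - p) (z - x) = (0 : ℝ)) : x = z := by
  obtain ⟨s, s0, s1, a0, a1⟩ := mem_openSegment_iff.1 hy
  simp only [inner_eq, PiLp.sub_apply] at h h'
  have h3 : (1 - s) * ((z 0 - x 0) ^ 2 + (z 1 - x 1) ^ 2) = 0 := by
    rw [a0, a1] at h'
    linear_combination h - h'
  have h4 := (mul_eq_zero.1 h3).resolve_left (by linarith)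
  exact (eq_of_sq_add_sq_eq_zero h4).symm

/-- A point off the line `xu` from which a perpendicular segment crosses `xu` in its interior. -/
theorem cross_ne_zero_of_foot {x u z p r : Plane} (hz : z ∈ openSegment ℝ x u)
    (hz' : z ∈ openSegment ℝ p r) (hpr : p ≠ r) (hxu : x ≠ u)
    (h : inner ℝ (r - p) (u - x) = (0 : ℝ)) : cross (p - x) (u - x) ≠ 0 := by
  intro hc
  obtain ⟨s, s0, s1, a0, a1⟩ := mem_openSegment_iff.1 hz
  obtain ⟨t, t0, t1, b0, b1⟩ := mem_openSegment_iff.1 hz'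
  simp only [inner_eq, cross, PiLp.sub_apply] at h hc
  have hN : u - x ≠ 0 := sub_ne_zero.2 hxu.symm
  have h2 : (r 0 - p 0) * (u 1 - x 1) - (r 1 - p 1) * (u 0 - x 0) = 0 := by
    have : t * ((r 0 - p 0) * (u 1 - x 1) - (r 1 - p 1) * (u 0 - x 0)) = 0 := by
      linear_combination (a0 - b0) * (u 1 - x 1) - (a1 - b1) * (u 0 - x 0) - hc
    exact (mul_eq_zero.1 this).resolve_left t0.ne'
  have h3 : ((r 0 - p 0) ^ 2 + (r 1 - p 1) ^ 2) * ((u 0 - x 0) ^ 2 + (u 1 - x 1) ^ 2) = 0 := by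
    linear_combination ((r 0 - p 0) * (u 0 - x 0) + (r 1 - p 1) * (u 1 - x 1)) * h +
      ((r 0 - p 0) * (u 1 - x 1) - (r 1 - p 1) * (u 0 - x 0)) * h2
  rcases mul_eq_zero.1 h3 with h | h
  · exact hpr (eq_of_sq_add_sq_eq_zero h).symm
  · exact hxu (eq_of_sq_add_sq_eq_zero h).symm

/-! ### Polylines -/

/-- The union of the first `n + 1` segments of a polyline. -/
def polyCurve (n : ℕ) (p : ℕ → Plane) : Set Plane :=
  {x | ∃ i ≤ n, x ∈ segment ℝ (p i) (p (i + 1))}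

/-- A polyline without its two end-points. -/
def polyInt (n : ℕ) (p : ℕ → Plane) : Set Plane :=
  polyCurve n p \ {p 0, p (n + 1)}

/-- Two polylines cross at a right angle at `x`. -/
def RightAngle (n : ℕ) (p : ℕ → Plane) (m : ℕ) (q : ℕ → Plane) (x : Plane) : Prop :=
  ∃ i ≤ n, ∃ j ≤ m, x ∈ openSegment ℝ (p i) (p (i + 1)) ∧ x ∈ openSegment ℝ (q j) (q (j + 1)) ∧
    inner ℝ (p (i + 1) - p i) (q (j + 1) - q j) = 0

/-- The polyline with corners `p 0, …, p (n + 1)` is simple and bends at its inner corners. -/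
structure IsPolyline (n : ℕ) (p : ℕ → Plane) : Prop where
  nondegenerate : ∀ i ≤ n, p i ≠ p (i + 1)
  consecutive : ∀ i < n,
    segment ℝ (p i) (p (i + 1)) ∩ segment ℝ (p (i + 1)) (p (i + 2)) = {p (i + 1)}
  bend_angle : ∀ i < n, EuclideanGeometry.angle (p i) (p (i + 1)) (p (i + 2)) ≠ Real.pi
  nonconsecutive : ∀ i j, i + 1 < j → j ≤ n →
    Disjoint (segment ℝ (p i) (p (i + 1))) (segment ℝ (p j) (p (j + 1)))

theorem isPolyline_zero {p : ℕ → Plane} (h : p 0 ≠ p 1) : IsPolyline 0 p where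
  nondegenerate i hi := by obtain rfl : i = 0 := by omega
                           exact h
  consecutive i hi := by omega
  bend_angle i hi := by omega
  nonconsecutive i j h h' := by omega

theorem polyCurve_zero (p : ℕ → Plane) : polyCurve 0 p = segment ℝ (p 0) (p 1) := by
  ext x; simp [polyCurve]

theorem isClosed_polyCurve (n : ℕ) (p : ℕ → Plane) : IsClosed (polyCurve n p) := by
  have : polyCurve n p = ⋃ i ∈ Set.Iic n, segment ℝ (p i) (p (i + 1)) := by
    ext x; simp [polyCurve]
  rw [this]
  exact (Set.finite_Iic n).isClosed_biUnion fun i _ => isClosed_segment _ _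

namespace IsPolyline

variable {n : ℕ} {p : ℕ → Plane} (hp : IsPolyline n p)
include hp

theorem notMem_segment_of_lt {i j : ℕ} {y : Plane} (hi : i < j) (hj : j ≤ n)
    (h : y ∈ segment ℝ (p i) (p (i + 1))) : y ∉ openSegment ℝ (p j) (p (j + 1)) := by
  intro h'
  have h'' := openSegment_subset_segment ℝ _ _ h'
  rcases Nat.lt_or_ge (i + 1) j with hij | hij
  · exact Set.disjoint_left.1 (hp.nonconsecutive i j hij hj) h h''
  · obtain rfl : j = i + 1 := by omega
    have : y ∈ ({p (i + 1)} : Set Plane) := by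
      rw [← hp.consecutive i (by omega)]; exact ⟨h, h''⟩
    rw [Set.mem_singleton_iff] at this
    rw [this, left_mem_openSegment_iff] at h'
    exact hp.nondegenerate _ hj h'

theorem notMem_segment_of_gt {i j : ℕ} {y : Plane} (hi : j < i) (hj : i ≤ n)
    (h : y ∈ segment ℝ (p i) (p (i + 1))) : y ∉ openSegment ℝ (p j) (p (j + 1)) := by
  intro h'
  have h'' := openSegment_subset_segment ℝ _ _ h'
  rcases Nat.lt_or_ge (j + 1) i with hij | hij
  · exact Set.disjoint_left.1 (hp.nonconsecutive j i hij hj) h'' h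
  · obtain rfl : i = j + 1 := by omega
    have : y ∈ ({p (j + 1)} : Set Plane) := by
      rw [← hp.consecutive j (by omega)]; exact ⟨h'', h⟩
    rw [Set.mem_singleton_iff] at this
    rw [this, right_mem_openSegment_iff] at h'
    exact hp.nondegenerate _ (by omega) h'

/-- This identifies the segment that a right-angle crossing provides with the one already known to
contain the point. -/
theorem index_unique {i j : ℕ} {y : Plane} (hi : i ≤ n) (hj : j ≤ n)
    (h : y ∈ openSegment ℝ (p i) (p (i + 1))) (h' : y ∈ openSegment ℝ (p j) (p (j + 1))) :
    i = j := by
  have h'' := openSegment_subset_segment ℝ _ _ h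
  rcases lt_trichotomy i j with hij | hij | hij
  · exact absurd h' (hp.notMem_segment_of_lt hij hj h'')
  · exact hij
  · exact absurd h' (hp.notMem_segment_of_gt hij hi h'')

theorem openSegment_subset_polyInt {i : ℕ} (hi : i ≤ n) :
    openSegment ℝ (p i) (p (i + 1)) ⊆ polyInt n p := by
  intro y hy
  refine ⟨⟨i, hi, openSegment_subset_segment ℝ _ _ hy⟩, ?_⟩
  rintro (rfl | rfl)
  · rcases Nat.eq_zero_or_pos i with rfl | h0
    · rw [left_mem_openSegment_iff] at hy
      exact hp.nondegenerate _ hi hy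
    · exact hp.notMem_segment_of_lt h0 hi (left_mem_segment ℝ _ _) hy
  · rcases Nat.lt_or_ge i n with h0 | h0
    · exact hp.notMem_segment_of_gt h0 le_rfl (right_mem_segment ℝ _ _) hy
    · obtain rfl : i = n := by omega
      rw [right_mem_openSegment_iff] at hy
      exact hp.nondegenerate _ hi hy

end IsPolyline

/-! ### Drawings of induced subgraphs -/

variable {V : Type*}

/-- The edges of `G` inside the vertex set `S`. -/
def edgesIn (G : SimpleGraph V) (S : Set V) : Set (Sym2 V) :=
  {e | e ∈ G.edgeSet ∧ ∀ v ∈ e, v ∈ S}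

theorem mk_mem_edgesIn {G : SimpleGraph V} {S : Set V} {u v : V} :
    s(u, v) ∈ edgesIn G S ↔ G.Adj u v ∧ u ∈ S ∧ v ∈ S := by
  simp [edgesIn]

/-- A right-angle crossing drawing of the subgraph of `G` induced by `S`. -/
structure DrawnOn (G : SimpleGraph V) (S : Set V) (pos : V → Plane) (bends : Sym2 V → ℕ)
    (pt : Sym2 V → ℕ → Plane) : Prop where
  pos_injOn : Set.InjOn pos S
  ends : ∀ e ∈ edgesIn G S, s(pt e 0, pt e (bends e + 1)) = Sym2.map pos e
  isPolyline : ∀ e ∈ edgesIn G S, IsPolyline (bends e) (pt e)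
  avoids : ∀ v ∈ S, ∀ e ∈ edgesIn G S, v ∉ e → pos v ∉ polyCurve (bends e) (pt e)
  rac : ∀ e ∈ edgesIn G S, ∀ f ∈ edgesIn G S, e ≠ f →
    ∀ x ∈ polyInt (bends e) (pt e) ∩ polyInt (bends f) (pt f),
      RightAngle (bends e) (pt e) (bends f) (pt f) x

/-- The subgraph induced by `S` admits a `b`-bend `β`-restricted RAC drawing. -/
def DrawableOn [Finite V] (G : SimpleGraph V) (S : Set V) (b : ℕ) (β : Sym2 V → ℕ) : Prop :=
  ∃ pos bends pt, DrawnOn G S pos bends pt ∧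
    ∑ e ∈ (edgesIn G S).toFinite.toFinset, bends e ≤ b ∧ ∀ e ∈ edgesIn G S, bends e ≤ β e

theorem edgesIn_mono {G : SimpleGraph V} {S T : Set V} (h : S ⊆ T) : edgesIn G S ⊆ edgesIn G T :=
  fun _ he => ⟨he.1, fun v hv => h (he.2 v hv)⟩

theorem DrawnOn.mono {G : SimpleGraph V} {S T : Set V} {pos bends pt} (hST : S ⊆ T)
    (h : DrawnOn G T pos bends pt) : DrawnOn G S pos bends pt where
  pos_injOn := h.pos_injOn.mono hST
  ends e he := h.ends e (edgesIn_mono hST he)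
  isPolyline e he := h.isPolyline e (edgesIn_mono hST he)
  avoids v hv e he := h.avoids v (hST hv) e (edgesIn_mono hST he)
  rac e he f hf := h.rac e (edgesIn_mono hST he) f (edgesIn_mono hST hf)

theorem DrawableOn.mono [Finite V] {G : SimpleGraph V} {S T : Set V} {b : ℕ} {β : Sym2 V → ℕ}
    (hST : S ⊆ T) (h : DrawableOn G T b β) : DrawableOn G S b β := by
  obtain ⟨pos, bends, pt, hD, hb, hβ⟩ := h
  refine ⟨pos, bends, pt, hD.mono hST, le_trans (Finset.sum_le_sum_of_subset ?_) hb,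
    fun e he => hβ e (edgesIn_mono hST he)⟩
  simpa using edgesIn_mono hST

/-- Drawings of an induced subgraph as drawings in the sense of `DrawableOn`. -/
theorem hasBendRestrictedRACDrawing_iff {W : Type*} [Fintype W] [Finite V] {G : SimpleGraph V}
    {H : SimpleGraph W} {φ : W → V} (hφ : Function.Injective φ)
    (hH : ∀ a b, H.Adj a b ↔ G.Adj (φ a) (φ b)) {b : ℕ} {β' : H.edgeSet → Fin 4}
    {β : Sym2 V → ℕ} (hβ : ∀ e : H.edgeSet, (β' e : ℕ) = β (Sym2.map φ e.1)) :
    HasBendRestrictedRACDrawing H b β' ↔ DrawableOn G (Set.range φ) b β := by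
  classical
  have hmem : ∀ e : H.edgeSet, Sym2.map φ e.1 ∈ edgesIn G (Set.range φ) := by
    rintro ⟨e, he⟩
    induction e with | _ a c => simpa [mk_mem_edgesIn, ← hH] using he
  have hsurj : ∀ e ∈ edgesIn G (Set.range φ), ∃ e' : H.edgeSet, Sym2.map φ e'.1 = e := by
    intro e he
    induction e with | _ a c =>
    obtain ⟨h1, ⟨a, rfl⟩, ⟨c, rfl⟩⟩ := mk_mem_edgesIn.1 he
    exact ⟨⟨s(a, c), (hH a c).2 h1⟩, rfl⟩
  have hinj : Function.Injective fun e : H.edgeSet => Sym2.map φ e.1 :=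
    (Sym2.map.injective hφ).comp Subtype.val_injective
  have hsum : ∀ g : Sym2 V → ℕ, ∑ e ∈ (edgesIn G (Set.range φ)).toFinite.toFinset, g e =
      ∑ e : H.edgeSet, g (Sym2.map φ e.1) := by
    intro g
    rw [← Finset.sum_image (s := Finset.univ) (f := g) (fun _ _ _ _ h => hinj h)]
    congr 1
    ext e
    simp only [Set.Finite.mem_toFinset, Finset.mem_image, Finset.mem_univ, true_and]
    exact ⟨hsurj e, by rintro ⟨e', rfl⟩; exact hmem e'⟩
  have hmemφ : ∀ (v : W) (e : H.edgeSet), φ v ∈ Sym2.map φ e.1 ↔ v ∈ e.1 := by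
    intro v e
    rw [Sym2.mem_map]
    exact ⟨by rintro ⟨w, hw, h⟩; rwa [← hφ h], fun h => ⟨v, h, rfl⟩⟩
  constructor
  · rintro ⟨D, hr, hb, hβ'⟩
    -- Outside of the image of `H` the data get default values, which `DrawnOn` never inspects.
    have hbe : ∀ e : H.edgeSet, Function.extend (fun e : H.edgeSet => Sym2.map φ e.1) D.bends
        (fun _ => 0) (Sym2.map φ e.1) = D.bends e := fun e => hinj.extend_apply _ _ e
    have hpe : ∀ e : H.edgeSet, Function.extend (fun e : H.edgeSet => Sym2.map φ e.1) D.pt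
        (fun _ _ => 0) (Sym2.map φ e.1) = D.pt e := fun e => hinj.extend_apply _ _ e
    have hpos : ∀ w, Function.extend φ D.pos (fun _ => 0) (φ w) = D.pos w :=
      fun w => hφ.extend_apply _ _ w
    refine ⟨Function.extend φ D.pos fun _ => 0,
      Function.extend (fun e : H.edgeSet => Sym2.map φ e.1) D.bends fun _ => 0,
      Function.extend (fun e : H.edgeSet => Sym2.map φ e.1) D.pt fun _ _ => 0, ?_, ?_, ?_⟩
    · constructor
      · rintro _ ⟨a, rfl⟩ _ ⟨c, rfl⟩ h
        rw [hpos, hpos] at h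
        rw [D.pos_injective h]
      · intro e he
        obtain ⟨e, rfl⟩ := hsurj e he
        rw [hbe, hpe, D.ends, Sym2.map_map]
        congr 1
        funext w
        exact (hpos w).symm
      · intro e he
        obtain ⟨e, rfl⟩ := hsurj e he
        rw [hbe, hpe]
        exact ⟨D.nondegenerate e, D.consecutive e, D.bend_angle e, D.nonconsecutive e⟩
      · rintro _ ⟨w, rfl⟩ e he hwe
        obtain ⟨e, rfl⟩ := hsurj e he
        rw [hbe, hpe, hpos]
        rintro ⟨i, hi, hx⟩
        exact D.avoids w e (by rwa [hmemφ] at hwe) i hi hx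
      · intro e he f hf hef
        obtain ⟨e, rfl⟩ := hsurj e he
        obtain ⟨f, rfl⟩ := hsurj f hf
        rw [hbe, hpe, hbe, hpe]
        exact fun x hx => hr e f (by rintro rfl; exact hef rfl) x hx
    · rw [hsum]
      simp only [hbe]
      rw [PolylineDrawing.totalBends] at hb
      convert hb
    · intro e he
      obtain ⟨e, rfl⟩ := hsurj e he
      rw [hbe, ← hβ]
      exact hβ' e
  · rintro ⟨pos, bends, pt, hD, hb, hβ'⟩
    refine ⟨⟨fun w => pos (φ w), fun e => bends (Sym2.map φ e.1), fun e => pt (Sym2.map φ e.1),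
      fun a c h => hφ (hD.pos_injOn ⟨a, rfl⟩ ⟨c, rfl⟩ h), fun e => ?_,
      fun e => (hD.isPolyline _ (hmem e)).nondegenerate,
      fun e => (hD.isPolyline _ (hmem e)).consecutive,
      fun e => (hD.isPolyline _ (hmem e)).bend_angle,
      fun e => (hD.isPolyline _ (hmem e)).nonconsecutive, ?_⟩, ?_, ?_, ?_⟩
    · rw [hD.ends _ (hmem e), Sym2.map_map]; rfl
    · intro v e hv i hi hx
      exact hD.avoids (φ v) ⟨v, rfl⟩ _ (hmem e) (by rwa [hmemφ]) ⟨i, hi, hx⟩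
    · intro e f hef x hx
      exact hD.rac _ (hmem e) _ (hmem f) (fun h => hef (hinj h)) x hx
    · rw [hsum] at hb
      rw [PolylineDrawing.totalBends]
      convert hb
    · intro e
      rw [hβ]
      exact hβ' _ (hmem e)

/-! ### Few edges at a vertex are bent or crossed -/

/-- The edge `e` is drawn as a segment without crossings. -/
def Clean (G : SimpleGraph V) (S : Set V) (bends : Sym2 V → ℕ) (pt : Sym2 V → ℕ → Plane)
    (e : Sym2 V) : Prop :=
  bends e = 0 ∧ ∀ f ∈ edgesIn G S, f ≠ e →
    Disjoint (polyInt (bends e) (pt e)) (polyInt (bends f) (pt f))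

namespace DrawnOn

variable {G : SimpleGraph V} {S : Set V} {pos : V → Plane} {bends : Sym2 V → ℕ}
  {pt : Sym2 V → ℕ → Plane} (hD : DrawnOn G S pos bends pt)
include hD

theorem exists_end {e : Sym2 V} (he : e ∈ edgesIn G S) {z : Plane}
    (hz : z ∈ ({pt e 0, pt e (bends e + 1)} : Set Plane)) : ∃ w ∈ e, z = pos w := by
  have : z ∈ s(pt e 0, pt e (bends e + 1)) := Sym2.mem_iff.2 hz
  rw [hD.ends e he, Sym2.mem_map] at this
  obtain ⟨w, hw, rfl⟩ := this
  exact ⟨w, hw, rfl⟩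

theorem mem_of_pos_mem {e : Sym2 V} (he : e ∈ edgesIn G S) {w : V} (hw : w ∈ S)
    (h : pos w ∈ polyCurve (bends e) (pt e)) : w ∈ e := by
  by_contra hcon
  exact hD.avoids w hw e he hcon h

theorem straight {u v : V} (he : s(u, v) ∈ edgesIn G S) (hb : bends s(u, v) = 0) :
    (pt s(u, v) 0 = pos u ∧ pt s(u, v) 1 = pos v) ∨
      (pt s(u, v) 0 = pos v ∧ pt s(u, v) 1 = pos u) := by
  have := hD.ends _ he
  rw [hb, Sym2.map_mk] at this
  simpa using this

theorem curve_straight {u v : V} (he : s(u, v) ∈ edgesIn G S) (hb : bends s(u, v) = 0) :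
    polyCurve (bends s(u, v)) (pt s(u, v)) = segment ℝ (pos u) (pos v) := by
  rw [hb, polyCurve_zero]
  rcases hD.straight he hb with ⟨h0, h1⟩ | ⟨h0, h1⟩
  · rw [h0, h1]
  · rw [h0, h1, segment_symm]

theorem openSegment_straight {u v : V} (he : s(u, v) ∈ edgesIn G S) (hb : bends s(u, v) = 0) :
    openSegment ℝ (pt s(u, v) 0) (pt s(u, v) (0 + 1)) = openSegment ℝ (pos u) (pos v) := by
  rw [zero_add]
  rcases hD.straight he hb with ⟨h0, h1⟩ | ⟨h0, h1⟩
  · rw [h0, h1]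
  · rw [h0, h1, openSegment_symm]

theorem inner_straight {u v : V} (he : s(u, v) ∈ edgesIn G S) (hb : bends s(u, v) = 0)
    {w : Plane} (h : inner ℝ w (pt s(u, v) (0 + 1) - pt s(u, v) 0) = (0 : ℝ)) :
    inner ℝ w (pos v - pos u) = (0 : ℝ) := by
  rw [zero_add] at h
  rcases hD.straight he hb with ⟨h0, h1⟩ | ⟨h0, h1⟩
  · rwa [h0, h1] at h
  · rw [h0, h1, ← neg_sub, inner_neg_right, neg_eq_zero] at h
    exact h

/-- A clean edge meets another edge in common end-vertices only. -/
theorem clean_inter {e f : Sym2 V} (he : e ∈ edgesIn G S) (hf : f ∈ edgesIn G S)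
    (hc : Clean G S bends pt e) (hfe : f ≠ e) {z : Plane}
    (hz : z ∈ polyCurve (bends e) (pt e)) (hz' : z ∈ polyCurve (bends f) (pt f)) :
    ∃ w, w ∈ e ∧ w ∈ f ∧ z = pos w := by
  by_cases h : z ∈ polyInt (bends e) (pt e)
  · have h' : z ∉ polyInt (bends f) (pt f) := Set.disjoint_left.1 (hc.2 f hf hfe) h
    have h2 : z ∈ ({pt f 0, pt f (bends f + 1)} : Set Plane) := by
      by_contra h2; exact h' ⟨hz', h2⟩
    obtain ⟨w, hw, rfl⟩ := hD.exists_end hf h2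
    exact ⟨w, hD.mem_of_pos_mem he (hf.2 w hw) hz, hw, rfl⟩
  · have h2 : z ∈ ({pt e 0, pt e (bends e + 1)} : Set Plane) := by
      by_contra h2; exact h ⟨hz, h2⟩
    obtain ⟨w, hw, rfl⟩ := hD.exists_end he h2
    exact ⟨w, hw, hD.mem_of_pos_mem hf (he.2 w hw) hz', rfl⟩

end DrawnOn

open Classical in
/-- The points from which the segments that cross a straight edge emanate: the vertices in the
vertex cover and the bends. -/
def specialPoints [Finite V] (G : SimpleGraph V) (S : Set V) (C : Finset V) (pos : V → Plane)
    (bends : Sym2 V → ℕ) (pt : Sym2 V → ℕ → Plane) : Finset Plane :=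
  C.image pos ∪
    (edgesIn G S).toFinite.toFinset.biUnion fun e => (Finset.Icc 1 (bends e)).image (pt e)

theorem card_specialPoints_le [Finite V] (G : SimpleGraph V) (S : Set V) (C : Finset V)
    (pos : V → Plane) (bends : Sym2 V → ℕ) (pt : Sym2 V → ℕ → Plane) :
    (specialPoints G S C pos bends pt).card ≤
      C.card + ∑ e ∈ (edgesIn G S).toFinite.toFinset, bends e := by
  classical
  refine (Finset.card_union_le _ _).trans (add_le_add Finset.card_image_le ?_)
  refine Finset.card_biUnion_le.trans (Finset.sum_le_sum fun e _ => ?_)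
  refine Finset.card_image_le.trans ?_
  simp

/-- The straight edge `xu` is crossed in `z` by a segment `pr` of the edge `e`. -/
structure CrossedAt (G : SimpleGraph V) (S : Set V) (pos : V → Plane) (bends : Sym2 V → ℕ)
    (pt : Sym2 V → ℕ → Plane) (x u : V) (p r z : Plane) (e : Sym2 V) (i : ℕ) : Prop where
  edge_mem : e ∈ edgesIn G S
  index_le : i ≤ bends e
  segment_eq : openSegment ℝ p r = openSegment ℝ (pt e i) (pt e (i + 1))
  orthogonal : ∀ w : Plane, inner ℝ (pt e (i + 1) - pt e i) w = (0 : ℝ) ↔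
    inner ℝ (r - p) w = (0 : ℝ)
  inner_eq_zero : inner ℝ (r - p) (pos u - pos x) = (0 : ℝ)
  mem : z ∈ openSegment ℝ p r
  mem' : z ∈ openSegment ℝ (pos x) (pos u)
  ne : p ≠ r
  left_ne : p ≠ pos x
  right_ne : r ≠ pos x

namespace DrawnOn

variable {G : SimpleGraph V} {S : Set V} {pos : V → Plane} {bends : Sym2 V → ℕ}
  {pt : Sym2 V → ℕ → Plane} (hD : DrawnOn G S pos bends pt)
include hD

/-- Every segment of a bent edge has a bend as an end, and a straight edge has an end-vertex in the
cover. The crossing segment is oriented so that it starts at such a point. -/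
theorem exists_crossedAt [Finite V] {C : Finset V} (hC : ∀ e ∈ G.edgeSet, ∃ v ∈ e, v ∈ C)
    {x u : V} (he : s(x, u) ∈ edgesIn G S) (hb : bends s(x, u) = 0)
    (hc : ¬ Clean G S bends pt s(x, u)) :
    ∃ p ∈ specialPoints G S C pos bends pt, ∃ r z e i,
      CrossedAt G S pos bends pt x u p r z e i := by
  classical
  simp only [Clean, hb, true_and, not_forall, Set.not_disjoint_iff] at hc
  obtain ⟨f, hf, hfe, z, hz, hz'⟩ := hc
  obtain ⟨i, hi, j, hj, h1, h2, h3⟩ := hD.rac _ hf _ he hfe z ⟨hz', by rwa [hb]⟩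
  obtain rfl : j = 0 := by omega
  rw [hD.openSegment_straight he hb] at h2
  replace h3 := hD.inner_straight he hb h3
  have hne := (hD.isPolyline f hf).nondegenerate i hi
  -- A segment that starts at `x` cannot be perpendicular to `xu` at an interior point of `xu`.
  have hl : pt f i ≠ pos x := by
    intro h
    rw [h] at h1 h3
    have := eq_of_orthogonal_of_mem h2 h1 h3
    rw [← this, left_mem_openSegment_iff, ← h] at h1
    exact hne h1
  have hr : pt f (i + 1) ≠ pos x := by
    intro h
    rw [openSegment_symm, h] at h1
    rw [h, ← neg_sub, inner_neg_left, neg_eq_zero] at h3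
    have := eq_of_orthogonal_of_mem h2 h1 h3
    rw [← this, left_mem_openSegment_iff, ← h] at h1
    exact hne h1.symm
  have forward : CrossedAt G S pos bends pt x u (pt f i) (pt f (i + 1)) z f i :=
    ⟨hf, hi, rfl, fun _ => Iff.rfl, h3, h1, h2, hne, hl, hr⟩
  have backward : CrossedAt G S pos bends pt x u (pt f (i + 1)) (pt f i) z f i := by
    refine ⟨hf, hi, openSegment_symm _ _ _, fun w => ?_, ?_, ?_, h2, hne.symm, hr, hl⟩
    · rw [← neg_sub, inner_neg_left, neg_eq_zero]
    · rw [← neg_sub, inner_neg_left, neg_eq_zero]; exact h3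
    · rwa [openSegment_symm]
  have hbend : ∀ j, 1 ≤ j → j ≤ bends f → pt f j ∈ specialPoints G S C pos bends pt := by
    intro j h1 h2
    refine Finset.mem_union_right _ (Finset.mem_biUnion.2 ⟨f, by simpa using hf, ?_⟩)
    exact Finset.mem_image_of_mem _ (by simp [h1, h2])
  -- The special end is a cover vertex if `f` is straight, the far end of the segment if it is the
  -- first one of a bent edge, and its near end otherwise.
  rcases Nat.eq_zero_or_pos (bends f) with h0 | h0
  · obtain rfl : i = 0 := by omega
    obtain ⟨c, hcf, hcC⟩ := hC f hf.1
    obtain ⟨d, rfl⟩ := Sym2.mem_iff_exists.1 hcf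
    have hs : pos c ∈ specialPoints G S C pos bends pt :=
      Finset.mem_union_left _ (Finset.mem_image_of_mem _ hcC)
    rcases hD.straight hf h0 with ⟨e0, e1⟩ | ⟨e0, e1⟩
    · exact ⟨_, by rwa [e0], _, _, _, _, forward⟩
    · exact ⟨_, by rwa [zero_add, e1], _, _, _, _, backward⟩
  · rcases Nat.eq_zero_or_pos i with rfl | hi0
    · exact ⟨_, hbend _ le_rfl h0, _, _, _, _, backward⟩
    · exact ⟨_, hbend _ hi0 hi, _, _, _, _, forward⟩

/-- A segment that crosses the straight edge `xu` cannot cross another straight edge `xv`. -/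
theorem not_crossedAt_of_mem {x u v : V} (hu : s(x, u) ∈ edgesIn G S)
    (hbu : bends s(x, u) = 0) {p r z : Plane} {e : Sym2 V} {i : ℕ}
    (hc : CrossedAt G S pos bends pt x v p r z e i) {z' r' : Plane} {e' : Sym2 V} {i' : ℕ}
    (hc' : CrossedAt G S pos bends pt x u p r' z' e' i') {y : Plane}
    (hy : y ∈ openSegment ℝ p z) (hy' : y ∈ openSegment ℝ (pos x) z') : False := by
  have hxu : pos x ≠ pos u := by
    intro h
    have h2 := hD.pos_injOn (mk_mem_edgesIn.1 hu).2.1 (mk_mem_edgesIn.1 hu).2.2 h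
    exact G.ne_of_adj (mk_mem_edgesIn.1 hu).1 h2
  obtain ⟨s, s0, s1, a0, a1⟩ := mem_openSegment_iff.1 hc.mem
  obtain ⟨t, t0, t1, b0, b1⟩ := mem_openSegment_iff.1 hy
  obtain ⟨m, m0, m1, c0, c1⟩ := mem_openSegment_iff.1 hc'.mem'
  obtain ⟨n, n0, n1, d0, d1⟩ := mem_openSegment_iff.1 hy'
  obtain ⟨k, k0, k1, f0, f1⟩ := mem_openSegment_iff.1 hc'.mem
  have hyr : y ∈ openSegment ℝ p r :=
    mem_openSegment_iff.2 ⟨t * s, by positivity, by nlinarith, by rw [b0, a0]; ring,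
      by rw [b1, a1]; ring⟩
  have hyu : y ∈ openSegment ℝ (pos x) (pos u) :=
    mem_openSegment_iff.2 ⟨n * m, by positivity, by nlinarith, by rw [d0, c0]; ring,
      by rw [d1, c1]; ring⟩
  -- Were `e` the edge `xu` itself, `x` would be an end of the segment `pr`.
  have hne : e ≠ s(x, u) := by
    rintro rfl
    have hi := hc.index_le
    rw [hbu] at hi
    obtain rfl : i = 0 := by omega
    have h1 := hc.segment_eq
    rw [hD.openSegment_straight hu hbu] at h1
    -- two equal open segments have equal closures
    have h2 : segment ℝ p r = segment ℝ (pos x) (pos u) := by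
      rw [← closure_openSegment, ← closure_openSegment, h1]
    have hx : pos x ∈ segment ℝ p r := by rw [h2]; exact left_mem_segment ℝ _ _
    rw [← insert_endpoints_openSegment, h1] at hx
    rcases hx with hx | hx | hx
    · exact hc.left_ne hx.symm
    · exact hc.right_ne hx.symm
    · rw [left_mem_openSegment_iff] at hx; exact hxu hx
  rw [hc.segment_eq] at hyr
  have hye := (hD.isPolyline e hc.edge_mem).openSegment_subset_polyInt hc.index_le hyr
  have hyu' : y ∈ polyInt (bends s(x, u)) (pt s(x, u)) := by
    refine (hD.isPolyline _ hu).openSegment_subset_polyInt (Nat.zero_le _) ?_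
    rwa [hD.openSegment_straight hu hbu]
  obtain ⟨i₁, hi₁, j, hj, h1, h2, h3⟩ := hD.rac _ hc.edge_mem _ hu hne y ⟨hye, hyu'⟩
  obtain rfl := (hD.isPolyline e hc.edge_mem).index_unique hi₁ hc.index_le h1 hyr
  obtain rfl : j = 0 := by omega
  replace h3 := (hc.orthogonal _).1 (hD.inner_straight hu hbu h3)
  have h4 := hc'.inner_eq_zero
  -- Both `y` and `z'` would be feet of perpendiculars from `p` to the line `xu`, although `y` lies
  -- strictly between `x` and `z'`.
  have h5 : inner ℝ (y - p) (z' - pos x) = (0 : ℝ) := by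
    simp only [inner_eq, PiLp.sub_apply] at h3 ⊢
    rw [b0, b1, a0, a1, c0, c1]
    linear_combination t * s * m * h3
  have h6 : inner ℝ (z' - p) (z' - pos x) = (0 : ℝ) := by
    simp only [inner_eq, PiLp.sub_apply] at h4 ⊢
    have g0 : z' 0 - p 0 = k * (r' 0 - p 0) := by linarith
    have g1 : z' 1 - p 1 = k * (r' 1 - p 1) := by linarith
    have g2 : z' 0 - pos x 0 = m * (pos u 0 - pos x 0) := by linarith
    have g3 : z' 1 - pos x 1 = m * (pos u 1 - pos x 1) := by linarith
    rw [g0, g1, g2, g3]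
    linear_combination k * m * h4
  have h7 := eq_of_mem_openSegment_of_orthogonal hy' h6 h5
  have h8 := hc'.mem'
  rw [← h7, left_mem_openSegment_iff] at h8
  exact hxu h8

/-- Two straight edges `xu` and `xv` crossed from the same point lie on different sides of it. -/
theorem cross_mul_cross_nonpos {x u v : V} (huv : u ≠ v) (hu : s(x, u) ∈ edgesIn G S)
    (hbu : bends s(x, u) = 0) (hv : s(x, v) ∈ edgesIn G S) (hbv : bends s(x, v) = 0)
    {p r r' z z' : Plane} {e e' : Sym2 V} {i i' : ℕ}
    (hc : CrossedAt G S pos bends pt x u p r z e i)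
    (hc' : CrossedAt G S pos bends pt x v p r' z' e' i') :
    cross (p - pos x) (pos u - pos x) * cross (p - pos x) (pos v - pos x) ≤ 0 := by
  by_contra hcon
  push Not at hcon
  have foot : ∀ {u r z e i}, CrossedAt G S pos bends pt x u p r z e i →
      inner ℝ (z - p) (z - pos x) = (0 : ℝ) ∧ ∃ m : ℝ, 0 < m ∧
        cross (p - pos x) (z - pos x) = m * cross (p - pos x) (pos u - pos x) := by
    intro u r z e i hc
    obtain ⟨k, k0, k1, f0, f1⟩ := mem_openSegment_iff.1 hc.mem
    obtain ⟨m, m0, m1, c0, c1⟩ := mem_openSegment_iff.1 hc.mem'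
    have h4 := hc.inner_eq_zero
    have g0 : z 0 - p 0 = k * (r 0 - p 0) := by linarith
    have g1 : z 1 - p 1 = k * (r 1 - p 1) := by linarith
    have g2 : z 0 - pos x 0 = m * (pos u 0 - pos x 0) := by linarith
    have g3 : z 1 - pos x 1 = m * (pos u 1 - pos x 1) := by linarith
    refine ⟨?_, m, m0, ?_⟩
    · simp only [inner_eq, PiLp.sub_apply] at h4 ⊢
      rw [g0, g1, g2, g3]
      linear_combination k * m * h4
    · simp only [cross, PiLp.sub_apply]
      rw [g2, g3]; ring
  obtain ⟨h1, m, m0, hm⟩ := foot hc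
  obtain ⟨h2, n, n0, hn⟩ := foot hc'
  have hpos : 0 < cross (p - pos x) (z - pos x) * cross (p - pos x) (z' - pos x) := by
    rw [hm, hn]
    have : 0 < m * n * (cross (p - pos x) (pos u - pos x) * cross (p - pos x) (pos v - pos x)) := by
      positivity
    linarith
  -- A common foot would be a crossing of `xu` and `xv`, perpendicular although both start at `x`.
  -- Crossing legs are excluded by `not_crossedAt_of_mem`.
  rcases legs_cross h1 h2 hpos with rfl | ⟨y, hy, hy'⟩ | ⟨y, hy, hy'⟩
  · have hzu : z ∈ polyInt (bends s(x, u)) (pt s(x, u)) := by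
      refine (hD.isPolyline _ hu).openSegment_subset_polyInt (Nat.zero_le _) ?_
      rw [hD.openSegment_straight hu hbu]
      exact hc.mem'
    have hzv : z ∈ polyInt (bends s(x, v)) (pt s(x, v)) := by
      refine (hD.isPolyline _ hv).openSegment_subset_polyInt (Nat.zero_le _) ?_
      rw [hD.openSegment_straight hv hbv]
      exact hc'.mem'
    have hne : s(x, u) ≠ s(x, v) := fun h => huv (Sym2.congr_right.1 h)
    obtain ⟨i₁, hi₁, j, hj, -, -, h3⟩ := hD.rac _ hu _ hv hne z ⟨hzu, hzv⟩
    obtain rfl : j = 0 := by omega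
    obtain rfl : i₁ = 0 := by omega
    replace h3 := hD.inner_straight hv hbv h3
    rw [real_inner_comm] at h3
    replace h3 := hD.inner_straight hu hbu h3
    have := eq_of_orthogonal_of_mem hc.mem' hc'.mem' h3
    rw [← this] at hm
    simp [cross] at hm
    rcases hm with hm | hm
    · exact m0.ne' hm
    · simp [cross, hm] at hcon
  · exact hD.not_crossedAt_of_mem hu hbu hc' hc hy hy'
  · exact hD.not_crossedAt_of_mem hv hbv hc hc' hy hy'

/-- Most of the edges from a vertex `x` to vertices in a set `T` are drawn as segments
without crossings. -/
theorem card_not_clean_le [Finite V] [DecidableEq V] {C : Finset V}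
    (hC : ∀ e ∈ G.edgeSet, ∃ v ∈ e, v ∈ C) {b : ℕ}
    (hb : ∑ e ∈ (edgesIn G S).toFinite.toFinset, bends e ≤ b) {x : V} {T : Finset V}
    (hT : ∀ u ∈ T, s(x, u) ∈ edgesIn G S)
    [DecidablePred fun u => ¬ Clean G S bends pt s(x, u)] :
    (T.filter fun u => ¬ Clean G S bends pt s(x, u)).card ≤ 3 * (C.card + b) := by
  classical
  have hbent : (T.filter fun u => bends s(x, u) ≠ 0).card ≤ b := by
    refine le_trans ?_ hb
    calc _ = ∑ u ∈ T.filter (fun u => bends s(x, u) ≠ 0), 1 := by simp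
      _ ≤ ∑ u ∈ T.filter (fun u => bends s(x, u) ≠ 0), bends s(x, u) :=
        Finset.sum_le_sum fun u hu => Nat.one_le_iff_ne_zero.2 (Finset.mem_filter.1 hu).2
      _ = ∑ e ∈ (T.filter fun u => bends s(x, u) ≠ 0).image (fun u => s(x, u)), bends e := by
        rw [Finset.sum_image]
        intro u _ v _ h
        exact Sym2.congr_right.1 h
      _ ≤ _ := by
        refine Finset.sum_le_sum_of_subset fun e he => ?_
        obtain ⟨u, hu, rfl⟩ := Finset.mem_image.1 he
        simpa using hT u (Finset.mem_filter.1 hu).1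
  -- A crossed straight edge is determined by its special point `p` and the side of the line `xp` on
  -- which `u` lies. The side is well defined, since `u` is off this line by
  -- `cross_ne_zero_of_foot`.
  have hcr : (T.filter fun u => bends s(x, u) = 0 ∧ ¬ Clean G S bends pt s(x, u)).card ≤
      (C.card + b) * 2 := by
    have hw : ∀ u ∈ T.filter (fun u => bends s(x, u) = 0 ∧ ¬ Clean G S bends pt s(x, u)),
        ∃ p ∈ specialPoints G S C pos bends pt, ∃ r z e i,
          CrossedAt G S pos bends pt x u p r z e i := by
      intro u hu
      rw [Finset.mem_filter] at hu
      exact hD.exists_crossedAt hC (hT u hu.1) hu.2.1 hu.2.2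
    choose! p hp r z e i hcr using hw
    calc _ ≤ (specialPoints G S C pos bends pt ×ˢ (Finset.univ : Finset Bool)).card := by
          refine Finset.card_le_card_of_injOn
            (fun u => (p u, decide (0 < cross (p u - pos x) (pos u - pos x)))) ?_ ?_
          · intro u hu
            exact Finset.mem_coe.2 (Finset.mem_product.2 ⟨hp u hu, Finset.mem_univ _⟩)
          · intro u hu v hv huv
            simp only [Prod.mk.injEq] at huv
            by_contra hne
            have h1 := hcr u hu
            have h2 := hcr v hv
            have hxne : ∀ w ∈ T, pos x ≠ pos w := fun w hw h =>
              G.ne_of_adj (mk_mem_edgesIn.1 (hT w hw)).1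
                (hD.pos_injOn (mk_mem_edgesIn.1 (hT w hw)).2.1
                  (mk_mem_edgesIn.1 (hT w hw)).2.2 h)
            have hu' := Finset.mem_filter.1 (Finset.mem_coe.1 hu)
            have hv' := Finset.mem_filter.1 (Finset.mem_coe.1 hv)
            have c1 := cross_ne_zero_of_foot h1.mem' h1.mem h1.ne (hxne u hu'.1) h1.inner_eq_zero
            have c2 := cross_ne_zero_of_foot h2.mem' h2.mem h2.ne (hxne v hv'.1) h2.inner_eq_zero
            rw [← huv.1] at h2 c2
            have := hD.cross_mul_cross_nonpos hne (hT u hu'.1) hu'.2.1 (hT v hv'.1) hv'.2.1 h1 h2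
            have h3 := huv.2
            rw [← huv.1, decide_eq_decide] at h3
            rcases lt_or_gt_of_ne c1 with g1 | g1
            · have g2 : cross (p u - pos x) (pos v - pos x) < 0 :=
                lt_of_le_of_ne (not_lt.1 fun h => (h3.2 h).not_gt g1) c2
              nlinarith
            · nlinarith [h3.1 g1]
      _ = (specialPoints G S C pos bends pt).card * 2 := by simp
      _ ≤ (C.card + b) * 2 := Nat.mul_le_mul_right _
        ((card_specialPoints_le G S C pos bends pt).trans (Nat.add_le_add_left hb _))
  have hsub : (T.filter fun u => ¬ Clean G S bends pt s(x, u)) ⊆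
      (T.filter fun u => bends s(x, u) ≠ 0) ∪
      T.filter fun u => bends s(x, u) = 0 ∧ ¬ Clean G S bends pt s(x, u) := by
    intro u hu
    rw [Finset.mem_filter] at hu
    rw [Finset.mem_union, Finset.mem_filter, Finset.mem_filter]
    tauto
  have h1 := Finset.card_le_card hsub
  have h2 := Finset.card_union_le (T.filter fun u => bends s(x, u) ≠ 0)
    (T.filter fun u => bends s(x, u) = 0 ∧ ¬ Clean G S bends pt s(x, u))
  omega

/-- Many vertices with at most three common neighbours contain many whose edges to them are
all drawn as segments without crossings. -/
theorem exists_clean_subset [Finite V] [DecidableEq V] {C : Finset V}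
    (hC : ∀ e ∈ G.edgeSet, ∃ v ∈ e, v ∈ C) {b m : ℕ}
    (hb : ∑ e ∈ (edgesIn G S).toFinite.toFinset, bends e ≤ b) {A T : Finset V}
    (hA : A.card ≤ 3) (hT : ∀ a ∈ A, ∀ u ∈ T, s(a, u) ∈ edgesIn G S)
    (hm : 9 * (C.card + b) + m ≤ T.card) :
    ∃ T' ⊆ T, m ≤ T'.card ∧ ∀ a ∈ A, ∀ u ∈ T', Clean G S bends pt s(a, u) := by
  classical
  refine ⟨T.filter fun u => ∀ a ∈ A, Clean G S bends pt s(a, u), Finset.filter_subset _ _, ?_,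
    fun a ha u hu => (Finset.mem_filter.1 hu).2 a ha⟩
  have h1 := Finset.card_filter_add_card_filter_not (s := T)
    fun u => ∀ a ∈ A, Clean G S bends pt s(a, u)
  have h2 : (T.filter fun u => ¬ ∀ a ∈ A, Clean G S bends pt s(a, u)).card ≤
      9 * (C.card + b) := by
    calc _ ≤ (A.biUnion fun a => T.filter fun u => ¬ Clean G S bends pt s(a, u)).card := by
          refine Finset.card_le_card fun u hu => ?_
          rw [Finset.mem_filter] at hu
          push Not at hu
          obtain ⟨hu, a, ha, h⟩ := hu
          exact Finset.mem_biUnion.2 ⟨a, ha, Finset.mem_filter.2 ⟨hu, h⟩⟩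
      _ ≤ ∑ a ∈ A, (T.filter fun u => ¬ Clean G S bends pt s(a, u)).card :=
        Finset.card_biUnion_le
      _ ≤ ∑ a ∈ A, 3 * (C.card + b) :=
        Finset.sum_le_sum fun a ha => hD.card_not_clean_le hC hb (hT a ha)
      _ ≤ _ := by
        rw [Finset.sum_const, smul_eq_mul]
        nlinarith
  omega

/-- Disjoint clean edges are disjoint as segments. -/
theorem disjoint_of_clean {x y u v : V} (hxu : s(x, u) ∈ edgesIn G S)
    (hyv : s(y, v) ∈ edgesIn G S) (hc : Clean G S bends pt s(x, u))
    (hc' : Clean G S bends pt s(y, v)) (h1 : x ≠ y) (h2 : x ≠ v) (h3 : u ≠ y) (h4 : u ≠ v) :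
    Disjoint (segment ℝ (pos x) (pos u)) (segment ℝ (pos y) (pos v)) := by
  rw [Set.disjoint_left]
  intro z hz hz'
  rw [← hD.curve_straight hxu hc.1] at hz
  rw [← hD.curve_straight hyv hc'.1] at hz'
  obtain ⟨w, hw, hw', -⟩ := hD.clean_inter hxu hyv hc (by simp; tauto) hz hz'
  simp only [Sym2.mem_iff] at hw hw'
  rcases hw with rfl | rfl <;> rcases hw' with rfl | rfl <;> contradiction

theorem notMem_of_clean {x u w : V} (hxu : s(x, u) ∈ edgesIn G S)
    (hc : Clean G S bends pt s(x, u)) (hw : w ∈ S) (h1 : w ≠ x) (h2 : w ≠ u) :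
    pos w ∉ segment ℝ (pos x) (pos u) := by
  rw [← hD.curve_straight hxu hc.1]
  exact hD.avoids w hw _ hxu (by simp [h1, h2])

/-- Clean edges without a common vertex are disjoint, so the statements about disjoint segments
apply. The sign zero cannot occur: with both `u` and `v` on the line `xy`, some edge would pass
through a further vertex. -/
theorem cross_neg_of_clean {x y u v : V} (hxy : x ≠ y) (huv : u ≠ v)
    (hxu : s(x, u) ∈ edgesIn G S) (hxv : s(x, v) ∈ edgesIn G S)
    (hyu : s(y, u) ∈ edgesIn G S) (hyv : s(y, v) ∈ edgesIn G S)
    (cxu : Clean G S bends pt s(x, u)) (cxv : Clean G S bends pt s(x, v))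
    (cyu : Clean G S bends pt s(y, u)) (cyv : Clean G S bends pt s(y, v))
    (hs : SignType.sign (cross (pos y - pos x) (pos u - pos x)) =
      SignType.sign (cross (pos y - pos x) (pos v - pos x))) :
    cross (pos v - pos u) (pos x - pos u) * cross (pos v - pos u) (pos y - pos u) < 0 := by
  have mxu := mk_mem_edgesIn.1 hxu
  have mxv := mk_mem_edgesIn.1 hxv
  have myu := mk_mem_edgesIn.1 hyu
  have myv := mk_mem_edgesIn.1 hyv
  have d1 := hD.disjoint_of_clean hxu hyv cxu cyv hxy mxv.1.ne myu.1.ne' huv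
  have d2 := hD.disjoint_of_clean hxv hyu cxv cyu hxy mxu.1.ne myv.1.ne' huv.symm
  rcases eq_or_ne (cross (pos y - pos x) (pos u - pos x)) 0 with h0 | h0
  · have h0' : cross (pos y - pos x) (pos v - pos x) = 0 := by
      rw [h0, sign_zero, eq_comm, sign_eq_zero_iff] at hs
      exact hs
    exact (collinear_middle_eq h0 h0' (fun h => hxy (hD.pos_injOn mxu.2.1 myu.2.1 h))
      (hD.notMem_of_clean hxu cxu myu.2.1 hxy.symm myu.1.ne)
      (hD.notMem_of_clean hyu cyu mxu.2.1 hxy mxu.1.ne)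
      (hD.notMem_of_clean hxv cxv myu.2.1 hxy.symm myv.1.ne)
      (hD.notMem_of_clean hyv cyv mxu.2.1 hxy mxv.1.ne)
      (hD.notMem_of_clean hxv cxv mxu.2.2 mxu.1.ne' huv)
      (hD.notMem_of_clean hxu cxu mxv.2.2 mxv.1.ne' huv.symm)).elim
  · refine cross_mul_cross_neg d1 d2 ?_
    rcases lt_or_gt_of_ne h0 with h | h
    · rw [sign_neg h, eq_comm, sign_eq_neg_one_iff] at hs
      exact mul_pos_of_neg_of_neg h hs
    · rw [sign_pos h, eq_comm, sign_eq_one_iff] at hs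
      exact mul_pos h hs

/-- There is no crossing-free straight-line drawing of a complete bipartite graph with parts of
size three and 28. -/
theorem card_le_of_clean {x y z : V} (hxy : x ≠ y) (hyz : y ≠ z) (hxz : x ≠ z) {T : Finset V}
    (hT : ∀ a ∈ ({x, y, z} : Set V), ∀ u ∈ T, s(a, u) ∈ edgesIn G S)
    (hc : ∀ a ∈ ({x, y, z} : Set V), ∀ u ∈ T, Clean G S bends pt s(a, u)) : T.card ≤ 27 := by
  by_contra hcon
  push Not at hcon
  -- Each of the three lines has two sides and itself as possible positions, which makes `3 ^ 3 =
  -- 27` patterns.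
  obtain ⟨u, hu, v, hv, huv, h⟩ := Finset.exists_ne_map_eq_of_card_lt_of_maps_to
    (t := (Finset.univ : Finset (SignType × SignType × SignType)))
    (f := fun u => (SignType.sign (cross (pos y - pos x) (pos u - pos x)),
      SignType.sign (cross (pos z - pos y) (pos u - pos y)),
      SignType.sign (cross (pos z - pos x) (pos u - pos x)))) (s := T)
    (lt_of_le_of_lt (by decide) hcon) (fun _ _ => Finset.mem_univ _)
  simp only [Prod.mk.injEq] at h
  have hx : x ∈ ({x, y, z} : Set V) := by simp
  have hy : y ∈ ({x, y, z} : Set V) := by simp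
  have hz : z ∈ ({x, y, z} : Set V) := by simp
  have key : ∀ a ∈ ({x, y, z} : Set V), ∀ c ∈ ({x, y, z} : Set V), a ≠ c →
      SignType.sign (cross (pos c - pos a) (pos u - pos a)) =
        SignType.sign (cross (pos c - pos a) (pos v - pos a)) →
      cross (pos v - pos u) (pos a - pos u) * cross (pos v - pos u) (pos c - pos u) < 0 :=
    fun a ha c hc' hac hs => hD.cross_neg_of_clean hac huv (hT a ha u hu) (hT a ha v hv)
      (hT c hc' u hu) (hT c hc' v hv) (hc a ha u hu) (hc a ha v hv) (hc c hc' u hu)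
      (hc c hc' v hv) hs
  have k1 := key x hx y hy hxy h.1
  have k2 := key y hy z hz hyz h.2.1
  have k3 := key x hx z hz hxz h.2.2
  -- The product of the first two left-hand sides is the left-hand side of `k3` times a square,
  -- hence not positive.
  have := mul_pos_of_neg_of_neg k1 k2
  nlinarith [sq_nonneg (cross (pos v - pos u) (pos y - pos u))]

end DrawnOn

/-! ### Adding a twin of a vertex with at most two neighbours -/

/-- A point of the plane that may represent a new vertex with neighbourhood `A`. -/
structure IsTwinPosition (G : SimpleGraph V) (S : Set V) (pos : V → Plane) (bends : Sym2 V → ℕ)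
    (pt : Sym2 V → ℕ → Plane) (A : Finset V) (q : Plane) : Prop where
  pos_ne : ∀ w ∈ S, pos w ≠ q
  notMem_curve : ∀ e ∈ edgesIn G S, q ∉ polyCurve (bends e) (pt e)
  pos_notMem : ∀ a ∈ A, ∀ w ∈ S, w ≠ a → pos w ∉ segment ℝ (pos a) q
  inter_curve : ∀ a ∈ A, ∀ e ∈ edgesIn G S,
    polyCurve (bends e) (pt e) ∩ segment ℝ (pos a) q ⊆ {pos a}
  inter : ∀ a ∈ A, ∀ c ∈ A, a ≠ c → segment ℝ (pos a) q ∩ segment ℝ (pos c) q ⊆ {q}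

namespace DrawnOn

variable {G : SimpleGraph V} {S : Set V} {pos : V → Plane} {bends : Sym2 V → ℕ}
  {pt : Sym2 V → ℕ → Plane} (hD : DrawnOn G S pos bends pt)
include hD

/-- Close to a vertex with at most two edges, all of them clean, there is room for a twin. -/
theorem exists_isTwinPosition [Finite V] {A : Finset V} (hAS : ∀ a ∈ A, a ∈ S)
    (hA : A.card ≤ 2) {u : V} (hu : u ∈ S) (hN : ∀ w ∈ S, G.Adj u w ↔ w ∈ A)
    (hc : ∀ a ∈ A, Clean G S bends pt s(a, u)) :
    ∃ q, IsTwinPosition G S pos bends pt A q := by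
  classical
  have hE : ∀ a ∈ A, s(a, u) ∈ edgesIn G S := fun a ha =>
    mk_mem_edgesIn.2 ⟨((hN a (hAS a ha)).2 ha).symm, hAS a ha, hu⟩
  have hau : ∀ a ∈ A, a ≠ u := fun a ha => (mk_mem_edgesIn.1 (hE a ha)).1.ne
  have hEu : ∀ e ∈ edgesIn G S, u ∈ e → ∃ c ∈ A, e = s(c, u) := by
    intro e he hue
    obtain ⟨c, rfl⟩ := Sym2.mem_iff_exists.1 hue
    have := mk_mem_edgesIn.1 he
    exact ⟨c, (hN c this.2.2).1 this.1, Sym2.eq_swap⟩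
  -- An edge from `u` to one neighbour does not pass through the other one, as an escape direction
  -- requires.
  obtain ⟨d, hd⟩ : ∃ d, IsEscape (pos u) (A.image pos : Finset Plane) d := by
    refine exists_isEscape (Finset.card_image_le.trans hA) ?_ ?_
    · rw [Finset.mem_image]
      rintro ⟨a, ha, h⟩
      exact hau a ha (hD.pos_injOn (hAS a ha) hu h)
    · simp only [Finset.mem_image]
      rintro _ ⟨a, ha, rfl⟩ _ ⟨c, hc', rfl⟩ hne
      rw [segment_symm]
      exact hD.notMem_of_clean (hE c hc') (hc c hc') (hAS a ha) (by rintro rfl; exact hne rfl)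
        (hau a ha)
  have hdA : ∀ a ∈ A, cross (pos u - pos a) d ≠ 0 := fun a ha =>
    hd.cross_ne _ (by simpa using ⟨a, ha, rfl⟩)
  have hpos : ∀ᶠ t in 𝓝[>] (0 : ℝ), 0 < t := self_mem_nhdsWithin
  have hcont : Tendsto (fun t : ℝ => pos u + t • d) (𝓝[>] 0) (𝓝 (pos u)) := by
    have : Continuous fun t : ℝ => pos u + t • d := by fun_prop
    have h := this.tendsto 0
    rw [zero_smul, add_zero] at h
    exact h.mono_left nhdsWithin_le_nhds
  have h1 : ∀ w, ∀ᶠ t in 𝓝[>] (0 : ℝ), w ∈ S → pos w ≠ pos u + t • d := by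
    intro w
    by_cases hwS : w ∈ S
    swap
    · exact .of_forall fun t h => absurd h hwS
    rcases eq_or_ne w u with rfl | hw
    · filter_upwards [hpos] with t ht _
      simpa using ⟨ht.ne', hd.ne_zero⟩
    · have : pos u ≠ pos w := fun h => hw (hD.pos_injOn hu hwS h).symm
      filter_upwards [hcont.eventually_ne this] with t ht _ using ht.symm
  have h2 : ∀ e, ∀ᶠ t in 𝓝[>] (0 : ℝ), e ∈ edgesIn G S →
      pos u + t • d ∉ polyCurve (bends e) (pt e) := by
    intro e
    by_cases he : e ∈ edgesIn G S
    swap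
    · exact .of_forall fun t h => absurd h he
    by_cases hue : u ∈ e
    · obtain ⟨c, hcA, rfl⟩ := hEu e he hue
      rw [hD.curve_straight he (hc c hcA).1]
      filter_upwards [hpos] with t ht _
      rw [segment_symm]
      exact notMem_segment_of_cross_ne_zero (hdA c hcA) ht
    · have := hcont.eventually ((isClosed_polyCurve (bends e) (pt e)).isOpen_compl.mem_nhds
        (hD.avoids u hu e he hue))
      filter_upwards [this] with t ht _ using ht
  have h3 : ∀ a w, ∀ᶠ t in 𝓝[>] (0 : ℝ), a ∈ A → w ∈ S → w ≠ a →
      pos w ∉ segment ℝ (pos a) (pos u + t • d) := by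
    intro a w
    by_cases haw : a ∈ A ∧ w ∈ S ∧ w ≠ a
    swap
    · exact .of_forall fun t h h' h'' => absurd ⟨h, h', h''⟩ haw
    obtain ⟨ha, hwS, hwa⟩ := haw
    rcases eq_or_ne w u with rfl | hw
    · filter_upwards [hpos] with t ht _ _ _
      exact notMem_segment_add_of_cross_ne_zero (hdA a ha) ht
    · have := hD.notMem_of_clean (hE a ha) (hc a ha) hwS hwa hw
      have h := eventually_inter_subset (p := pos w) (r := pos w) (hdA a ha) (by
        rw [segment_same]
        rintro z ⟨rfl, hz⟩
        exact absurd hz this)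
      filter_upwards [h] with t ht _ _ _ hm
      have := ht ⟨left_mem_segment ℝ _ _, hm⟩
      exact hwa (hD.pos_injOn hwS (hAS a ha) this)
  have h4 : ∀ a e, ∀ᶠ t in 𝓝[>] (0 : ℝ), a ∈ A → e ∈ edgesIn G S →
      polyCurve (bends e) (pt e) ∩ segment ℝ (pos a) (pos u + t • d) ⊆ {pos a} := by
    intro a e
    by_cases hae : a ∈ A ∧ e ∈ edgesIn G S
    swap
    · exact .of_forall fun t h h' => absurd ⟨h, h'⟩ hae
    obtain ⟨ha, he⟩ := hae
    -- The edges at `u` are handled by the escape direction for all `t > 0`. Any other edge meets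
    -- the clean edge `au` in `a` at most, which persists for small `t`.
    by_cases hue : u ∈ e
    · obtain ⟨c, hcA, rfl⟩ := hEu e he hue
      rw [hD.curve_straight he (hc c hcA).1, segment_symm]
      filter_upwards [hpos] with t ht _ _
      rcases eq_or_ne a c with rfl | hac
      · exact segment_inter_subset_of_cross_ne_zero (hdA a ha) ht
      · have hne : pos a ≠ pos c := fun h => hac (hD.pos_injOn (hAS a ha) (hAS c hcA) h)
        rw [(hd.disjoint (pos a) (by simpa using ⟨a, ha, rfl⟩) (pos c)
          (by simpa using ⟨c, hcA, rfl⟩) hne t ht).inter_eq]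
        exact Set.empty_subset _
    · have hi : ∀ i, ∀ᶠ t in 𝓝[>] (0 : ℝ), i ≤ bends e →
          segment ℝ (pt e i) (pt e (i + 1)) ∩ segment ℝ (pos a) (pos u + t • d) ⊆ {pos a} := by
        intro i
        by_cases hi : i ≤ bends e
        swap
        · exact .of_forall fun t h => absurd h hi
        have h := eventually_inter_subset (p := pt e i) (r := pt e (i + 1)) (hdA a ha) (by
          rintro z ⟨hz, hz'⟩
          rw [← hD.curve_straight (hE a ha) (hc a ha).1] at hz'
          obtain ⟨w, hw, hw', rfl⟩ := hD.clean_inter (hE a ha) he (hc a ha)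
            (by rintro rfl; simp at hue) hz' ⟨i, hi, hz⟩
          rcases Sym2.mem_iff.1 hw with rfl | rfl
          · rfl
          · exact absurd hw' hue)
        filter_upwards [h] with t ht _ using ht
      have := (eventually_all_finite (Set.finite_Iic (bends e))).2 fun i _ => hi i
      filter_upwards [this] with t ht _ _
      rintro z ⟨⟨i, hi, hz⟩, hz'⟩
      exact ht i hi hi ⟨hz, hz'⟩
  -- There are finitely many vertices and edges, so one small `t > 0` meets all the requirements.
  have hall := (eventually_all.2 h1).and ((eventually_all.2 h2).and
    ((eventually_all.2 fun a => eventually_all.2 (h3 a)).and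
      ((eventually_all.2 fun a => eventually_all.2 (h4 a)).and hpos)))
  obtain ⟨t, g1, g2, g3, g4, ht⟩ := hall.exists
  refine ⟨pos u + t • d, fun w hw => g1 w hw, fun e he => g2 e he,
    fun a ha w hw h => g3 a w ha hw h, fun a ha e he => g4 a e ha he, fun a ha c hc' hac => ?_⟩
  exact hd.inter _ (by simpa using ⟨a, ha, rfl⟩) _ (by simpa using ⟨c, hc', rfl⟩)
    (fun h => hac (hD.pos_injOn (hAS a ha) (hAS c hc') h)) t ht

end DrawnOn

/-- A vertex with neighbourhood `A` can be added to a drawing at a twin position, with straight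
edges. -/
theorem DrawnOn.insert_vertex [Finite V] {G : SimpleGraph V} {S : Set V} {pos : V → Plane}
    {bends : Sym2 V → ℕ} {pt : Sym2 V → ℕ → Plane} (hD : DrawnOn G S pos bends pt)
    {b : ℕ} {β : Sym2 V → ℕ} (hb : ∑ e ∈ (edgesIn G S).toFinite.toFinset, bends e ≤ b)
    (hβ : ∀ e ∈ edgesIn G S, bends e ≤ β e) {A : Finset V} (hAS : ∀ a ∈ A, a ∈ S)
    {v : V} (hv : v ∉ S) (hN : ∀ w ∈ S, G.Adj v w ↔ w ∈ A) {q : Plane}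
    (hq : IsTwinPosition G S pos bends pt A q) : DrawableOn G (insert v S) b β := by
  classical
  let pos' : V → Plane := Function.update pos v q
  let bends' : Sym2 V → ℕ := fun e => if v ∈ e then 0 else bends e
  let pt' : Sym2 V → ℕ → Plane := fun e =>
    if h : v ∈ e then fun i => if i = 0 then q else pos (Sym2.Mem.other h) else pt e
  have hposv : pos' v = q := Function.update_self ..
  have hpos : ∀ w ∈ S, pos' w = pos w := fun w hw =>
    Function.update_of_ne (by rintro rfl; exact hv hw) ..
  have hedge : ∀ e ∈ edgesIn G (insert v S),
      (∃ a ∈ A, e = s(v, a)) ∨ e ∈ edgesIn G S ∧ v ∉ e := by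
    intro e he
    by_cases hve : v ∈ e
    · left
      obtain ⟨a, rfl⟩ := Sym2.mem_iff_exists.1 hve
      have := mk_mem_edgesIn.1 he
      have haS : a ∈ S := this.2.2.resolve_left this.1.ne'
      exact ⟨a, (hN a haS).1 this.1, rfl⟩
    · refine Or.inr ⟨⟨he.1, fun w hw => (he.2 w hw).resolve_left ?_⟩, hve⟩
      rintro rfl; exact hve hw
  have hvS : ∀ e ∈ edgesIn G S, v ∉ e := fun e he h => hv (he.2 v h)
  have hbo : ∀ e, v ∉ e → bends' e = bends e := fun e h => if_neg h
  have hpo : ∀ e, v ∉ e → pt' e = pt e := fun e h => dif_neg h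
  have hbn : ∀ a, bends' s(v, a) = 0 := fun a => if_pos (Sym2.mem_mk_left v a)
  have hp0 : ∀ a, pt' s(v, a) 0 = q := fun a => by simp [pt']
  have hp1 : ∀ a, pt' s(v, a) 1 = pos a := fun a => by
    have h : v ∈ s(v, a) := Sym2.mem_mk_left v a
    have h2 : Sym2.Mem.other h = a := Sym2.congr_right.1 (Sym2.other_spec h)
    have h3 : pt' s(v, a) = fun i => if i = 0 then q else pos (Sym2.Mem.other h) := dif_pos h
    rw [h3, h2]
    simp
  have hcn : ∀ a, polyCurve (bends' s(v, a)) (pt' s(v, a)) = segment ℝ (pos a) q := by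
    intro a
    rw [hbn, polyCurve_zero, hp0, hp1, segment_symm]
  have hin : ∀ a, polyInt (bends' s(v, a)) (pt' s(v, a)) = segment ℝ (pos a) q \ {q, pos a} := by
    intro a
    rw [polyInt, hcn, hbn, hp0, zero_add, hp1]
  -- A new edge meets an old one at most in its own end `a`, so the two never cross.
  have hnew : ∀ a ∈ A, ∀ e ∈ edgesIn G S, ∀ x,
      x ∉ polyInt (bends' s(v, a)) (pt' s(v, a)) ∩ polyInt (bends' e) (pt' e) := by
    rintro a ha e he x ⟨hx, hx'⟩
    rw [hin] at hx
    rw [hbo e (hvS e he), hpo e (hvS e he)] at hx'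
    have := hq.inter_curve a ha e he ⟨hx'.1, hx.1⟩
    exact hx.2 (Or.inr this)
  refine ⟨pos', bends', pt', ⟨?_, ?_, ?_, ?_, ?_⟩, ?_, ?_⟩
  · rintro w (rfl | hw) w' (rfl | hw') h
    · rfl
    · rw [hposv, hpos w' hw'] at h
      exact absurd h.symm (hq.pos_ne w' hw')
    · rw [hposv, hpos w hw] at h
      exact absurd h (hq.pos_ne w hw)
    · rw [hpos w hw, hpos w' hw'] at h
      exact hD.pos_injOn hw hw' h
  · intro e he
    rcases hedge e he with ⟨a, ha, rfl⟩ | ⟨he, hve⟩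
    · rw [hbn, hp0, zero_add, hp1, Sym2.map_mk, hposv, hpos a (hAS a ha)]
    · rw [hbo e hve, hpo e hve, hD.ends e he]
      exact Sym2.map_congr fun w hw => (hpos w (he.2 w hw)).symm
  · intro e he
    rcases hedge e he with ⟨a, ha, rfl⟩ | ⟨he, hve⟩
    · rw [hbn]
      refine isPolyline_zero ?_
      rw [hp0, hp1]
      exact (hq.pos_ne a (hAS a ha)).symm
    · rw [hbo e hve, hpo e hve]
      exact hD.isPolyline e he
  · intro w hw e he hwe
    rcases hedge e he with ⟨a, ha, rfl⟩ | ⟨heS, hve⟩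
    · have hwv : w ≠ v := by rintro rfl; exact hwe (Sym2.mem_mk_left _ _)
      have hwS := hw.resolve_left hwv
      rw [hcn, hpos w hwS]
      exact hq.pos_notMem a ha w hwS (by rintro rfl; exact hwe (Sym2.mem_mk_right _ _))
    · rw [hbo e hve, hpo e hve]
      rcases hw with rfl | hw
      · rw [hposv]; exact hq.notMem_curve e heS
      · rw [hpos w hw]; exact hD.avoids w hw e heS hwe
  · intro e he f hf hef x hx
    rcases hedge e he with ⟨a, ha, rfl⟩ | ⟨he, hve⟩ <;>
      rcases hedge f hf with ⟨c, hc, rfl⟩ | ⟨hf, hvf⟩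
    · rw [hin, hin] at hx
      have := hq.inter a ha c hc (by rintro rfl; exact hef rfl) ⟨hx.1.1, hx.2.1⟩
      exact absurd (Or.inl this) hx.1.2
    · exact absurd hx (hnew a ha f hf x)
    · rw [Set.inter_comm] at hx
      exact absurd hx (hnew c hc e he x)
    · rw [hbo e hve, hpo e hve, hbo f hvf, hpo f hvf] at hx ⊢
      exact hD.rac e he f hf hef x hx
  · refine le_trans ?_ hb
    rw [← Finset.sum_subset (s₁ := (edgesIn G S).toFinite.toFinset)
      (by simpa using edgesIn_mono (Set.subset_insert v S))]
    · exact Finset.sum_le_sum fun e he =>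
        (hbo e (hvS e (by simpa using he))).le
    · intro e he he'
      rw [Set.Finite.mem_toFinset] at he he'
      rcases hedge e he with ⟨a, ha, rfl⟩ | ⟨he, hve⟩
      · exact hbn a
      · exact absurd he he'
  · intro e he
    rcases hedge e he with ⟨a, ha, rfl⟩ | ⟨he, hve⟩
    · rw [hbn]; exact Nat.zero_le _
    · rw [hbo e hve]; exact hβ e he

/-- If sufficiently many vertices outside of the vertex cover have exactly the neighbours in `A`,
at most two, then another one can be added. -/
theorem DrawableOn.insert_twin [Finite V] {G : SimpleGraph V} {C : Finset V}
    (hC : ∀ e ∈ G.edgeSet, ∃ v ∈ e, v ∈ C) {S : Set V} {b : ℕ} {β : Sym2 V → ℕ}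
    (h : DrawableOn G S b β) {A T : Finset V} (hA : A.card ≤ 2) (hAS : ∀ a ∈ A, a ∈ S)
    (hTS : ∀ u ∈ T, u ∈ S) (hT : ∀ u ∈ T, ∀ w ∈ S, G.Adj u w ↔ w ∈ A)
    (hcard : 9 * (C.card + b) + 1 ≤ T.card) {v : V} (hv : v ∉ S)
    (hN : ∀ w ∈ S, G.Adj v w ↔ w ∈ A) : DrawableOn G (insert v S) b β := by
  classical
  obtain ⟨pos, bends, pt, hD, hb, hβ⟩ := h
  obtain ⟨T', hT', hcard', hclean⟩ := hD.exists_clean_subset hC hb (A := A) (T := T)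
    (by omega) (fun a ha u hu => mk_mem_edgesIn.2
      ⟨((hT u hu a (hAS a ha)).2 ha).symm, hAS a ha, hTS u hu⟩) hcard
  obtain ⟨u, hu⟩ := Finset.card_pos.1 hcard'
  obtain ⟨q, hq⟩ := hD.exists_isTwinPosition hAS hA (hTS u (hT' hu)) (hT u (hT' hu))
    fun a ha => hclean a ha u hu
  exact hD.insert_vertex hb hβ hAS hv hN hq

/-- No graph with sufficiently many common neighbours of three vertices has a drawing. -/
theorem not_drawableOn [Finite V] {G : SimpleGraph V} {C : Finset V}
    (hC : ∀ e ∈ G.edgeSet, ∃ v ∈ e, v ∈ C) {S : Set V} {b : ℕ} {β : Sym2 V → ℕ}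
    {A T : Finset V} (hA : A.card = 3) (hAS : ∀ a ∈ A, a ∈ S)
    (hTS : ∀ u ∈ T, u ∈ S) (hT : ∀ u ∈ T, ∀ a ∈ A, G.Adj a u)
    (hcard : 9 * (C.card + b) + 28 ≤ T.card) : ¬ DrawableOn G S b β := by
  classical
  rintro ⟨pos, bends, pt, hD, hb, hβ⟩
  have hE : ∀ a ∈ A, ∀ u ∈ T, s(a, u) ∈ edgesIn G S := fun a ha u hu =>
    mk_mem_edgesIn.2 ⟨hT u hu a ha, hAS a ha, hTS u hu⟩
  obtain ⟨T', hT', hcard', hclean⟩ := hD.exists_clean_subset hC hb hA.le hE hcard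
  obtain ⟨x, y, z, hxy, hxz, hyz, rfl⟩ := Finset.card_eq_three.1 hA
  have := hD.card_le_of_clean hxy hyz hxz (T := T')
    (fun a ha u hu => hE a (by simpa using ha) u (hT' hu))
    (fun a ha u hu => hclean a (by simpa using ha) u hu)
  omega

end Drawings

/-! ### The kernel and its correctness -/

namespace Instance

variable (I : Instance)

open Classical in
/-- The last three neighbours of a vertex; all neighbours if there are at most three. -/
def nbrs (v : Fin I.n) : List (Fin I.n) :=
  ((List.finRange I.n).reverse.filter fun w => I.G.Adj v w).take 3

/-- The number of vertices with the same last neighbours that are kept. -/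
def cap : ℕ := 29 + 10 * I.C.card + 9 * min I.b I.n

/-- The position of a vertex among the vertices with the same last neighbours. -/
def rank (v : Fin I.n) : ℕ := (Finset.univ.filter fun w => w ≤ v ∧ I.nbrs w = I.nbrs v).card

/-- The vertices of the kernel. -/
def Kept (v : Fin I.n) : Prop := v ∈ I.C ∨ I.rank v < I.cap

open Classical in
/-- The vertices of the kernel in increasing order. -/
def keptList : List (Fin I.n) := (List.finRange I.n).filter fun v => I.Kept v

theorem mem_keptList {v : Fin I.n} : v ∈ I.keptList ↔ I.Kept v := by
  simp [keptList]

theorem nodup_keptList : I.keptList.Nodup := (List.nodup_finRange _).filter _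

theorem get_keptList_injective : Function.Injective I.keptList.get :=
  List.nodup_iff_injective_get.1 I.nodup_keptList

theorem range_get_keptList : Set.range I.keptList.get = {v | I.Kept v} := by
  ext v
  rw [Set.mem_range, Set.mem_ofPred_eq, ← mem_keptList, List.mem_iff_get]

theorem map_get_mem {e : Sym2 (Fin I.keptList.length)}
    (he : e ∈ (I.G.comap I.keptList.get).edgeSet) : e.map I.keptList.get ∈ I.G.edgeSet := by
  induction e with | _ a c => simpa using he

open Classical in
/-- The kernel: the subgraph induced by the kept vertices. -/
def kernel : Instance where
  n := I.keptList.length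
  G := I.G.comap I.keptList.get
  b := I.b
  β e := I.β ⟨e.1.map I.keptList.get, I.map_get_mem e.2⟩
  C := Finset.univ.filter fun i => I.keptList.get i ∈ I.C
  cover := by
    intro u v h
    have := I.cover (show I.G.Adj _ _ from h)
    simpa using this

theorem cover' : ∀ e ∈ I.G.edgeSet, ∃ v ∈ e, v ∈ I.C := by
  intro e he
  induction e with | _ a c =>
  rcases I.cover (show I.G.Adj a c from he) with h | h
  · exact ⟨a, Sym2.mem_mk_left _ _, h⟩
  · exact ⟨c, Sym2.mem_mk_right _ _, h⟩

theorem mem_C_of_adj {u w : Fin I.n} (hu : u ∉ I.C) (h : I.G.Adj u w) : w ∈ I.C := by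
  obtain ⟨v, hv, hC⟩ := I.cover' s(u, w) h
  rcases Sym2.mem_iff.1 hv with rfl | rfl
  · exact absurd hC hu
  · exact hC

theorem length_nbrs_le (v : Fin I.n) : (I.nbrs v).length ≤ 3 := by
  simp [nbrs]

theorem nodup_nbrs (v : Fin I.n) : (I.nbrs v).Nodup :=
  (((List.nodup_reverse.2 (List.nodup_finRange _)).filter _).sublist (List.take_sublist _ _))

theorem adj_of_mem_nbrs {v w : Fin I.n} (h : w ∈ I.nbrs v) : I.G.Adj v w := by
  have := List.mem_of_mem_take h
  simpa using this

/-- A list of length less than three has not been truncated. -/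
theorem mem_nbrs_iff {v w : Fin I.n} (h : (I.nbrs v).length ≤ 2) :
    w ∈ I.nbrs v ↔ I.G.Adj v w := by
  refine ⟨I.adj_of_mem_nbrs, fun hw => ?_⟩
  rw [nbrs, List.length_take] at h
  rw [nbrs, List.take_of_length_le (by omega)]
  simpa using hw

theorem rank_lt_rank {u v : Fin I.n} (h : I.nbrs u = I.nbrs v) (huv : u < v) :
    I.rank u < I.rank v := by
  refine Finset.card_lt_card ⟨fun w hw => ?_, fun hsub => ?_⟩
  · simp only [Finset.mem_filter, Finset.mem_univ, true_and] at hw ⊢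
    exact ⟨hw.1.trans huv.le, hw.2.trans h⟩
  · have : v ∈ Finset.univ.filter fun w => w ≤ u ∧ I.nbrs w = I.nbrs u := hsub (by simp)
    simp only [Finset.mem_filter, Finset.mem_univ, true_and] at this
    exact absurd huv (not_lt.2 this.1)

open Classical in
/-- A vertex is dropped only if many vertices with the same last neighbours are kept. -/
theorem card_kept_class {v : Fin I.n} (hv : ¬ I.Kept v) :
    9 * (I.C.card + I.b) + 28 ≤
      (Finset.univ.filter fun u => I.Kept u ∧ u ∉ I.C ∧ I.nbrs u = I.nbrs v).card := by
  set K := Finset.univ.filter fun u => I.Kept u ∧ u ∉ I.C ∧ I.nbrs u = I.nbrs v with hK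
  have hne : (Finset.univ.filter fun w => I.nbrs w = I.nbrs v ∧ I.cap ≤ I.rank w).Nonempty := by
    refine ⟨v, ?_⟩
    simp only [Kept, not_or, not_lt] at hv
    simpa using hv.2
  -- Take the first vertex of the class whose rank reaches `cap`; all earlier ones in the class are
  -- kept.
  obtain ⟨w₀, hw₀, hmin⟩ := Finset.exists_min_image _ id hne
  simp only [Finset.mem_filter, Finset.mem_univ, true_and, id] at hw₀ hmin
  have hsub : (Finset.univ.filter fun w => w ≤ w₀ ∧ I.nbrs w = I.nbrs w₀) ⊆
      insert w₀ (I.C ∪ K) := by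
    intro w hw
    simp only [Finset.mem_filter, Finset.mem_univ, true_and] at hw
    rcases hw.1.eq_or_lt with rfl | hlt
    · exact Finset.mem_insert_self _ _
    · refine Finset.mem_insert_of_mem (Finset.mem_union.2 ?_)
      by_cases hC : w ∈ I.C
      · exact Or.inl hC
      · right
        have : I.rank w < I.cap := by
          by_contra hcon
          exact absurd hlt (not_lt.2 (hmin w ⟨hw.2.trans hw₀.1, not_lt.1 hcon⟩))
        simp only [hK, Finset.mem_filter, Finset.mem_univ, true_and]
        exact ⟨Or.inr this, hC, hw.2.trans hw₀.1⟩
  -- Ranks start at one and also count cover vertices. Discounting `w₀` and at most `k` of those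
  -- leaves `cap - 1 - k = 28 + 9 * k + 9 * min b n` vertices.
  have h1 : I.rank w₀ ≤ I.C.card + K.card + 1 :=
    (Finset.card_le_card hsub).trans ((Finset.card_insert_le _ _).trans
      (Nat.add_le_add_right (Finset.card_union_le _ _) 1))
  -- For `b > n` the lower bound would exceed the number of vertices, so nothing is dropped then and
  -- truncating `b` at `n` does no harm.
  have h2 : K.card ≤ I.n := by simpa using Finset.card_le_univ K
  have h3 := hw₀.2
  rw [cap] at h3
  omega

/-- The labels as a function on all unordered pairs. -/
def labelFun (e : Sym2 (Fin I.n)) : ℕ :=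
  open Classical in if h : e ∈ I.G.edgeSet then I.β ⟨e, h⟩ else 0

theorem isYes_iff : I.IsYes ↔ DrawableOn I.G Set.univ I.b I.labelFun := by
  rw [← Set.range_id]
  refine hasBendRestrictedRACDrawing_iff Function.injective_id (fun _ _ => Iff.rfl) ?_
  rintro ⟨e, he⟩
  rw [Sym2.map_id, id, labelFun, dif_pos he]

theorem kernel_isYes_iff :
    I.kernel.IsYes ↔ DrawableOn I.G {v | I.Kept v} I.b I.labelFun := by
  rw [← range_get_keptList]
  refine hasBendRestrictedRACDrawing_iff I.get_keptList_injective (fun _ _ => Iff.rfl) ?_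
  rintro ⟨e, he⟩
  simp only [labelFun, dif_pos (I.map_get_mem he), kernel]

/-- One direction restricts a drawing. For the other, the dropped vertices are put back one at a
time. If three neighbours are listed, the kept vertices of the class already contradict the
existence of a drawing; otherwise the list is the full neighbourhood, and `DrawableOn.insert_twin`
applies. -/
theorem kernel_correct : I.kernel.IsYes ↔ I.IsYes := by
  classical
  rw [kernel_isYes_iff, isYes_iff]
  refine ⟨fun h => ?_, fun h => h.mono (Set.subset_univ _)⟩
  suffices key : ∀ D : Finset (Fin I.n), (∀ v ∈ D, ¬ I.Kept v) →
      DrawableOn I.G ({v | I.Kept v} ∪ D) I.b I.labelFun by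
    have := key (Finset.univ.filter fun v => ¬ I.Kept v) (by simp)
    convert this
    ext v
    simp [em]
  intro D
  induction D using Finset.induction_on with
  | empty => intro _; simpa using h
  | insert v D hvD ih =>
    intro hD
    have hS := ih fun w hw => hD w (Finset.mem_insert_of_mem hw)
    have hv := hD v (Finset.mem_insert_self _ _)
    have hvC : v ∉ I.C := fun hC => hv (Or.inl hC)
    have hcard := I.card_kept_class hv
    set K := Finset.univ.filter fun u => I.Kept u ∧ u ∉ I.C ∧ I.nbrs u = I.nbrs v with hK
    have hKm : ∀ u ∈ K, I.Kept u ∧ u ∉ I.C ∧ I.nbrs u = I.nbrs v := fun u hu => by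
      simpa [hK] using hu
    have hAC : ∀ a ∈ (I.nbrs v).toFinset, a ∈ {v | I.Kept v} ∪ (D : Set (Fin I.n)) :=
      fun a ha => Or.inl (Or.inl (I.mem_C_of_adj hvC (I.adj_of_mem_nbrs (List.mem_toFinset.1 ha))))
    have hlen := I.length_nbrs_le v
    have hAcard : (I.nbrs v).toFinset.card = (I.nbrs v).length :=
      List.toFinset_card_of_nodup (I.nodup_nbrs v)
    rcases hlen.eq_or_lt with h3 | h3
    · refine absurd hS (not_drawableOn I.cover' (A := (I.nbrs v).toFinset) (T := K)
        (hAcard.trans h3) hAC (fun u hu => Or.inl (hKm u hu).1) ?_ hcard)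
      intro u hu a ha
      rw [List.mem_toFinset, ← (hKm u hu).2.2] at ha
      exact (I.adj_of_mem_nbrs ha).symm
    · rw [Finset.coe_insert, Set.union_insert]
      refine hS.insert_twin I.cover' (A := (I.nbrs v).toFinset) (T := K) (by omega) hAC
        (fun u hu => Or.inl (hKm u hu).1) ?_ (by omega) ?_ ?_
      · intro u hu w _
        rw [List.mem_toFinset, ← (hKm u hu).2.2, I.mem_nbrs_iff]
        rw [(hKm u hu).2.2]; omega
      · rintro (h | h)
        · exact hv h
        · exact hvD h
      · intro w _
        rw [List.mem_toFinset, I.mem_nbrs_iff (by omega)]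

/-! ### The size of the kernel -/

theorem mem_C_kernel {i : Fin I.keptList.length} :
    i ∈ I.kernel.C ↔ I.keptList.get i ∈ I.C := by
  unfold kernel
  simp

theorem card_C_kernel_le : I.kernel.C.card ≤ I.C.card := by
  classical
  refine Finset.card_le_card_of_injOn I.keptList.get (fun i hi => ?_)
    I.get_keptList_injective.injOn
  exact I.mem_C_kernel.1 hi

/-- All neighbours of a vertex outside of the cover lie in the cover. Such a vertex is determined by
its list, read as three optional cover vertices, and its rank, since the rank is strictly increasing
within a class. -/
theorem kernel_n_le : I.kernel.n ≤ I.k + (I.k + 1) ^ 3 * I.cap := by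
  classical
  have h1 : I.kernel.n = (Finset.univ.filter fun v => I.Kept v).card := by
    refine (I.keptList.toFinset_card_of_nodup I.nodup_keptList).symm.trans ?_
    congr 1
    ext v; simp [mem_keptList]
  have h2 : (Finset.univ.filter fun v => I.Kept v) ⊆
      I.C ∪ Finset.univ.filter fun v => v ∉ I.C ∧ I.rank v < I.cap := by
    intro v hv
    have hv' : v ∈ I.C ∨ I.rank v < I.cap := (Finset.mem_filter.1 hv).2
    simp only [Finset.mem_filter, Finset.mem_univ, true_and, Finset.mem_union]
    tauto
  have h3 : (Finset.univ.filter fun v => v ∉ I.C ∧ I.rank v < I.cap).card ≤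
      (I.C.insertNone ×ˢ I.C.insertNone ×ˢ I.C.insertNone ×ˢ Finset.range I.cap).card := by
    refine Finset.card_le_card_of_injOn
      (fun v => ((I.nbrs v)[0]?, (I.nbrs v)[1]?, (I.nbrs v)[2]?, I.rank v)) ?_ ?_
    · intro v hv
      simp only [Finset.coe_filter, Finset.mem_univ, true_and, Set.mem_ofPred_eq] at hv
      have : ∀ i : ℕ, (I.nbrs v)[i]? ∈ I.C.insertNone := by
        intro i
        rw [Finset.mem_insertNone]
        intro a ha
        exact I.mem_C_of_adj hv.1 (I.adj_of_mem_nbrs (List.mem_of_getElem? ha))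
      simp [this, hv.2]
    · intro u hu v hv huv
      simp only [Prod.mk.injEq] at huv
      have hn : I.nbrs u = I.nbrs v := by
        refine List.ext_getElem? fun i => ?_
        match i with
        | 0 => exact huv.1
        | 1 => exact huv.2.1
        | 2 => exact huv.2.2.1
        | j + 3 =>
          rw [List.getElem?_eq_none ((I.length_nbrs_le u).trans (by omega)),
            List.getElem?_eq_none ((I.length_nbrs_le v).trans (by omega))]
      rcases lt_trichotomy u v with h | h | h
      · exact absurd huv.2.2.2 (I.rank_lt_rank hn h).ne
      · exact h
      · exact absurd huv.2.2.2 (I.rank_lt_rank hn.symm h).ne'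
  rw [h1]
  refine (Finset.card_le_card h2).trans ((Finset.card_union_le _ _).trans ?_)
  refine Nat.add_le_add_left (h3.trans ?_) _
  simp only [Finset.card_product, Finset.card_insertNone, Finset.card_range, k]
  apply le_of_eq
  ring

theorem cap_le : I.cap ≤ 29 + 10 * I.k + 9 * I.b := by
  rw [cap, k]; omega

theorem size_le : I.size ≤ I.n * (I.k + 1) := by
  classical
  have h : I.G.edgeSet ⊆ ((I.C ×ˢ (Finset.univ : Finset (Fin I.n))).image
      fun p => s(p.1, p.2) : Finset (Sym2 (Fin I.n))) := by
    intro e he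
    obtain ⟨v, hv, hC⟩ := I.cover' e he
    obtain ⟨w, rfl⟩ := Sym2.mem_iff_exists.1 hv
    simp only [Finset.coe_image, Set.mem_image, Finset.mem_coe, Finset.mem_product]
    exact ⟨(v, w), ⟨hC, Finset.mem_univ _⟩, rfl⟩
  have h2 := (Set.ncard_le_ncard h (Finset.finite_toSet _)).trans
    ((Set.ncard_coe_finset _).le.trans Finset.card_image_le)
  rw [Finset.card_product, Finset.card_univ, Fintype.card_fin] at h2
  rw [size, k]
  nlinarith

/-- The power is at most `(k + 1) ⋯ (k + 5) = 5! * choose (k + 5) 5`, and the binomial coefficient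
is at most `2 ^ (k + 5)`; finally `3840 = 120 * 32`. -/
theorem pow_five_le (k : ℕ) : (k + 1) ^ 5 ≤ 3840 * 2 ^ k := by
  have h1 : (k + 1) ^ 5 ≤ (k + 1).ascFactorial 5 :=
    (Nat.pow_succ_le_ascFactorial k.succ 5).trans' (by simp)
  have h2 : (k + 1).ascFactorial 5 = Nat.factorial 5 * (k + 5).choose 5 :=
    Nat.ascFactorial_eq_factorial_mul_choose k 5
  have h3 : (k + 5).choose 5 ≤ 2 ^ (k + 5) := Nat.choose_le_two_pow _ _
  rw [h2] at h1
  refine h1.trans ((Nat.mul_le_mul_left _ h3).trans (le_of_eq ?_))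
  rw [pow_add]; norm_num [Nat.factorial]; ring

/-- The fifth power arises from three listed neighbours, the factor `k` in `cap` and the number of
edges per vertex. The constant is `115200 = 30 * 3840`. -/
theorem kernel_size_le : I.kernel.size ≤ 115200 * ((I.b + 1) * 2 ^ I.k) := by
  have hk : I.kernel.k ≤ I.k := I.card_C_kernel_le
  calc I.kernel.size ≤ I.kernel.n * (I.kernel.k + 1) := I.kernel.size_le
    _ ≤ (I.k + (I.k + 1) ^ 3 * (29 + 10 * I.k + 9 * I.b)) * (I.k + 1) :=
      Nat.mul_le_mul (I.kernel_n_le.trans (Nat.add_le_add_left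
        (Nat.mul_le_mul_left _ I.cap_le) _)) (Nat.add_le_add_right hk 1)
    _ ≤ ((I.k + 1) ^ 4 * (I.b + 1) + (I.k + 1) ^ 3 * (29 * ((I.k + 1) * (I.b + 1)))) *
        (I.k + 1) := by
      refine Nat.mul_le_mul_right _ (Nat.add_le_add ?_ (Nat.mul_le_mul_left _ ?_))
      · calc I.k ≤ (I.k + 1) ^ 1 := by simp
          _ ≤ (I.k + 1) ^ 4 := Nat.pow_le_pow_right (Nat.succ_pos _) (by norm_num)
          _ ≤ _ := Nat.le_mul_of_pos_right _ (Nat.succ_pos _)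
      · nlinarith [Nat.zero_le (I.k * I.b)]
    _ = (I.k + 1) ^ 5 * (30 * (I.b + 1)) := by ring
    _ ≤ 3840 * 2 ^ I.k * (30 * (I.b + 1)) := Nat.mul_le_mul_right _ (pow_five_le _)
    _ = _ := by ring

theorem length_encodePosNum_le (m : PosNum) : (Computability.encodePosNum m).length ≤ (m : ℕ) := by
  induction m with
  | one => simp [Computability.encodePosNum]
  | bit0 m ih =>
    have := PosNum.cast_pos (α := ℕ) m
    simp only [Computability.encodePosNum, List.length_cons, PosNum.cast_bit0]
    omega
  | bit1 m ih =>
    have := PosNum.cast_pos (α := ℕ) m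
    simp only [Computability.encodePosNum, List.length_cons, PosNum.cast_bit1]
    omega

theorem length_encodeNat_le (m : ℕ) : (Computability.encodeNat m).length ≤ m := by
  have h : ((m : Num) : ℕ) = m := Num.to_of_nat m
  rw [Computability.encodeNat]
  generalize (m : Num) = x at h ⊢
  subst h
  cases x with
  | zero => simp [Computability.encodeNum]
  | pos p => exact length_encodePosNum_le p

theorem length_encode : I.encode.length =
    (Computability.encodeNat I.b).length + 1 + I.n * (I.n + 2) := by
  simp only [encode, List.length_append, List.length_map, List.length_cons, List.length_flatMap,
    encodeRow, List.length_finRange, List.length_nil, List.map_const', List.sum_replicate,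
    smul_eq_mul]
  ring

/-- The bound on the number of vertices of the kernel in terms of the parameter. -/
def vertexBound (p : ℕ) : ℕ := p + (p + 1) * (p + 1) * (p + 1) * (29 + 10 * p + 9 * p)

/-- The bound on the encoding length of the kernel in terms of the parameter. -/
def lengthBound (p : ℕ) : ℕ := p + 1 + vertexBound p * (vertexBound p + 2)

theorem computable_lengthBound : Computable lengthBound := by
  apply Primrec.to_comp
  have hadd {f g : ℕ → ℕ} (hf : Primrec f) (hg : Primrec g) : Primrec fun p => f p + g p :=
    Primrec.nat_add.comp hf hg
  have hmul {f g : ℕ → ℕ} (hf : Primrec f) (hg : Primrec g) : Primrec fun p => f p * g p :=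
    Primrec.nat_mul.comp hf hg
  have hc (c : ℕ) : Primrec fun _ : ℕ => c := Primrec.const c
  have hi : Primrec fun p : ℕ => p := Primrec.id
  have h1 := hadd hi (hc 1)
  have hv : Primrec vertexBound := hadd hi (hmul (hmul (hmul h1 h1) h1)
    (hadd (hadd (hc 29) (hmul (hc 10) hi)) (hmul (hc 9) hi)))
  exact hadd h1 (hmul hv (hadd hv (hc 2)))

theorem kernel_n_le_vertexBound : I.kernel.n ≤ vertexBound I.param := by
  refine I.kernel_n_le.trans ?_
  have h1 : I.k ≤ I.param := Nat.le_add_left _ _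
  have h2 : I.cap ≤ 29 + 10 * I.param + 9 * I.param := by
    have := I.cap_le
    have : I.b ≤ I.param := Nat.le_add_right _ _
    omega
  rw [vertexBound]
  refine Nat.add_le_add h1 (Nat.mul_le_mul ?_ h2)
  rw [pow_succ, pow_two]
  gcongr

theorem kernel_param_le : I.kernel.param ≤ lengthBound I.param := by
  have h1 : I.kernel.k ≤ I.k := I.card_C_kernel_le
  have h2 : I.kernel.param ≤ I.param := Nat.add_le_add_left h1 _
  rw [lengthBound]
  exact h2.trans (by omega)

theorem length_encode_kernel_le : I.kernel.encode.length ≤ lengthBound I.param := by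
  rw [length_encode, lengthBound]
  have h1 : (Computability.encodeNat I.kernel.b).length ≤ I.param :=
    (length_encodeNat_le _).trans (Nat.le_add_right _ _)
  have h2 := I.kernel_n_le_vertexBound
  gcongr

end Instance

/-! ### A machine that computes the kernel -/

open Turing

namespace Machine

/-- The stacks of the machine. -/
inductive Stack
  | inp | out | bin | dig | tok | used | prev | row | scanned | tmp | flag | rowFlag
  deriving DecidableEq

instance : Fintype Stack where
  elems := {.inp, .out, .bin, .dig, .tok, .used, .prev, .row, .scanned, .tmp, .flag, .rowFlag}
  complete k := by cases k <;> decide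

/-- The labels of the machine. -/
inductive Label
  | bits | rest | pre | dec | turn | read | scan | restRow | restPrev | restTok | clearRow
  | unPrev | unFlag | emit | restFlag | clearTok | clearDig | clearFlag | fin
  deriving DecidableEq

instance : Fintype Label where
  elems := {.bits, .rest, .pre, .dec, .turn, .read, .scan, .restRow, .restPrev, .restTok,
    .clearRow, .unPrev, .unFlag, .emit, .restFlag, .clearTok, .clearDig, .clearFlag, .fin}
  complete l := by cases l <;> decide

/-- The memory of the machine: two letters, a counter and two flags. -/
structure Mem where
  /-- the letter read last -/
  cur : Option Letter
  /-- a second letter -/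
  aux : Option Letter
  /-- the number of common neighbours seen so far -/
  cnt : Fin 4
  /-- whether the compared vertices agree so far; the borrow of a subtraction -/
  eq : Bool
  /-- whether the current vertex is kept -/
  keep : Bool

instance : Finite Letter := by
  refine Finite.of_injective (β := Option (Bool ⊕ Option (Fin 4)))
    (fun | .bit x => some (.inl x) | .entry a => some (.inr a) | .sep => none) ?_
  rintro (_ | _ | _) (_ | _ | _) h <;> simp_all

instance : Finite Mem := by
  refine Finite.of_injective (β := Option Letter × Option Letter × Fin 4 × Bool × Bool)
    (fun m => (m.cur, m.aux, m.cnt, m.eq, m.keep)) ?_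
  rintro ⟨_, _, _, _, _⟩ ⟨_, _, _, _, _⟩ h
  simpa using h

/-- Whether the letter is a bit. -/
@[simp] def isBit : Option Letter → Bool
  | some (.bit _) => true
  | some (.entry _) => false
  | some .sep => false
  | none => false

/-- Whether the letter is the separator. -/
@[simp] def isSep : Option Letter → Bool
  | some (.bit _) => false
  | some (.entry _) => false
  | some .sep => true
  | none => false

/-- The value of a bit. -/
@[simp] def bitVal : Option Letter → Bool
  | some (.bit x) => x
  | some (.entry _) => false
  | some .sep => false
  | none => false

/-- Whether the letter is the matrix entry of an edge. -/
@[simp] def isEdge : Option Letter → Bool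
  | some (.bit _) => false
  | some (.entry a) => a.isSome
  | some .sep => false
  | none => false

/-- One step of the comparison of the rows of two vertices, until three neighbours were seen. -/
def cmpStep (s : Fin 4 × Bool) (x y : Bool) : Fin 4 × Bool :=
  if s.1 = 3 then s else (if y then s.1 + 1 else s.1, s.2 && (x == y))

/-- Statements of the machine. -/
abbrev Code : Type := TM2.Stmt (fun _ : Stack => Letter) Label Mem

/-- Push `n` copies of a letter. -/
def pushN (k : Stack) (a : Letter) (n : ℕ) (q : Code) : Code :=
  (TM2.Stmt.push k fun _ => a)^[n] q

/-- Read the top of a stack and branch on whether the stack was empty. -/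
def popOr (k : Stack) (q₁ q₂ : Code) : Code :=
  .pop k (fun m a => { m with cur := a }) (.branch (fun m => m.cur.isNone) q₁ q₂)

/-- Push the letter read last. -/
def pushCur (k : Stack) (q : Code) : Code :=
  .push k (fun m => m.cur.getD .sep) q

/-- Read a second letter. -/
def popAux (k : Stack) (q : Code) : Code :=
  .pop k (fun m a => { m with aux := a }) q

/-- Jump to a label. -/
def jump (l : Label) : Code := .goto fun _ => l

/-- The initial memory. -/
def initMem : Mem := ⟨none, none, 0, false, false⟩

/-- The program. -/
def prog : Label → Code
  -- The first phase builds `cap` in unary on `tok`. The digits of `b` are copied to `out` and, by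
  -- way of `bin`, to `dig`.
  | .bits => popOr .inp .halt <| .branch (fun m => isBit m.cur)
      (pushCur .out <| pushCur .bin <| jump .bits)
      (pushCur .out <| pushN .tok .sep 29 <| jump .rest)
  | .rest => popOr .bin (jump .pre) <|
      .push .dig (fun m => .bit (bitVal m.cur && !m.eq)) <| jump .rest
  -- A cover bit is worth ten tokens. The end of a row decrements the number in `dig` and is worth
  -- nine unless that number was zero, which makes nine times `min b n`.
  | .pre => popOr .inp (jump .turn) <| pushCur .scanned <|
      .branch (fun m => isSep m.cur) (.load (fun m => { m with eq := true }) <| jump .dec) <|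
      .branch (fun m => bitVal m.cur) (pushN .tok .sep 10 <| jump .pre) (jump .pre)
  -- Here `eq` is the borrow. If it survives all digits the number was zero, and `rest` then writes
  -- zeros.
  | .dec => popOr .dig (.branch (fun m => m.eq) (jump .rest) (pushN .tok .sep 9 <| jump .rest)) <|
      .push .bin (fun m => .bit (bitVal m.cur ^^ m.eq)) <|
      .load (fun m => { m with eq := m.eq && !bitVal m.cur }) <| jump .dec
  | .turn => popOr .scanned (jump .read) <| pushCur .inp <| jump .turn
  -- The second phase decides which vertices are kept. The current row is pushed, reversed, both on
  -- `prev` and on `row`.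
  | .read => popOr .inp (jump .unPrev) <| pushCur .prev <|
      .branch (fun m => isSep m.cur) (jump .scan) <|
      .branch (fun m => isBit m.cur)
        (.load (fun m => { m with keep := bitVal m.cur }) <| jump .read)
        (pushCur .row <| jump .read)
  -- All rows up to and including the current one are compared with it, and each match moves a token
  -- to `used`. A token left at the end means `rank < cap`.
  | .scan => popOr .prev
      (.peek .tok (fun m a => { m with keep := m.keep || a.isSome }) <| jump .restPrev) <|
      pushCur .scanned <|
      .branch (fun m => isSep m.cur)
        (.load (fun m => { m with cnt := 0, eq := true }) <| jump .scan) <|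
      .branch (fun m => isBit m.cur)
        (.branch (fun m => m.eq) (popOr .tok (jump .restRow) <| pushCur .used <| jump .restRow)
          (jump .restRow))
        (popAux .row <| .push .tmp (fun m => m.aux.getD .sep) <|
          .load (fun m => { m with
            cnt := (cmpStep (m.cnt, m.eq) (isEdge m.cur) (isEdge m.aux)).1
            eq := (cmpStep (m.cnt, m.eq) (isEdge m.cur) (isEdge m.aux)).2 }) <| jump .scan)
  | .restRow => popOr .tmp (jump .scan) <| pushCur .row <| jump .restRow
  | .restPrev => popOr .scanned (jump .restTok) <| pushCur .prev <| jump .restPrev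
  | .restTok => popOr .used (jump .clearRow) <| pushCur .tok <| jump .restTok
  | .clearRow => popOr .row (.push .flag (fun m => .bit m.keep) <| jump .read) <| jump .clearRow
  | .unPrev => popOr .prev (jump .unFlag) <| pushCur .inp <| jump .unPrev
  -- The third phase needs the flags twice: `rowFlag` is consumed once per row, while `row` selects
  -- the columns and is restored after each row.
  | .unFlag => popOr .flag (jump .emit) <| pushCur .rowFlag <| pushCur .row <| jump .unFlag
  | .emit => popOr .inp (jump .clearTok) <|
      .branch (fun m => isBit m.cur)
        (popAux .rowFlag <| .load (fun m => { m with keep := bitVal m.aux }) <|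
          .branch (fun m => m.keep) (pushCur .out <| jump .emit) (jump .emit)) <|
      .branch (fun m => isSep m.cur)
        (.branch (fun m => m.keep) (pushCur .out <| jump .restFlag) (jump .restFlag))
        (popAux .row <| .push .tmp (fun m => m.aux.getD .sep) <|
          .branch (fun m => m.keep && bitVal m.aux) (pushCur .out <| jump .emit) (jump .emit))
  | .restFlag => popOr .tmp (jump .emit) <| pushCur .row <| jump .restFlag
  | .clearTok => popOr .tok (jump .clearDig) <| jump .clearTok
  | .clearDig => popOr .dig (jump .clearFlag) <| jump .clearDig
  | .clearFlag => popOr .row (jump .fin) <| jump .clearFlag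
  -- The stack `inp` serves for input and output. A halting configuration requires the initial
  -- memory and all other stacks empty.
  | .fin => popOr .out (.load (fun _ => initMem) .halt) <| pushCur .inp <| jump .fin

/-- The contents of the stacks. -/
structure Regs where
  (inp out bin dig tok used prev row scanned tmp flag rowFlag : List Letter)

/-- The contents of the stacks as a function. -/
@[simp] def Regs.stk (r : Regs) : Stack → List Letter
  | .inp => r.inp
  | .out => r.out
  | .bin => r.bin
  | .dig => r.dig
  | .tok => r.tok
  | .used => r.used
  | .prev => r.prev
  | .row => r.row
  | .scanned => r.scanned
  | .tmp => r.tmp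
  | .flag => r.flag
  | .rowFlag => r.rowFlag

section update

variable (r : Regs) (x : List Letter)

@[simp] theorem update_inp : Function.update r.stk .inp x = Regs.stk { r with inp := x } := by
  funext k; cases k <;> rfl
@[simp] theorem update_out : Function.update r.stk .out x = Regs.stk { r with out := x } := by
  funext k; cases k <;> rfl
@[simp] theorem update_bin : Function.update r.stk .bin x = Regs.stk { r with bin := x } := by
  funext k; cases k <;> rfl
@[simp] theorem update_dig : Function.update r.stk .dig x = Regs.stk { r with dig := x } := by
  funext k; cases k <;> rfl
@[simp] theorem update_tok : Function.update r.stk .tok x = Regs.stk { r with tok := x } := by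
  funext k; cases k <;> rfl
@[simp] theorem update_used : Function.update r.stk .used x = Regs.stk { r with used := x } := by
  funext k; cases k <;> rfl
@[simp] theorem update_prev : Function.update r.stk .prev x = Regs.stk { r with prev := x } := by
  funext k; cases k <;> rfl
@[simp] theorem update_row : Function.update r.stk .row x = Regs.stk { r with row := x } := by
  funext k; cases k <;> rfl
@[simp] theorem update_scanned :
    Function.update r.stk .scanned x = Regs.stk { r with scanned := x } := by
  funext k; cases k <;> rfl
@[simp] theorem update_tmp : Function.update r.stk .tmp x = Regs.stk { r with tmp := x } := by
  funext k; cases k <;> rfl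
@[simp] theorem update_flag : Function.update r.stk .flag x = Regs.stk { r with flag := x } := by
  funext k; cases k <;> rfl
@[simp] theorem update_rowFlag :
    Function.update r.stk .rowFlag x = Regs.stk { r with rowFlag := x } := by
  funext k; cases k <;> rfl

end update

/-- Configurations of the machine. -/
abbrev Config : Type := TM2.Cfg (fun _ : Stack => Letter) Label Mem

/-- The configuration at the beginning of a label. -/
abbrev cfg (l : Label) (m : Mem) (r : Regs) : Config := ⟨some l, m, r.stk⟩

/-- The machine gets from `c` to `c'` in at most `n` steps. -/
def Within (n : ℕ) (c c' : Config) : Prop :=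
  ∃ t ≤ n, (flip bind (TM2.step prog))^[t] (some c) = some c'

theorem Within.refl (c : Config) : Within 0 c c := ⟨0, le_rfl, rfl⟩

theorem Within.mono {n n' : ℕ} {c c' : Config} (h : Within n c c') (hn : n ≤ n') :
    Within n' c c' := by
  obtain ⟨t, ht, h⟩ := h
  exact ⟨t, ht.trans hn, h⟩

theorem Within.trans {n n' : ℕ} {c c' c'' : Config} (h : Within n c c') (h' : Within n' c' c'') :
    Within (n + n') c c'' := by
  obtain ⟨t, ht, h⟩ := h
  obtain ⟨t', ht', h'⟩ := h'
  refine ⟨t' + t, by omega, ?_⟩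
  rw [Function.iterate_add_apply, h, h']

theorem flip_bind_step (M : Label → Code) (l : Label) (m : Mem) (S : Stack → List Letter) :
    flip bind (TM2.step M) (some ⟨some l, m, S⟩) = some (TM2.stepAux (M l) m S) := rfl

/-- One step of the machine executes the entire statement of a label. -/
theorem Within.head {n : ℕ} {l : Label} {m : Mem} {r : Regs} {c' : Config}
    (h : Within n (TM2.stepAux (prog l) m r.stk) c') : Within (n + 1) (cfg l m r) c' := by
  obtain ⟨t, ht, h⟩ := h
  refine ⟨t + 1, by omega, ?_⟩
  rw [Function.iterate_succ_apply, flip_bind_step, h]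

@[simp] theorem stepAux_pushN (k : Stack) (a : Letter) (n : ℕ) (q : Code) (m : Mem)
    (S : Stack → List Letter) : TM2.stepAux (pushN k a n q) m S =
      TM2.stepAux q m (Function.update S k (List.replicate n a ++ S k)) := by
  induction n generalizing S with
  | zero => simp [pushN]
  | succ n ih =>
    rw [pushN, Function.iterate_succ_apply']
    simp only [TM2.stepAux]
    rw [← pushN, ih]
    congr 1
    simp [List.replicate_succ']

@[simp] theorem stepAux_popOr (k : Stack) (q₁ q₂ : Code) (m : Mem) (S : Stack → List Letter) :
    TM2.stepAux (popOr k q₁ q₂) m S =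
      bif (S k).head?.isNone then TM2.stepAux q₁ { m with cur := (S k).head? }
        (Function.update S k (S k).tail)
      else TM2.stepAux q₂ { m with cur := (S k).head? } (Function.update S k (S k).tail) := (id rfl)

@[simp] theorem stepAux_pushCur (k : Stack) (q : Code) (m : Mem) (S : Stack → List Letter) :
    TM2.stepAux (pushCur k q) m S =
      TM2.stepAux q m (Function.update S k (m.cur.getD .sep :: S k)) := (id rfl)

@[simp] theorem stepAux_popAux (k : Stack) (q : Code) (m : Mem) (S : Stack → List Letter) :
    TM2.stepAux (popAux k q) m S =
      TM2.stepAux q { m with aux := (S k).head? } (Function.update S k (S k).tail) := (id rfl)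

@[simp] theorem stepAux_jump (l : Label) (m : Mem) (S : Stack → List Letter) :
    TM2.stepAux (jump l) m S = ⟨some l, m, S⟩ := (id rfl)

/-! ### The loops of the program -/

variable (cu au : Option Letter) (cn : Fin 4) (eq keep : Bool)
  (i z b d u t p v q w f g : List Letter)

theorem turn_loop : Within (q.length + 1) (cfg .turn ⟨cu, au, cn, eq, keep⟩
    ⟨i, z, b, d, u, t, p, v, q, w, f, g⟩) (cfg .read ⟨none, au, cn, eq, keep⟩
    ⟨q.reverse ++ i, z, b, d, u, t, p, v, [], w, f, g⟩) := by
  induction q generalizing cu i with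
  | nil => exact .head (by simpa [prog] using Within.refl _)
  | cons a q ih => exact .head (by simpa [prog] using ih (some a) (a :: i))

theorem bits_loop (bs : List Bool) : Within (bs.length + 1) (cfg .bits ⟨cu, au, cn, eq, keep⟩
    ⟨bs.map .bit ++ .sep :: i, z, b, d, u, t, p, v, q, w, f, g⟩) (cfg .rest
    ⟨some .sep, au, cn, eq, keep⟩
    ⟨i, .sep :: ((bs.map .bit).reverse ++ z), (bs.map .bit).reverse ++ b, d,
      List.replicate 29 .sep ++ u, t, p, v, q, w, f, g⟩) := by
  induction bs generalizing cu z b with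
  | nil => exact .head (by simpa [prog, -List.reduceReplicate] using Within.refl _)
  | cons a bs ih =>
    exact .head (by simpa [prog] using ih (some (.bit a)) (.bit a :: z) (.bit a :: b))

theorem rest_loop (bs : List Bool) : Within (bs.length + 1) (cfg .rest ⟨cu, au, cn, eq, keep⟩
    ⟨i, z, bs.map .bit, d, u, t, p, v, q, w, f, g⟩) (cfg .pre ⟨none, au, cn, eq, keep⟩
    ⟨i, z, [], ((bs.map fun x => x && !eq).map .bit).reverse ++ d, u, t, p, v, q, w, f, g⟩) := by
  induction bs generalizing cu d with
  | nil => exact .head (by simpa [prog] using Within.refl _)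
  | cons a bs ih =>
    exact .head (by simpa [prog] using ih (some (.bit a)) (.bit (a && !eq) :: d))

/-- The digits of a number, lowest first, after the subtraction of a borrow. -/
def decBits : Bool → List Bool → List Bool
  | _, [] => []
  | c, x :: xs => (x ^^ c) :: decBits (c && !x) xs

/-- The borrow that remains after the subtraction of a borrow. -/
def borrow : Bool → List Bool → Bool
  | c, [] => c
  | c, x :: xs => borrow (c && !x) xs

/-- The digits of the predecessor of a number. -/
def predBits (ds : List Bool) : List Bool :=
  (decBits true ds).map fun x => x && !borrow true ds

theorem length_decBits (c : Bool) (ds : List Bool) : (decBits c ds).length = ds.length := by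
  induction ds generalizing c with
  | nil => rfl
  | cons x xs ih => simp [decBits, ih]

theorem length_predBits (ds : List Bool) : (predBits ds).length = ds.length := by
  rw [predBits, List.length_map, length_decBits]

theorem dec_loop (ds : List Bool) : Within (ds.length + 1) (cfg .dec ⟨cu, au, cn, eq, keep⟩
    ⟨i, z, b, ds.map .bit, u, t, p, v, q, w, f, g⟩)
    (cfg .rest ⟨none, au, cn, borrow eq ds, keep⟩
    ⟨i, z, ((decBits eq ds).map .bit).reverse ++ b, [],
      List.replicate (if borrow eq ds then 0 else 9) .sep ++ u, t, p, v, q, w, f, g⟩) := by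
  induction ds generalizing cu b eq with
  | nil =>
    refine .head ?_
    cases eq <;>
      simpa [prog, borrow, decBits, -List.reduceReplicate] using Within.refl _
  | cons a ds ih =>
    have h := ih (some (.bit a)) (eq && !a) (.bit (a ^^ eq) :: b)
    rw [borrow, decBits]
    exact .head (by simpa [prog] using h)

/-- The decremented digits arrive reversed on `bin`. Moving them back restores their order and
replaces them by zeros on underflow, so the predecessor is truncated. -/
theorem dec_rest (ds : List Bool) : Within (2 * ds.length + 2)
    (cfg .dec ⟨cu, au, cn, true, keep⟩ ⟨i, z, [], ds.map .bit, u, t, p, v, q, w, f, g⟩)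
    (cfg .pre ⟨none, au, cn, borrow true ds, keep⟩
    ⟨i, z, [], (predBits ds).map .bit,
      List.replicate (if borrow true ds then 0 else 9) .sep ++ u, t, p, v, q, w, f, g⟩) := by
  have h1 := dec_loop cu au cn true keep i z [] u t p v q w f g ds
  have h2 := rest_loop none au cn (borrow true ds) keep i z []
    (List.replicate (if borrow true ds then 0 else 9) .sep ++ u) t p v q w f g
    (decBits true ds).reverse
  rw [List.map_reverse, List.map_reverse, List.map_reverse, List.reverse_reverse,
    List.append_nil, List.length_reverse, length_decBits] at h2
  rw [List.append_nil] at h1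
  exact (h1.trans h2).mono (by omega)

/-- A row of the labelled adjacency matrix, with the indicator of the vertex cover. -/
abbrev Row : Type := Bool × List (Option (Fin 4))

/-- The encoding of a row. -/
def encRow (r : Row) : List Letter := .bit r.1 :: (r.2.map .entry ++ [.sep])

/-- The encoding of a list of rows. -/
def encRows (rs : List Row) : List Letter := rs.flatMap encRow

theorem encRow_append (r : Row) (l : List Letter) :
    encRow r ++ l = .bit r.1 :: (r.2.map .entry ++ .sep :: l) := by
  simp [encRow]

theorem reverse_encRow_append (r : Row) (l : List Letter) :
    (encRow r).reverse ++ l = .sep :: (r.2.reverse.map .entry ++ .bit r.1 :: l) := by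
  simp [encRow]

theorem length_encRow (r : Row) : (encRow r).length = r.2.length + 2 := by
  simp [encRow]

theorem encRows_cons (r : Row) (rs : List Row) : encRows (r :: rs) = encRow r ++ encRows rs := rfl

theorem encRows_append (rs rs' : List Row) : encRows (rs ++ rs') = encRows rs ++ encRows rs' :=
  List.flatMap_append

theorem length_le_length_encRows (rs : List Row) : rs.length ≤ (encRows rs).length := by
  induction rs with
  | nil => simp
  | cons r rs ih =>
    rw [encRows_cons, List.length_append, length_encRow, List.length_cons]
    omega

theorem pre_entries (es : List (Option (Fin 4))) : ∃ cu', Within es.length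
    (cfg .pre ⟨cu, au, cn, eq, keep⟩ ⟨es.map .entry ++ i, z, b, d, u, t, p, v, q, w, f, g⟩)
    (cfg .pre ⟨cu', au, cn, eq, keep⟩
      ⟨i, z, b, d, u, t, p, v, (es.map .entry).reverse ++ q, w, f, g⟩) := by
  induction es generalizing cu q with
  | nil => exact ⟨cu, Within.refl _⟩
  | cons a es ih =>
    obtain ⟨cu', h⟩ := ih (some (.entry a)) (.entry a :: q)
    exact ⟨cu', .head (by simpa [prog, -List.reduceReplicate] using h)⟩

/-- The number of tokens that a row contributes while the remaining number has digits `ds`. -/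
def rowTok (ds : List Bool) (r : Row) : ℕ :=
  (if borrow true ds then 0 else 9) + if r.1 then 10 else 0

theorem pre_row (ds : List Bool) (r : Row) : ∃ cu' eq', Within (r.2.length + 2 * ds.length + 4)
    (cfg .pre ⟨cu, au, cn, eq, keep⟩
      ⟨encRow r ++ i, z, [], ds.map .bit, u, t, p, v, q, w, f, g⟩)
    (cfg .pre ⟨cu', au, cn, eq', keep⟩
      ⟨i, z, [], (predBits ds).map .bit, List.replicate (rowTok ds r) .sep ++ u, t, p, v,
        (encRow r).reverse ++ q, w, f, g⟩) := by
  rw [encRow_append, reverse_encRow_append]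
  obtain ⟨cu', h⟩ := pre_entries (some (.bit r.1)) au cn eq keep (.sep :: i) z []
    (ds.map .bit) (List.replicate (if r.1 then 10 else 0) .sep ++ u) t p v (.bit r.1 :: q) w f g r.2
  have h1 := dec_rest (some .sep) au cn keep i z
    (List.replicate (if r.1 then 10 else 0) .sep ++ u) t p v
    (.sep :: ((r.2.map .entry).reverse ++ .bit r.1 :: q)) w f g ds
  have h2 : Within (2 * ds.length + 3) _ _ := Within.head (l := .pre)
    (m := ⟨cu', au, cn, eq, keep⟩)
    (r := ⟨.sep :: i, z, [], ds.map .bit, List.replicate (if r.1 then 10 else 0) .sep ++ u, t, p,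
      v, (r.2.map .entry).reverse ++ .bit r.1 :: q, w, f, g⟩)
    (c' := cfg .pre ⟨none, au, cn, borrow true ds, keep⟩
      ⟨i, z, [], (predBits ds).map .bit,
        List.replicate (if borrow true ds then 0 else 9) .sep ++
          (List.replicate (if r.1 then 10 else 0) .sep ++ u), t, p, v,
        .sep :: ((r.2.map .entry).reverse ++ .bit r.1 :: q), w, f, g⟩)
    (by simpa [prog, -List.reduceReplicate] using h1)
  have h3 := (h.trans h2).mono (n' := r.2.length + 2 * ds.length + 3) (by omega)
  refine ⟨none, borrow true ds, .head ?_⟩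
  rw [← List.append_assoc, List.replicate_append_replicate, ← rowTok] at h3
  cases hr : r.1 <;> rw [hr] at h3 <;>
    simpa [prog, -List.reduceReplicate] using h3

/-- The number of tokens that the rows contribute. -/
def preTok : List Bool → List Row → ℕ
  | _, [] => 0
  | ds, r :: rs => preTok (predBits ds) rs + rowTok ds r

/-- Of the digits left over only the length matters, for the running time: they are merely cleared
later. -/
theorem pre_loop (ds : List Bool) (rs : List Row) :
    ∃ (eq' : Bool) (ds' : List Bool), ds'.length = ds.length ∧
    Within ((encRows rs).length + rs.length * (2 * ds.length + 2) + 1)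
    (cfg .pre ⟨cu, au, cn, eq, keep⟩
      ⟨encRows rs, z, [], ds.map .bit, u, t, p, v, q, w, f, g⟩)
    (cfg .turn ⟨none, au, cn, eq', keep⟩
      ⟨[], z, [], ds'.map .bit, List.replicate (preTok ds rs) .sep ++ u, t, p, v,
        (encRows rs).reverse ++ q, w, f, g⟩) := by
  induction rs generalizing cu eq ds u q with
  | nil =>
    refine ⟨eq, ds, rfl, .mono (.head (n := 0) ?_) (by simp)⟩
    simpa [prog, encRows, preTok, -List.reduceReplicate] using Within.refl _
  | cons r rs ih =>
    obtain ⟨cu', eq', h⟩ := pre_row cu au cn eq keep (encRows rs) z u t p v q w f g ds r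
    obtain ⟨eq'', ds', hl, h'⟩ := ih cu' eq' (List.replicate (rowTok ds r) .sep ++ u)
      ((encRow r).reverse ++ q) (predBits ds)
    refine ⟨eq'', ds', hl.trans (length_predBits ds), ?_⟩
    rw [← List.append_assoc, List.replicate_append_replicate, ← List.append_assoc,
      ← List.reverse_append] at h'
    refine (h.trans h').mono ?_
    rw [length_predBits, encRows_cons, List.length_append, length_encRow, List.length_cons,
      Nat.succ_mul rs.length]
    omega

theorem read_entries (es : List (Option (Fin 4))) : ∃ cu', Within es.length
    (cfg .read ⟨cu, au, cn, eq, keep⟩ ⟨es.map .entry ++ i, z, b, d, u, t, p, v, q, w, f, g⟩)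
    (cfg .read ⟨cu', au, cn, eq, keep⟩
      ⟨i, z, b, d, u, t, (es.map .entry).reverse ++ p, (es.map .entry).reverse ++ v, q, w, f, g⟩)
    := by
  induction es generalizing cu p v with
  | nil => exact ⟨cu, Within.refl _⟩
  | cons a es ih =>
    obtain ⟨cu', h⟩ := ih (some (.entry a)) (.entry a :: p) (.entry a :: v)
    exact ⟨cu', .head (by simpa [prog] using h)⟩

theorem read_row (r : Row) : Within (r.2.length + 2)
    (cfg .read ⟨cu, au, cn, eq, keep⟩ ⟨encRow r ++ i, z, b, d, u, t, p, [], q, w, f, g⟩)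
    (cfg .scan ⟨some .sep, au, cn, eq, r.1⟩
      ⟨i, z, b, d, u, t, (encRow r).reverse ++ p, r.2.reverse.map .entry, q, w, f, g⟩) := by
  rw [encRow_append, reverse_encRow_append]
  obtain ⟨cu', h⟩ := read_entries (some (.bit r.1)) au cn eq r.1 (.sep :: i) z b d u t
    (.bit r.1 :: p) [] q w f g r.2
  have h2 : Within 1 _ _ := Within.head (l := .read)
    (m := ⟨cu', au, cn, eq, r.1⟩)
    (r := ⟨.sep :: i, z, b, d, u, t, (r.2.map .entry).reverse ++ .bit r.1 :: p,
      (r.2.map .entry).reverse ++ [], q, w, f, g⟩) (c' := cfg .scan ⟨some .sep, au, cn, eq, r.1⟩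
      ⟨i, z, b, d, u, t, .sep :: ((r.2.map .entry).reverse ++ .bit r.1 :: p),
      r.2.reverse.map .entry, q, w, f, g⟩)
    (by simpa [prog] using Within.refl _)
  exact .head (by simpa [prog] using h.trans h2)

/-- The comparison of two rows. -/
def cmpRun : Fin 4 × Bool → List (Option (Fin 4)) → List (Option (Fin 4)) → Fin 4 × Bool
  | s, x :: xs, y :: ys => cmpRun (cmpStep s x.isSome y.isSome) xs ys
  | s, _, _ => s

/-- Whether two vertices have the same last three neighbours. -/
def sameRow (es fs : List (Option (Fin 4))) : Bool :=
  (cmpRun (0, true) fs.reverse es.reverse).2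

theorem scan_entries (es fs : List (Option (Fin 4))) (h : es.length = fs.length) :
    ∃ cu' au', Within es.length
    (cfg .scan ⟨cu, au, cn, eq, keep⟩
      ⟨i, z, b, d, u, t, es.map .entry ++ p, fs.map .entry ++ v, q, w, f, g⟩)
    (cfg .scan ⟨cu', au', (cmpRun (cn, eq) es fs).1, (cmpRun (cn, eq) es fs).2, keep⟩
      ⟨i, z, b, d, u, t, p, v, (es.map .entry).reverse ++ q, (fs.map .entry).reverse ++ w, f, g⟩)
    := by
  induction es generalizing cu au cn eq q w fs with
  | nil =>
    obtain rfl := List.length_eq_zero_iff.1 h.symm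
    exact ⟨cu, au, Within.refl _⟩
  | cons x es ih =>
    obtain _ | ⟨y, fs⟩ := fs
    · simp at h
    obtain ⟨cu', au', h⟩ := ih (some (.entry x)) (some (.entry y))
      (cmpStep (cn, eq) x.isSome y.isSome).1 (cmpStep (cn, eq) x.isSome y.isSome).2
      (.entry x :: q) (.entry y :: w) fs (by simpa using h)
    exact ⟨cu', au', .head (by simpa [prog, cmpRun] using h)⟩

theorem restRow_loop : Within (w.length + 1) (cfg .restRow ⟨cu, au, cn, eq, keep⟩
    ⟨i, z, b, d, u, t, p, v, q, w, f, g⟩) (cfg .scan ⟨none, au, cn, eq, keep⟩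
    ⟨i, z, b, d, u, t, p, w.reverse ++ v, q, [], f, g⟩) := by
  induction w generalizing cu v with
  | nil => exact .head (by simpa [prog] using Within.refl _)
  | cons a w ih => exact .head (by simpa [prog] using ih (some a) (a :: v))

theorem restPrev_loop : Within (q.length + 1) (cfg .restPrev ⟨cu, au, cn, eq, keep⟩
    ⟨i, z, b, d, u, t, p, v, q, w, f, g⟩) (cfg .restTok ⟨none, au, cn, eq, keep⟩
    ⟨i, z, b, d, u, t, q.reverse ++ p, v, [], w, f, g⟩) := by
  induction q generalizing cu p with
  | nil => exact .head (by simpa [prog] using Within.refl _)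
  | cons a q ih => exact .head (by simpa [prog] using ih (some a) (a :: p))

theorem restTok_loop : Within (t.length + 1) (cfg .restTok ⟨cu, au, cn, eq, keep⟩
    ⟨i, z, b, d, u, t, p, v, q, w, f, g⟩) (cfg .clearRow ⟨none, au, cn, eq, keep⟩
    ⟨i, z, b, d, t.reverse ++ u, [], p, v, q, w, f, g⟩) := by
  induction t generalizing cu u with
  | nil => exact .head (by simpa [prog] using Within.refl _)
  | cons a t ih => exact .head (by simpa [prog] using ih (some a) (a :: u))

theorem clearRow_loop : Within (v.length + 1) (cfg .clearRow ⟨cu, au, cn, eq, keep⟩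
    ⟨i, z, b, d, u, t, p, v, q, w, f, g⟩) (cfg .read ⟨none, au, cn, eq, keep⟩
    ⟨i, z, b, d, u, t, p, [], q, w, .bit keep :: f, g⟩) := by
  induction v generalizing cu with
  | nil => exact .head (by simpa [prog] using Within.refl _)
  | cons a v ih => exact .head (by simpa [prog] using ih (some a))

theorem unPrev_loop : Within (p.length + 1) (cfg .unPrev ⟨cu, au, cn, eq, keep⟩
    ⟨i, z, b, d, u, t, p, v, q, w, f, g⟩) (cfg .unFlag ⟨none, au, cn, eq, keep⟩
    ⟨p.reverse ++ i, z, b, d, u, t, [], v, q, w, f, g⟩) := by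
  induction p generalizing cu i with
  | nil => exact .head (by simpa [prog] using Within.refl _)
  | cons a p ih => exact .head (by simpa [prog] using ih (some a) (a :: i))

theorem unFlag_loop : Within (f.length + 1) (cfg .unFlag ⟨cu, au, cn, eq, keep⟩
    ⟨i, z, b, d, u, t, p, v, q, w, f, g⟩) (cfg .emit ⟨none, au, cn, eq, keep⟩
    ⟨i, z, b, d, u, t, p, f.reverse ++ v, q, w, [], f.reverse ++ g⟩) := by
  induction f generalizing cu v g with
  | nil => exact .head (by simpa [prog] using Within.refl _)
  | cons a f ih => exact .head (by simpa [prog] using ih (some a) (a :: v) (a :: g))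

theorem restFlag_loop : Within (w.length + 1) (cfg .restFlag ⟨cu, au, cn, eq, keep⟩
    ⟨i, z, b, d, u, t, p, v, q, w, f, g⟩) (cfg .emit ⟨none, au, cn, eq, keep⟩
    ⟨i, z, b, d, u, t, p, w.reverse ++ v, q, [], f, g⟩) := by
  induction w generalizing cu v with
  | nil => exact .head (by simpa [prog] using Within.refl _)
  | cons a w ih => exact .head (by simpa [prog] using ih (some a) (a :: v))

theorem clearTok_loop : Within (u.length + 1) (cfg .clearTok ⟨cu, au, cn, eq, keep⟩
    ⟨i, z, b, d, u, t, p, v, q, w, f, g⟩) (cfg .clearDig ⟨none, au, cn, eq, keep⟩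
    ⟨i, z, b, d, [], t, p, v, q, w, f, g⟩) := by
  induction u generalizing cu with
  | nil => exact .head (by simpa [prog] using Within.refl _)
  | cons a u ih => exact .head (by simpa [prog] using ih (some a))

theorem clearDig_loop : Within (d.length + 1) (cfg .clearDig ⟨cu, au, cn, eq, keep⟩
    ⟨i, z, b, d, u, t, p, v, q, w, f, g⟩) (cfg .clearFlag ⟨none, au, cn, eq, keep⟩
    ⟨i, z, b, [], u, t, p, v, q, w, f, g⟩) := by
  induction d generalizing cu with
  | nil => exact .head (by simpa [prog] using Within.refl _)
  | cons a d ih => exact .head (by simpa [prog] using ih (some a))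

theorem clearFlag_loop : Within (v.length + 1) (cfg .clearFlag ⟨cu, au, cn, eq, keep⟩
    ⟨i, z, b, d, u, t, p, v, q, w, f, g⟩) (cfg .fin ⟨none, au, cn, eq, keep⟩
    ⟨i, z, b, d, u, t, p, [], q, w, f, g⟩) := by
  induction v generalizing cu with
  | nil => exact .head (by simpa [prog] using Within.refl _)
  | cons a v ih => exact .head (by simpa [prog] using ih (some a))

theorem fin_loop : Within (z.length + 1) (cfg .fin ⟨cu, au, cn, eq, keep⟩
    ⟨i, z, b, d, u, t, p, v, q, w, f, g⟩) ⟨none, initMem,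
    Regs.stk ⟨z.reverse ++ i, [], b, d, u, t, p, v, q, w, f, g⟩⟩ := by
  induction z generalizing cu i with
  | nil => exact .head (by simpa [prog] using Within.refl _)
  | cons a z ih => exact .head (by simpa [prog] using ih (some a) (a :: i))

/-- The rows read so far, the last one first and each one reversed. -/
def revRows (ws : List Row) : List Letter := ws.flatMap fun r => (encRow r).reverse

theorem revRows_cons (r : Row) (ws : List Row) :
    revRows (r :: ws) = (encRow r).reverse ++ revRows ws := rfl

theorem revRows_eq (ws : List Row) : revRows ws = (encRows ws.reverse).reverse := by
  induction ws with
  | nil => rfl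
  | cons r ws ih =>
    rw [revRows_cons, ih, List.reverse_cons, encRows_append, List.reverse_append]
    simp [encRows]

theorem length_revRows (ws : List Row) : (revRows ws).length = (encRows ws).length := by
  induction ws with
  | nil => rfl
  | cons r ws ih =>
    rw [revRows_cons, encRows_cons, List.length_append, List.length_append, ih,
      List.length_reverse]

/-- The number of tokens used when a row is compared with another one. -/
def useTok (es : List (Option (Fin 4))) (r : Row) : ℕ := if sameRow es r.2 then 1 else 0

/-- The truncated difference and the minimum account for a match when no token is left, which moves
nothing. -/
theorem scan_row (es : List (Option (Fin 4))) (r : Row) (hr : r.2.length = es.length) (a c : ℕ) :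
    ∃ cu' au' cn' eq', Within (2 * (encRow r).length)
    (cfg .scan ⟨cu, au, cn, eq, keep⟩
      ⟨i, z, b, d, List.replicate a .sep, List.replicate c .sep, (encRow r).reverse ++ p,
        es.reverse.map .entry, q, [], f, g⟩)
    (cfg .scan ⟨cu', au', cn', eq', keep⟩
      ⟨i, z, b, d, List.replicate (a - useTok es r) .sep,
        List.replicate (c + min a (useTok es r)) .sep, p,
        es.reverse.map .entry, encRow r ++ q, [], f, g⟩) := by
  rw [reverse_encRow_append, encRow_append, length_encRow]
  obtain ⟨cu', au', h⟩ := scan_entries (some .sep) au 0 true keep i z b d (List.replicate a .sep)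
    (List.replicate c .sep) (.bit r.1 :: p) [] (.sep :: q) [] f g r.2.reverse es.reverse
    (by simpa using hr)
  have hlast : ∀ cn', Within (es.length + 2)
      (cfg .scan ⟨cu', au', cn', sameRow es r.2, keep⟩
        ⟨i, z, b, d, List.replicate a .sep, List.replicate c .sep, .bit r.1 :: p, [],
          r.2.map .entry ++ .sep :: q, es.map .entry, f, g⟩)
      (cfg .scan ⟨none, au', cn', sameRow es r.2, keep⟩
      ⟨i, z, b, d, List.replicate (a - useTok es r) .sep,
        List.replicate (c + min a (useTok es r)) .sep, p,
        es.reverse.map .entry, .bit r.1 :: (r.2.map .entry ++ .sep :: q), [], f, g⟩) := by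
    intro cn'
    refine .head ?_
    have hloop := fun cu a' c' => restRow_loop cu au' cn' (sameRow es r.2) keep i z b d
      (List.replicate a' .sep) (List.replicate c' .sep) p []
      (.bit r.1 :: (r.2.map .entry ++ .sep :: q)) (es.map .entry) f g
    simp only [List.length_map, List.append_nil, ← List.map_reverse] at hloop
    cases hs : sameRow es r.2 with
    | false =>
      have := hloop (some (.bit r.1)) a c
      rw [hs] at this
      simpa [prog, useTok, hs] using this
    | true =>
      rw [hs] at hloop
      obtain _ | a := a
      · simpa [prog, useTok, hs] using hloop none 0 c
      · have := hloop (some .sep) a (c + 1)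
        simpa [prog, useTok, hs, List.replicate_succ] using this
  refine ⟨none, au', (cmpRun (0, true) r.2.reverse es.reverse).1, sameRow es r.2, ?_⟩
  have h2 : Within (es.length + 1) _ _ := Within.head (l := .scan) (m := ⟨cu, au, cn, eq, keep⟩)
    (r := ⟨i, z, b, d, List.replicate a .sep, List.replicate c .sep,
        .sep :: (r.2.reverse.map .entry ++ .bit r.1 :: p),
        es.reverse.map .entry, q, [], f, g⟩) (by simpa [prog, hr] using h)
  refine (h2.trans ?_).mono (n := es.length + 1 + (es.length + 2)) (by omega)
  have h3 := hlast (cmpRun (0, true) r.2.reverse es.reverse).1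
  simpa [sameRow] using h3

theorem scan_loop (es : List (Option (Fin 4))) (ws : List Row)
    (hw : ∀ r ∈ ws, r.2.length = es.length) (a c : ℕ) :
    ∃ au' cn' eq', Within (2 * (encRows ws).length + 1)
    (cfg .scan ⟨cu, au, cn, eq, keep⟩
      ⟨i, z, b, d, List.replicate a .sep, List.replicate c .sep, revRows ws,
        es.reverse.map .entry, q, [], f, g⟩)
    (cfg .restPrev ⟨none, au', cn', eq',
        keep || decide (0 < a - ws.countP fun r => sameRow es r.2)⟩
      ⟨i, z, b, d, List.replicate (a - ws.countP fun r => sameRow es r.2) .sep,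
        List.replicate (c + min a (ws.countP fun r => sameRow es r.2)) .sep, [],
        es.reverse.map .entry, encRows ws.reverse ++ q, [], f, g⟩) := by
  induction ws generalizing cu au cn eq a c q with
  | nil =>
    refine ⟨au, cn, eq, .mono (.head (n := 0) ?_) (by simp)⟩
    obtain _ | a := a
    · simpa [prog, revRows, encRows] using Within.refl _
    · simpa [prog, revRows, encRows, List.replicate_succ] using Within.refl _
  | cons r ws ih =>
    obtain ⟨cu', au', cn', eq', h⟩ := scan_row cu au cn eq keep i z b d (revRows ws) q f g es r
      (hw r (by simp)) a c
    obtain ⟨au'', cn'', eq'', h'⟩ := ih cu' au' cn' eq' (encRow r ++ q)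
      (fun r hr => hw r (by simp [hr])) (a - useTok es r) (c + min a (useTok es r))
    refine ⟨au'', cn'', eq'', ?_⟩
    have hc : (List.countP (fun r => sameRow es r.2) (r :: ws)) =
        useTok es r + List.countP (fun r => sameRow es r.2) ws := by
      rw [List.countP_cons, useTok, Nat.add_comm]
    have e1 : a - useTok es r - List.countP (fun r => sameRow es r.2) ws =
        a - (useTok es r + List.countP (fun r => sameRow es r.2) ws) := by omega
    have e2 : c + min a (useTok es r) +
        min (a - useTok es r) (List.countP (fun r => sameRow es r.2) ws) =
        c + min a (useTok es r + List.countP (fun r => sameRow es r.2) ws) := by omega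
    have e3 : encRows (r :: ws).reverse = encRows ws.reverse ++ encRow r := by
      rw [List.reverse_cons, encRows_append]; simp [encRows]
    rw [e1, e2] at h'
    rw [hc, e3, revRows_cons, List.append_assoc]
    refine (h.trans h').mono ?_
    rw [encRows_cons, List.length_append]
    omega

/-- Whether a vertex is kept, given the rows up to its own. -/
def keepFlag (N : ℕ) (ws : List Row) (r : Row) : Bool :=
  r.1 || decide (0 < N - ws.countP fun r' => sameRow r.2 r'.2)

theorem main_row (N : ℕ) (ws : List Row) (r : Row) (hw : ∀ r' ∈ ws, r'.2.length = r.2.length) :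
    ∃ au' cn' eq' keep', Within (3 * (encRows (r :: ws)).length + N + 2 * (encRow r).length + 3)
    (cfg .read ⟨cu, au, cn, eq, keep⟩
      ⟨encRow r ++ i, z, b, d, List.replicate N .sep, [], revRows ws, [], [], [], f, g⟩)
    (cfg .read ⟨none, au', cn', eq', keep'⟩
      ⟨i, z, b, d, List.replicate N .sep, [], revRows (r :: ws), [], [], [],
        .bit (keepFlag N (r :: ws) r) :: f, g⟩) := by
  have h1 := read_row cu au cn eq keep i z b d (List.replicate N .sep) [] (revRows ws) [] [] f g r
  rw [← revRows_cons] at h1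
  obtain ⟨au', cn', eq', h2⟩ := scan_loop (some .sep) au cn eq r.1 i z b d [] f g r.2 (r :: ws)
    (by simpa using hw) N 0
  rw [← keepFlag, Nat.zero_add, List.append_nil] at h2
  have h3 := restPrev_loop none au' cn' eq' (keepFlag N (r :: ws) r) i z b d
    (List.replicate (N - (r :: ws).countP fun r' => sameRow r.2 r'.2) .sep)
    (List.replicate (min N ((r :: ws).countP fun r' => sameRow r.2 r'.2)) .sep) []
    (r.2.reverse.map .entry) (encRows (r :: ws).reverse) [] f g
  rw [List.append_nil, ← revRows_eq] at h3
  have h4 := restTok_loop none au' cn' eq' (keepFlag N (r :: ws) r) i z b d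
    (List.replicate (N - (r :: ws).countP fun r' => sameRow r.2 r'.2) .sep)
    (List.replicate (min N ((r :: ws).countP fun r' => sameRow r.2 r'.2)) .sep) (revRows (r :: ws))
    (r.2.reverse.map .entry) [] [] f g
  -- The used and the unused tokens together are again all `N`, ready for the next row.
  rw [List.reverse_replicate, List.replicate_append_replicate,
    show ∀ c, min N c + (N - c) = N by intro c; omega] at h4
  have h5 := clearRow_loop none au' cn' eq' (keepFlag N (r :: ws) r) i z b d
    (List.replicate N .sep) [] (revRows (r :: ws)) (r.2.reverse.map .entry) [] [] f g
  refine ⟨au', cn', eq', _, ((((h1.trans h2).trans h3).trans h4).trans h5).mono ?_⟩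
  have e1 : (encRows (r :: ws).reverse).length = (encRows (r :: ws)).length := by
    rw [← length_revRows (r :: ws), revRows_eq, List.length_reverse]
  simp only [List.length_replicate, List.length_map, List.length_reverse, length_encRow]
  rw [e1]
  omega

/-- The flags of a list of rows, given the rows before them. -/
def flags (N : ℕ) : List Row → List Row → List Bool
  | _, [] => []
  | ws, r :: rs => keepFlag N (r :: ws) r :: flags N (r :: ws) rs

theorem length_flags (N : ℕ) (ws rs : List Row) : (flags N ws rs).length = rs.length := by
  induction rs generalizing ws with
  | nil => rfl
  | cons r rs ih => simp [flags, ih]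

/-- The bound `Y` on the total length of read and unread rows is invariant. Processing a row costs
at most `3 * Y` for scanning and restoring the earlier rows, `N` for the tokens, and `2 * Y` for
reading and clearing the row. -/
theorem main_loop (N m Y : ℕ) (ws rs : List Row) (hw : ∀ r ∈ ws, r.2.length = m)
    (hr : ∀ r ∈ rs, r.2.length = m) (hY : (encRows ws).length + (encRows rs).length ≤ Y) :
    ∃ au' cn' eq' keep', Within (rs.length * (5 * Y + N + 3) + 1)
    (cfg .read ⟨cu, au, cn, eq, keep⟩
      ⟨encRows rs, z, b, d, List.replicate N .sep, [], revRows ws, [], [], [], f, g⟩)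
    (cfg .unPrev ⟨none, au', cn', eq', keep'⟩
      ⟨[], z, b, d, List.replicate N .sep, [], revRows (rs.reverse ++ ws), [], [], [],
        ((flags N ws rs).map .bit).reverse ++ f, g⟩) := by
  induction rs generalizing cu au cn eq keep ws f with
  | nil =>
    refine ⟨au, cn, eq, keep, .mono (.head (n := 0) ?_) (by simp)⟩
    simpa [prog, encRows, flags] using Within.refl _
  | cons r rs ih =>
    have hr1 := hr r (by simp)
    obtain ⟨au', cn', eq', keep', h⟩ := main_row cu au cn eq keep (encRows rs) z b d f g N ws r
      (fun r' h' => (hw r' h').trans hr1.symm)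
    have hY' : (encRow r).length + (encRows ws).length + (encRows rs).length ≤ Y := by
      rw [encRows_cons, List.length_append] at hY
      omega
    obtain ⟨au'', cn'', eq'', keep'', h'⟩ := ih none au' cn' eq' keep'
      (.bit (keepFlag N (r :: ws) r) :: f) (r :: ws) (List.forall_mem_cons.2 ⟨hr1, hw⟩)
      (fun r h => hr r (by simp [h])) (by rw [encRows_cons, List.length_append]; omega)
    refine ⟨au'', cn'', eq'', keep'', ?_⟩
    rw [encRows_cons]
    have h2 := (h.trans h').mono (n' := (r :: rs).length * (5 * Y + N + 3) + 1) (by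
      rw [encRows_cons r ws, List.length_append, List.length_cons, Nat.succ_mul rs.length]
      omega)
    simpa [flags] using h2

/-- The entries of a list that are marked by a flag. -/
def select {α : Type} : List Bool → List α → List α
  | c :: cs, x :: xs => if c then x :: select cs xs else select cs xs
  | _, _ => []

theorem emit_entries (es : List (Option (Fin 4))) (cs : List Bool) (h : cs.length = es.length) :
    ∃ cu' au', Within es.length
    (cfg .emit ⟨cu, au, cn, eq, keep⟩
      ⟨es.map .entry ++ i, z, b, d, u, t, p, cs.map .bit ++ v, q, w, f, g⟩)
    (cfg .emit ⟨cu', au', cn, eq, keep⟩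
      ⟨i, (if keep then ((select cs es).map .entry).reverse else []) ++ z, b, d, u, t, p, v, q,
        (cs.map .bit).reverse ++ w, f, g⟩) := by
  induction es generalizing cu au z w cs with
  | nil =>
    obtain rfl := List.length_eq_zero_iff.1 h
    exact ⟨cu, au, by cases keep <;> exact Within.refl _⟩
  | cons x es ih =>
    obtain _ | ⟨c, cs⟩ := cs
    · simp at h
    obtain ⟨cu', au', h⟩ := ih (some (.entry x)) (some (.bit c))
      (if keep && c then .entry x :: z else z) (.bit c :: w) cs (by simpa using h)
    refine ⟨cu', au', .head ?_⟩
    cases keep <;> cases c <;> simpa [prog, select] using h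

/-- The row of the kernel that corresponds to a kept row. -/
def selectRow (cs : List Bool) (r : Row) : Row := (r.1, select cs r.2)

theorem emit_row (cs : List Bool) (r : Row) (h : cs.length = r.2.length) (k : Bool) :
    ∃ cu' au', Within (2 * (encRow r).length)
    (cfg .emit ⟨cu, au, cn, eq, keep⟩
      ⟨encRow r ++ i, z, b, d, u, t, p, cs.map .bit, q, [], f, .bit k :: g⟩)
    (cfg .emit ⟨cu', au', cn, eq, k⟩
      ⟨i, (if k then (encRow (selectRow cs r)).reverse else []) ++ z, b, d, u, t, p,
        cs.map .bit, q, [], f, g⟩) := by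
  rw [encRow_append, length_encRow]
  obtain ⟨cu', au', h1⟩ := emit_entries (some (.bit r.1)) (some (.bit k)) cn eq k (.sep :: i)
    (if k then .bit r.1 :: z else z) b d u t p [] q [] f g r.2 cs h
  have h2 := restFlag_loop (some .sep) au' cn eq k i
    ((if k then (encRow (selectRow cs r)).reverse else []) ++ z) b d u t p []
    q ((cs.map .bit).reverse) f g
  rw [List.reverse_reverse, List.append_nil, List.length_reverse, List.length_map, h] at h2
  refine ⟨none, au', ?_⟩
  have h3 : Within (r.2.length + 2) (cfg .emit ⟨cu', au', cn, eq, k⟩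
      ⟨.sep :: i, (if k then ((select cs r.2).map .entry).reverse else []) ++
        (if k then .bit r.1 :: z else z), b, d, u, t, p, [], q,
        (cs.map .bit).reverse ++ [], f, g⟩)
      (cfg .emit ⟨none, au', cn, eq, k⟩
      ⟨i, (if k then (encRow (selectRow cs r)).reverse else []) ++ z, b, d, u, t, p,
        cs.map .bit, q, [], f, g⟩) := .head (by
    cases k <;> simpa [prog, selectRow, encRow] using h2)
  rw [List.append_nil] at h1
  have h4 := h1.trans h3
  refine .mono (.head (n := r.2.length + (r.2.length + 2)) ?_) (by omega)
  cases k <;> simpa [prog] using h4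

theorem emit_loop (cs ks : List Bool) (rs : List Row) (h : ∀ r ∈ rs, cs.length = r.2.length)
    (hk : ks.length = rs.length) :
    ∃ au' keep', Within (2 * (encRows rs).length + 1)
    (cfg .emit ⟨cu, au, cn, eq, keep⟩
      ⟨encRows rs, z, b, d, u, t, p, cs.map .bit, q, [], f, ks.map .bit⟩)
    (cfg .clearTok ⟨none, au', cn, eq, keep'⟩
      ⟨[], (encRows ((select ks rs).map (selectRow cs))).reverse ++ z, b, d, u, t, p,
        cs.map .bit, q, [], f, []⟩) := by
  induction rs generalizing cu au keep z ks with
  | nil =>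
    obtain rfl := List.length_eq_zero_iff.1 hk
    refine ⟨au, keep, .mono (.head (n := 0) ?_) (by simp)⟩
    simpa [prog, encRows, select] using Within.refl _
  | cons r rs ih =>
    obtain _ | ⟨k, ks⟩ := ks
    · simp at hk
    obtain ⟨cu', au', h1⟩ := emit_row cu au cn eq keep (encRows rs) z b d u t p q f
      (ks.map .bit) cs r (h r (by simp)) k
    obtain ⟨au'', keep', h2⟩ := ih cu' au' k
      ((if k then (encRow (selectRow cs r)).reverse else []) ++ z) ks
      (fun r hr => h r (by simp [hr])) (by simpa using hk)
    refine ⟨au'', keep', ?_⟩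
    rw [encRows_cons]
    have h3 := (h1.trans h2).mono (n' := 2 * (encRow r ++ encRows rs).length + 1) (by
      rw [List.length_append]; omega)
    cases k <;> simpa [select, encRows_cons] using h3

theorem length_select_le {α : Type} (cs : List Bool) (xs : List α) :
    (select cs xs).length ≤ xs.length := by
  induction cs generalizing xs with
  | nil => simp [select]
  | cons c cs ih =>
    obtain _ | ⟨x, xs⟩ := xs
    · simp [select]
    · have := ih xs
      cases c <;> simp [select] <;> omega

theorem length_encRows_select_le (cs ks : List Bool) (rs : List Row) :
    (encRows ((select ks rs).map (selectRow cs))).length ≤ (encRows rs).length := by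
  induction rs generalizing ks with
  | nil => cases ks <;> simp [select, encRows]
  | cons r rs ih =>
    obtain _ | ⟨k, ks⟩ := ks
    · simp [select, encRows]
    · have h1 := ih ks
      have h2 := length_select_le cs r.2
      cases k
      · simp only [select, Bool.false_eq_true, if_false]
        rw [encRows_cons, List.length_append]
        omega
      · simp only [select, if_true, List.map_cons]
        rw [encRows_cons, encRows_cons, List.length_append, List.length_append, length_encRow,
          length_encRow, selectRow]
        simp only at h2 ⊢
        omega

theorem preTok_le (ds : List Bool) (rs : List Row) : preTok ds rs ≤ 19 * rs.length := by
  induction rs generalizing ds with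
  | nil => simp [preTok]
  | cons r rs ih =>
    have h1 := ih (predBits ds)
    have h2 : rowTok ds r ≤ 19 := by
      rw [rowTok]; split_ifs <;> omega
    rw [preTok, List.length_cons]
    omega

/-- The rows of the kernel. -/
def outRows (bs : List Bool) (rs : List Row) : List Row :=
  (select (flags (preTok bs rs + 29) [] rs) rs).map
    (selectRow (flags (preTok bs rs + 29) [] rs))

/-- The machine computes the kernel. -/
theorem run (bs : List Bool) (rs : List Row) (hr : ∀ r ∈ rs, r.2.length = rs.length) :
    Within (200 * (bs.length + 1 + (encRows rs).length + 1) ^ 2)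
    (cfg .bits initMem
      ⟨bs.map .bit ++ .sep :: encRows rs, [], [], [], [], [], [], [], [], [], [], []⟩)
    ⟨none, initMem, Regs.stk
      ⟨bs.map .bit ++ .sep :: encRows (outRows bs rs), [], [], [], [], [], [], [], [], [], [], []⟩⟩
    := by
  have h1 := bits_loop none none 0 false false (encRows rs) [] [] [] [] [] [] [] [] [] [] [] bs
  have h2 := rest_loop (some .sep) none 0 false false (encRows rs)
    (.sep :: ((bs.map .bit).reverse ++ [])) [] (List.replicate 29 .sep ++ []) [] [] [] [] [] [] []
    bs.reverse
  simp only [List.append_nil, Bool.not_false, Bool.and_true, List.map_id', List.map_reverse,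
    List.reverse_reverse, List.length_reverse] at h1 h2
  obtain ⟨eq₁, ds, hds, h3⟩ := pre_loop none none 0 false false (.sep :: (bs.map .bit).reverse)
    (List.replicate 29 .sep) [] [] [] [] [] [] [] bs rs
  rw [List.replicate_append_replicate, List.append_nil] at h3
  set N := preTok bs rs + 29 with hN
  have h4 := turn_loop none none 0 eq₁ false [] (.sep :: (bs.map .bit).reverse) []
    (ds.map .bit) (List.replicate N .sep) [] [] [] (encRows rs).reverse [] [] []
  rw [List.reverse_reverse, List.append_nil, List.length_reverse] at h4
  obtain ⟨au₁, cn₁, eq₂, keep₁, h5⟩ := main_loop none none 0 eq₁ false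
    (.sep :: (bs.map .bit).reverse) [] (ds.map .bit) [] [] N rs.length (encRows rs).length [] rs
    (by simp) hr (by simp [encRows])
  simp only [List.append_nil] at h5
  have h6 := unPrev_loop none au₁ cn₁ eq₂ keep₁ [] (.sep :: (bs.map .bit).reverse) []
    (ds.map .bit) (List.replicate N .sep) [] (revRows rs.reverse) [] [] []
    ((flags N [] rs).map .bit).reverse []
  rw [List.append_nil, length_revRows, revRows_eq, List.reverse_reverse, List.reverse_reverse] at h6
  have hrev : (encRows rs.reverse).length = (encRows rs).length := by
    rw [← length_revRows, revRows_eq, List.reverse_reverse, List.length_reverse]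
  rw [revRows_eq rs.reverse, List.reverse_reverse] at h5
  have h7 := unFlag_loop none au₁ cn₁ eq₂ keep₁ (encRows rs) (.sep :: (bs.map .bit).reverse) []
    (ds.map .bit) (List.replicate N .sep) [] [] [] [] [] ((flags N [] rs).map .bit).reverse []
  rw [List.reverse_reverse, List.append_nil, List.length_reverse, List.length_map,
    length_flags] at h7
  obtain ⟨au₂, keep₂, h8⟩ := emit_loop none au₁ cn₁ eq₂ keep₁ (.sep :: (bs.map .bit).reverse) []
    (ds.map .bit) (List.replicate N .sep) [] [] [] [] (flags N [] rs) (flags N [] rs) rs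
    (fun r h => (length_flags N [] rs).trans (hr r h).symm) (length_flags N [] rs)
  rw [hN, ← outRows, ← hN] at h8
  have hout := length_encRows_select_le (flags N [] rs) (flags N [] rs) rs
  rw [hN, ← outRows] at hout
  have h9 := clearTok_loop none au₂ cn₁ eq₂ keep₂ []
    ((encRows (outRows bs rs)).reverse ++ .sep :: (bs.map .bit).reverse) []
    (ds.map .bit) (List.replicate N .sep) [] [] ((flags N [] rs).map .bit) [] [] [] []
  have h10 := clearDig_loop none au₂ cn₁ eq₂ keep₂ []
    ((encRows (outRows bs rs)).reverse ++ .sep :: (bs.map .bit).reverse) []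
    (ds.map .bit) [] [] [] ((flags N [] rs).map .bit) [] [] [] []
  have h11 := clearFlag_loop none au₂ cn₁ eq₂ keep₂ []
    ((encRows (outRows bs rs)).reverse ++ .sep :: (bs.map .bit).reverse) []
    [] [] [] [] ((flags N [] rs).map .bit) [] [] [] []
  have h12 := fin_loop none au₂ cn₁ eq₂ keep₂ []
    ((encRows (outRows bs rs)).reverse ++ .sep :: (bs.map .bit).reverse) []
    [] [] [] [] [] [] [] [] []
  have e : ((encRows (outRows bs rs)).reverse ++
      Letter.sep :: (bs.map Letter.bit).reverse).reverse ++ [] =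
      bs.map Letter.bit ++ Letter.sep :: encRows (outRows bs rs) := by simp
  rw [e] at h12
  refine (((((((((((h1.trans h2).trans h3).trans h4).trans h5).trans h6).trans h7).trans
    h8).trans h9).trans h10).trans h11).trans h12).mono ?_
  have hn := length_le_length_encRows rs
  have hp := preTok_le bs rs
  simp only [List.length_replicate, List.length_map, List.length_append, List.length_reverse,
    List.length_cons, length_flags, hds, hrev]
  generalize (encRows rs).length = Y at *
  generalize (encRows (outRows bs rs)).length = Y' at *
  generalize rs.length = n at *
  generalize bs.length = L at *
  -- As the number of rows and of tokens is linear in `Y`, the sum of all phases is quadratic in `L`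
  -- and `Y`.
  have b1 : n * (2 * L + 2) ≤ Y * (2 * L + 2) := Nat.mul_le_mul_right _ hn
  have b2 : n * (5 * Y + N + 3) ≤ Y * (5 * Y + (19 * Y + 29) + 3) :=
    Nat.mul_le_mul hn (by omega)
  have b3 : N ≤ 19 * Y + 29 := by omega
  nlinarith [Nat.zero_le (Y * L), Nat.zero_le (L * L)]

end Machine

/-! ### The output of the machine is the encoded kernel -/

namespace Machine

/-- The value of a list of binary digits, lowest first. -/
def bitsVal : List Bool → ℕ
  | [] => 0
  | x :: xs => x.toNat + 2 * bitsVal xs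

theorem bitsVal_lt (ds : List Bool) : bitsVal ds < 2 ^ ds.length := by
  induction ds with
  | nil => simp [bitsVal]
  | cons x xs ih =>
    have := Bool.toNat_le x
    rw [bitsVal, List.length_cons, pow_succ]
    omega

theorem bitsVal_decBits (c : Bool) (ds : List Bool) :
    bitsVal (decBits c ds) + c.toNat = bitsVal ds + 2 ^ ds.length * (borrow c ds).toNat := by
  induction ds generalizing c with
  | nil => simp [bitsVal, decBits, borrow]
  | cons x xs ih =>
    have h := ih (c && !x)
    rw [decBits, borrow, bitsVal, bitsVal, List.length_cons, pow_succ, mul_assoc, mul_left_comm]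
    generalize 2 ^ xs.length * (borrow (c && !x) xs).toNat = t at *
    cases x <;> cases c <;> simp at * <;> omega

/-- The value of the digits is below `2 ^ ds.length`, the weight of a final borrow, so there is one
precisely if `1` cannot be subtracted. -/
theorem borrow_true_iff (ds : List Bool) : borrow true ds = true ↔ bitsVal ds = 0 := by
  have h1 := bitsVal_decBits true ds
  have h2 := bitsVal_lt (decBits true ds)
  rw [length_decBits] at h2
  cases h : borrow true ds <;> rw [h] at h1 <;> simp at * <;> omega

theorem bitsVal_predBits (ds : List Bool) : bitsVal (predBits ds) = bitsVal ds - 1 := by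
  rw [predBits]
  cases h : borrow true ds with
  | false =>
    have h1 := bitsVal_decBits true ds
    rw [h] at h1
    simp at *
    omega
  | true =>
    rw [(borrow_true_iff ds).1 h]
    have (xs : List Bool) : bitsVal (xs.map fun x => x && !true) = 0 := by
      induction xs with
      | nil => rfl
      | cons x xs ih => simpa [bitsVal] using ih
    exact this _

/-- A number decremented once per row, with truncation, is nonzero before exactly `min (bitsVal ds)
rs.length` of the decrements. -/
theorem preTok_eq (ds : List Bool) (rs : List Row) :
    preTok ds rs = 10 * rs.countP (fun r => r.1) + 9 * min (bitsVal ds) rs.length := by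
  induction rs generalizing ds with
  | nil => simp [preTok]
  | cons r rs ih =>
    have h := borrow_true_iff ds
    rw [preTok, ih, rowTok, bitsVal_predBits, List.countP_cons, List.length_cons]
    cases h' : borrow true ds <;> rw [h'] at h <;> cases r.1 <;> simp at * <;> omega

theorem bitsVal_encodePosNum (m : PosNum) : bitsVal (Computability.encodePosNum m) = m := by
  induction m with
  | one => rfl
  | bit0 m ih => simp [Computability.encodePosNum, bitsVal, ih, two_mul]
  | bit1 m ih => simp [Computability.encodePosNum, bitsVal, ih, two_mul, add_comm]

theorem bitsVal_encodeNat (m : ℕ) : bitsVal (Computability.encodeNat m) = m := by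
  have h : ((m : Num) : ℕ) = m := Num.to_of_nat m
  rw [Computability.encodeNat]
  generalize (m : Num) = x at h ⊢
  subst h
  cases x with
  | zero => rfl
  | pos p => exact bitsVal_encodePosNum p

theorem cmpRun_three {e : Bool} (xs ys : List (Option (Fin 4))) : cmpRun (3, e) xs ys = (3, e) := by
  induction xs generalizing ys with
  | nil => rfl
  | cons x xs ih => cases ys <;> simp [cmpRun, cmpStep, ih]

theorem cmpRun_false (c : Fin 4) (xs ys : List (Option (Fin 4))) :
    (cmpRun (c, false) xs ys).2 = false := by
  induction xs generalizing c ys with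
  | nil => rfl
  | cons x xs ih =>
    cases ys with
    | nil => rfl
    | cons y ys => rw [cmpRun, cmpStep]; split_ifs <;> simp [ih]

/-- As long as the rows agree, `c` counts the neighbours common to both. At the first index where
only one row has an edge, that index heads one truncated list and, without repetitions, is missing
from the other. -/
theorem cmpRun_map_iff {α : Type} (x y : α → Option (Fin 4)) (l : List α) (hl : l.Nodup)
    (c : Fin 4) : (cmpRun (c, true) (l.map x) (l.map y)).2 = true ↔
      (l.filter fun a => (x a).isSome).take (3 - c) =
        (l.filter fun a => (y a).isSome).take (3 - c) := by
  induction l generalizing c with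
  | nil => simp [cmpRun]
  | cons a l ih =>
    obtain ⟨ha, hl⟩ := List.nodup_cons.1 hl
    by_cases hc : c = 3
    · subst hc
      rw [cmpRun_three]
      simp
    have hk : 3 - (c : ℕ) = (2 - c) + 1 := by omega
    have hc' : ((c + 1 : Fin 4) : ℕ) = c + 1 :=
      (by decide : ∀ c : Fin 4, c ≠ 3 → ((c + 1 : Fin 4) : ℕ) = c + 1) c hc
    have hne (r : α → Bool) (k : ℕ) (t : List α) : (l.filter r).take (k + 1) ≠ a :: t := by
      intro h
      exact ha (List.mem_of_mem_filter (List.mem_of_mem_take (h ▸ List.mem_cons_self)))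
    rw [List.map_cons, List.map_cons, cmpRun, cmpStep, if_neg hc, List.filter_cons,
      List.filter_cons]
    cases hx : (x a).isSome <;> cases hy : (y a).isSome
    · simpa using ih hl c
    · simp only [Bool.false_eq_true, if_false, if_true]
      rw [hk, List.take_succ_cons]
      simpa [cmpRun_false] using hne _ _ _
    · simp only [Bool.false_eq_true, if_false, if_true]
      rw [hk, List.take_succ_cons]
      simpa [cmpRun_false, eq_comm] using hne _ _ _
    · have := ih hl (c + 1)
      rw [hc', Nat.add_comm, ← Nat.sub_sub] at this
      simp only [if_true]
      rw [hk, List.take_succ_cons, List.take_succ_cons]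
      simpa using this

theorem select_map {α β : Type} (P : α → Bool) (h : α → β) (l : List α) :
    select (l.map P) (l.map h) = (l.filter P).map h := by
  induction l with
  | nil => rfl
  | cons a l ih => cases hP : P a <;> simp [select, hP, ih]

end Machine

open Machine

namespace Instance

variable (I : Instance)

/-- The row of a vertex. -/
def row (v : Fin I.n) : Row := (decide (v ∈ I.C), (List.finRange I.n).map (I.label v))

/-- The rows of an instance. -/
def rows : List Row := (List.finRange I.n).map I.row

theorem encRow_row (v : Fin I.n) : encRow (I.row v) = I.encodeRow v := by
  simp [encRow, row, encodeRow, Function.comp_def]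

theorem encode_eq : I.encode =
    (Computability.encodeNat I.b).map .bit ++ .sep :: encRows I.rows := by
  simp [encode, encRows, rows, List.flatMap_map, encRow_row]

theorem length_rows : I.rows.length = I.n := by simp [rows]

theorem length_row {r : Row} (h : r ∈ I.rows) : r.2.length = I.rows.length := by
  obtain ⟨v, -, rfl⟩ := List.mem_map.1 h
  simp [row, rows]

theorem isSome_label (v w : Fin I.n) : (I.label v w).isSome = true ↔ I.G.Adj v w := by
  rw [label]; split_ifs with h <;> simp [h]

theorem sameRow_row_iff (v w : Fin I.n) :
    sameRow (I.row v).2 (I.row w).2 = true ↔ I.nbrs w = I.nbrs v := by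
  classical
  rw [sameRow, row, row, ← List.map_reverse, ← List.map_reverse, cmpRun_map_iff _ _ _
    (List.nodup_reverse.2 (List.nodup_finRange _)), nbrs, nbrs]
  simp only [← I.isSome_label]
  simp

theorem preTok_rows : preTok (Computability.encodeNat I.b) I.rows + 29 = I.cap := by
  have h : I.rows.countP (fun r => r.1) = I.C.card := by
    rw [rows, List.countP_map, List.countP_eq_length_filter,
      ← List.toFinset_card_of_nodup ((List.nodup_finRange _).filter _)]
    congr 1
    ext v
    simp [row]
  rw [preTok_eq, bitsVal_encodeNat, h, length_rows, cap]
  omega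

open Classical in
-- The rows come in increasing order of the vertices, so those read up to `v` are exactly those of
-- the `w ≤ v`.
theorem rank_eq_countP {v : Fin I.n} {l l' : List (Fin I.n)}
    (h : l.reverse ++ v :: l' = List.finRange I.n) :
    I.rank v = (v :: l).countP fun w => decide (I.nbrs w = I.nbrs v) := by
  have hs : (l.reverse ++ v :: l').Pairwise (· < ·) := h ▸ List.pairwise_lt_finRange _
  have hm (w : Fin I.n) : w ∈ l.reverse ++ v :: l' := h ▸ List.mem_finRange w
  rw [List.pairwise_append, List.pairwise_cons] at hs
  obtain ⟨h1, ⟨h2, -⟩, h3⟩ := hs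
  have hl : (v :: l).Nodup := by
    refine List.nodup_cons.2 ⟨fun hv => ?_, ?_⟩
    · exact lt_irrefl _ (h3 v (by simpa using hv) v (by simp))
    · exact List.nodup_reverse.1 (h1.imp fun h => ne_of_lt h)
  rw [List.countP_eq_length_filter, ← List.toFinset_card_of_nodup (hl.filter _), rank]
  congr 1
  ext w
  have key : w ≤ v ↔ w ∈ v :: l := by
    constructor
    · intro hw
      have := hm w
      simp only [List.mem_append, List.mem_reverse, List.mem_cons] at this ⊢
      rcases this with h | h | h
      · exact .inr h
      · exact .inl h
      · exact absurd hw (not_le.2 (h2 w h))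
    · intro hw
      rcases List.mem_cons.1 hw with rfl | hw
      · exact le_rfl
      · exact (h3 w (by simpa using hw) v (by simp)).le
  simp only [Finset.mem_filter, Finset.mem_univ, true_and, List.mem_toFinset, List.mem_filter, key,
    decide_eq_true_eq]

open Classical in
-- The list `l` holds the vertices already processed, last one first. The tokens left for `v` number
-- `cap - rank v`, truncated, so one remains exactly if `rank v < cap`.
theorem flags_map_row {l l' : List (Fin I.n)} (h : l.reverse ++ l' = List.finRange I.n) :
    flags I.cap (l.map I.row) (l'.map I.row) = l'.map fun v => decide (I.Kept v) := by
  induction l' generalizing l with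
  | nil => rfl
  | cons v l' ih =>
    rw [List.map_cons, flags, ← List.map_cons, ih (l := v :: l) (by simpa using h), List.map_cons]
    congr 1
    rw [keepFlag, ← List.map_cons, List.countP_map, Bool.eq_iff_iff]
    have hc : List.countP ((fun r' => sameRow (I.row v).2 r'.2) ∘ I.row) (v :: l) = I.rank v := by
      rw [I.rank_eq_countP h]
      refine List.countP_congr fun w _ => ?_
      simp [sameRow_row_iff]
    rw [hc]
    simp only [row, Bool.or_eq_true, decide_eq_true_eq, Nat.sub_pos_iff_lt]
    rfl

theorem flags_rows : flags I.cap [] I.rows =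
    (List.finRange I.n).map (fun v => @decide (I.Kept v) (Classical.propDecidable _)) :=
  I.flags_map_row (l := []) rfl

theorem outRows_rows : outRows (Computability.encodeNat I.b) I.rows =
    I.keptList.map fun v => (decide (v ∈ I.C), I.keptList.map (I.label v)) := by
  rw [outRows, preTok_rows, flags_rows, rows, select_map, List.map_map]
  refine List.map_congr_left fun v _ => ?_
  simp only [Function.comp_apply, selectRow, row, select_map]
  rfl

theorem rows_kernel : I.kernel.rows = outRows (Computability.encodeNat I.b) I.rows := by
  have h {β : Type} (g : Fin I.n → β) :
      I.keptList.map g = (List.finRange I.keptList.length).map (g ∘ I.keptList.get) := by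
    rw [← List.map_map, List.map_get_finRange]
  rw [outRows_rows, h]
  refine List.map_congr_left fun i _ => Prod.ext ?_ ?_
  · exact decide_eq_decide.2 I.mem_C_kernel
  · exact (h (I.label (I.keptList.get i))).symm

end Instance

/-! ### The machine as a polynomial-time computation of the kernel -/

namespace Machine

instance : Fintype Letter := Fintype.ofFinite _
instance : Fintype Mem := Fintype.ofFinite _

/-- The machine. -/
def machine : Turing.FinTM2 where
  K := Stack
  k₀ := .inp
  k₁ := .inp
  Γ _ := Letter
  Λ := Label
  main := .bits
  σ := Mem
  initialState := initMem
  Γk₀Fin := inferInstanceAs (Fintype Letter)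
  m := prog

theorem initList_machine (l : List Letter) : Turing.initList machine l =
    cfg .bits initMem ⟨l, [], [], [], [], [], [], [], [], [], [], []⟩ := by
  refine congrArg (Turing.TM2.Cfg.mk _ _) (funext fun k => ?_)
  cases k <;> rfl

theorem haltList_machine (l : List Letter) : Turing.haltList machine l =
    ⟨none, initMem, Regs.stk ⟨l, [], [], [], [], [], [], [], [], [], [], []⟩⟩ := by
  refine congrArg (Turing.TM2.Cfg.mk _ _) (funext fun k => ?_)
  cases k <;> rfl

end Machine

namespace Instance

theorem run_encode (I : Instance) : Within (200 * (I.encode.length + 1) ^ 2)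
    (Turing.initList machine I.encode) (Turing.haltList machine I.kernel.encode) := by
  rw [initList_machine, haltList_machine, encode_eq, encode_eq, rows_kernel]
  refine (run _ _ fun r h => I.length_row h).mono ?_
  rw [List.length_append, List.length_map, List.length_cons]
  exact le_of_eq (by ring)

/-- The kernel is computable in polynomial time. -/
def kernelPolyTime : Turing.TM2ComputableInPolyTime encode encode kernel where
  tm := machine
  inputAlphabet := Equiv.refl _
  outputAlphabet := Equiv.refl _
  time := 200 * (Polynomial.X + 1) ^ 2
  outputsFun I := by
    have h := I.run_encode
    refine ⟨⟨h.choose, ?_⟩, ?_⟩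
    · have h2 := h.choose_spec.2
      have hid (l : List Letter) : l.map (Equiv.refl Letter).invFun = l := List.map_id l
      exact (congrArg (fun l => (flip bind (Turing.TM2.step prog))^[h.choose]
        (some (Turing.initList machine l))) (hid I.encode)).trans
        (h2.trans (congrArg (fun l => some (Turing.haltList machine l)) (hid I.kernel.encode).symm))
    · have h1 := h.choose_spec.1
      simpa using h1

end Instance

end RACDrawing

end

theorem theorem13 :
    ∃ f : RACDrawing.Instance → RACDrawing.Instance,
      RACDrawing.IsKernelization RACDrawing.Instance.encode RACDrawing.Instance.IsYes
        RACDrawing.Instance.param f ∧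
      ∃ c : ℕ, ∀ I : RACDrawing.Instance, (f I).size ≤ c * ((I.b + 1) * 2 ^ I.k) :=
  ⟨RACDrawing.Instance.kernel, ⟨⟨RACDrawing.Instance.kernelPolyTime⟩,
    RACDrawing.Instance.kernel_correct, RACDrawing.Instance.lengthBound,
    RACDrawing.Instance.computable_lengthBound, fun I =>
      ⟨I.kernel_param_le, I.length_encode_kernel_le⟩⟩, 115200, fun I => I.kernel_size_le⟩
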